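/- There is a single algorithm with the following property. Its input consists of - a directed graph $G=(V,E)$ with $n=|V|\ge 1$ vertices, given by the list of its arcs, with arbitrary rational arc weights $w:E\to\mathbb{Q}$ (a weighted undirected graph is the special case in which every edge is listed in both orientations with the same weight), and - a small tree decomposition of $G$: a rooted tree with at most $4(n+1)$ nodes $i$ and bags $X_i\subseteq V$, such that every vertex lies in some bag, the two ends of every arc lie in a common bag, and for every vertex $v$ the nodes $i$ with $v\in X_i$ induce a connected subtree. The tree is given by its parent pointers and its root, the bags as bit vectors of length $n$. Let $t=\max_i|X_i|-1$ be the width of the decomposition, and for $S\subseteq V$ let $\alpha(\partial S)=\sum_{uv\in E,\ u\in S,\ v\notin S}w(uv)$. The algorithm outputs a set $S\subseteq V$ that maximizes $\alpha(\partial S)$ among all sets with $\bigl||S|-|V\setminus S|\bigr|\le 1$, together with the maximum value. Its running time is $O(2^t n^2)$ with an absolute constant, on a unit-cost random access machine whose integer words have $O(t+\log (n+1))$ bits and which adds, subtracts and compares weights in one step each. -/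

import Mathlib

/-! ## Weighted directed graphs, cuts, bisections

The graph has vertex type `V`, a finite set `E` of arcs (ordered pairs) and rational arc
weights `w` (only the values on `E` matter). An undirected graph is the special case in which
`E` and `w` are symmetric: each undirected edge is replaced by its two orientations. -/

/-- The size `α(∂S)` of the cut `S`: the total weight of all arcs from `S` to `V \ S`. -/
def cutValue {V : Type*} [DecidableEq V] (E : Finset (V × V)) (w : V × V → ℚ)
    (S : Finset V) : ℚ :=
  ∑ e ∈ E with e.1 ∈ S ∧ e.2 ∉ S, w e

/-- `S` is a bisection: `| |S| - |V \ S| | ≤ 1`. -/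
def IsBisection {V : Type*} [Fintype V] [DecidableEq V] (S : Finset V) : Prop :=
  |(S.card : ℤ) - (Sᶜ.card : ℤ)| ≤ 1

/-- `S` is an optimal solution of the weighted Max-Bisection problem. -/
def IsMaxBisection {V : Type*} [Fintype V] [DecidableEq V] (E : Finset (V × V))
    (w : V × V → ℚ) (S : Finset V) : Prop :=
  IsBisection S ∧ ∀ S' : Finset V, IsBisection S' → cutValue E w S' ≤ cutValue E w S

/-! ## Tree decompositions -/

/-- A (rooted) tree decomposition, with nodes `I`, of the graph with vertices `V` and arcs `E`. -/
structure TreeDecomposition {V : Type*} (E : Finset (V × V)) (I : Type*) where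
  tree : SimpleGraph I
  isTree : tree.IsTree
  root : I
  bag : I → Finset V
  node_coverage : ∀ v : V, ∃ i, v ∈ bag i
  edge_coverage : ∀ e ∈ E, ∃ i, e.1 ∈ bag i ∧ e.2 ∈ bag i
  coherence : ∀ v : V, (tree.induce {i | v ∈ bag i}).Connected

namespace TreeDecomposition

variable {V I : Type*} {E : Finset (V × V)}

/-- The width: largest cardinality of a bag, minus `1`. (If `V` is nonempty then some bag is
nonempty, so that the subtraction does not truncate.) -/
def width [Fintype I] (D : TreeDecomposition E I) : ℕ :=
  (Finset.univ.sup fun i => (D.bag i).card) - 1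

/-- The parent of the node `i`: the second node on the unique path from `i` to the root.
By convention the parent of the root is the root itself. -/
noncomputable def parent (D : TreeDecomposition E I) (i : I) : I :=
  (D.isTree.existsUnique_path i D.root).choose.snd

/-- A decomposition is small if it has at most `4 (|V| + 1)` nodes. -/
def IsSmall [Fintype V] [Fintype I] (_D : TreeDecomposition E I) : Prop :=
  Fintype.card I ≤ 4 * (Fintype.card V + 1)

end TreeDecomposition

/-! ## The machine model: a word RAM with unit costs

Programs are structured (assignments, sequencing, branching, loops) and use a fixed finite
number of registers and arrays: the names of registers and arrays are constants of the program,
the indices into the arrays are computed. There are two sorts of cells: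
* *word* cells hold natural numbers that must not exceed a bound `B` (the word size is
  `log₂ (B + 1)` bits); a computation that produces a larger number anywhere gets stuck;
* *weight* cells hold rational numbers, which can only be copied, added, subtracted and compared.
Every operation, every memory access and every test costs one step. -/

namespace WordRAM

/-- A memory state: word registers, word arrays, weight registers, weight arrays. -/
@[ext]
structure State where
  reg : ℕ → ℕ
  arr : ℕ → ℕ → ℕ
  wreg : ℕ → ℚ
  warr : ℕ → ℕ → ℚ

/-- Word expressions. -/
inductive Expr
  | const (k : ℕ)
  | reg (r : ℕ)
  | arr (a : ℕ) (i : Expr)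
  | add (x y : Expr)
  | sub (x y : Expr)
  | mul (x y : Expr)
  | div (x y : Expr)
  | mod (x y : Expr)

namespace Expr

/-- The value of a word expression (subtraction is truncated at `0`). -/
def eval (s : State) : Expr → ℕ
  | const k => k
  | reg r => s.reg r
  | arr a i => s.arr a (i.eval s)
  | add x y => x.eval s + y.eval s
  | sub x y => x.eval s - y.eval s
  | mul x y => x.eval s * y.eval s
  | div x y => x.eval s / y.eval s
  | mod x y => x.eval s % y.eval s

/-- The number of steps needed for evaluating a word expression. -/
def cost : Expr → ℕ
  | const _ => 1
  | reg _ => 1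
  | arr _ i => i.cost + 1
  | add x y => x.cost + y.cost + 1
  | sub x y => x.cost + y.cost + 1
  | mul x y => x.cost + y.cost + 1
  | div x y => x.cost + y.cost + 1
  | mod x y => x.cost + y.cost + 1

/-- All numbers that occur in the evaluation of the expression, including the indices of
array cells and all intermediate results, are at most `B`. -/
def Fits (B : ℕ) (s : State) : Expr → Prop
  | const k => k ≤ B
  | reg r => s.reg r ≤ B
  | arr a i => i.Fits B s ∧ s.arr a (i.eval s) ≤ B
  | add x y => x.Fits B s ∧ y.Fits B s ∧ x.eval s + y.eval s ≤ B
  | sub x y => x.Fits B s ∧ y.Fits B s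
  | mul x y => x.Fits B s ∧ y.Fits B s ∧ x.eval s * y.eval s ≤ B
  | div x y => x.Fits B s ∧ y.Fits B s
  | mod x y => x.Fits B s ∧ y.Fits B s

end Expr

/-- Weight expressions. -/
inductive WExpr
  | zero
  | reg (r : ℕ)
  | arr (a : ℕ) (i : Expr)
  | add (x y : WExpr)
  | sub (x y : WExpr)

namespace WExpr

/-- The value of a weight expression. -/
def eval (s : State) : WExpr → ℚ
  | zero => 0
  | reg r => s.wreg r
  | arr a i => s.warr a (i.eval s)
  | add x y => x.eval s + y.eval s
  | sub x y => x.eval s - y.eval s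

/-- The number of steps needed for evaluating a weight expression. -/
def cost : WExpr → ℕ
  | zero => 1
  | reg _ => 1
  | arr _ i => i.cost + 1
  | add x y => x.cost + y.cost + 1
  | sub x y => x.cost + y.cost + 1

/-- All indices of array cells occurring in the expression respect the word bound `B`. -/
def Fits (B : ℕ) (s : State) : WExpr → Prop
  | zero => True
  | reg _ => True
  | arr _ i => i.Fits B s
  | add x y => x.Fits B s ∧ y.Fits B s
  | sub x y => x.Fits B s ∧ y.Fits B s

end WExpr

/-- Tests: comparisons of two words or of two weights. -/
inductive Test
  | le (x y : Expr)
  | lt (x y : Expr)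
  | eq (x y : Expr)
  | wle (x y : WExpr)
  | wlt (x y : WExpr)

namespace Test

/-- The test succeeds. -/
def Holds (s : State) : Test → Prop
  | le x y => x.eval s ≤ y.eval s
  | lt x y => x.eval s < y.eval s
  | eq x y => x.eval s = y.eval s
  | wle x y => x.eval s ≤ y.eval s
  | wlt x y => x.eval s < y.eval s

/-- The number of steps needed for a test. -/
def cost : Test → ℕ
  | le x y => x.cost + y.cost + 1
  | lt x y => x.cost + y.cost + 1
  | eq x y => x.cost + y.cost + 1
  | wle x y => x.cost + y.cost + 1
  | wlt x y => x.cost + y.cost + 1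

/-- The evaluation of the test respects the word bound `B`. -/
def Fits (B : ℕ) (s : State) : Test → Prop
  | le x y => x.Fits B s ∧ y.Fits B s
  | lt x y => x.Fits B s ∧ y.Fits B s
  | eq x y => x.Fits B s ∧ y.Fits B s
  | wle x y => x.Fits B s ∧ y.Fits B s
  | wlt x y => x.Fits B s ∧ y.Fits B s

end Test

/-- Programs. -/
inductive Prog
  | skip
  | setReg (r : ℕ) (x : Expr)
  | setArr (a : ℕ) (i x : Expr)
  | setWReg (r : ℕ) (x : WExpr)
  | setWArr (a : ℕ) (i : Expr) (x : WExpr)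
  | seq (p q : Prog)
  | ite (b : Test) (p q : Prog)
  | while (b : Test) (p : Prog)

namespace State

def setReg (s : State) (r x : ℕ) : State :=
  { s with reg := Function.update s.reg r x }

def setArr (s : State) (a i x : ℕ) : State :=
  { s with arr := Function.update s.arr a (Function.update (s.arr a) i x) }

def setWReg (s : State) (r : ℕ) (x : ℚ) : State :=
  { s with wreg := Function.update s.wreg r x }

def setWArr (s : State) (a i : ℕ) (x : ℚ) : State :=
  { s with warr := Function.update s.warr a (Function.update (s.warr a) i x) }

end State

/-- `Exec B p s T s'`: with word bound `B`, the program `p` started in the state `s` halts after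
exactly `T` steps in the state `s'`, and no number exceeds the word bound on the way. -/
inductive Exec (B : ℕ) : Prog → State → ℕ → State → Prop
  | skip (s : State) : Exec B .skip s 1 s
  | setReg (s : State) (r : ℕ) (x : Expr) (hx : x.Fits B s) :
      Exec B (.setReg r x) s (x.cost + 1) (s.setReg r (x.eval s))
  | setArr (s : State) (a : ℕ) (i x : Expr) (hi : i.Fits B s) (hx : x.Fits B s) :
      Exec B (.setArr a i x) s (i.cost + x.cost + 1) (s.setArr a (i.eval s) (x.eval s))
  | setWReg (s : State) (r : ℕ) (x : WExpr) (hx : x.Fits B s) :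
      Exec B (.setWReg r x) s (x.cost + 1) (s.setWReg r (x.eval s))
  | setWArr (s : State) (a : ℕ) (i : Expr) (x : WExpr) (hi : i.Fits B s) (hx : x.Fits B s) :
      Exec B (.setWArr a i x) s (i.cost + x.cost + 1) (s.setWArr a (i.eval s) (x.eval s))
  | seq (p q : Prog) (s s₁ s₂ : State) (T₁ T₂ : ℕ) (hp : Exec B p s T₁ s₁)
      (hq : Exec B q s₁ T₂ s₂) : Exec B (.seq p q) s (T₁ + T₂) s₂
  | ite_true (b : Test) (p q : Prog) (s s' : State) (T : ℕ) (hf : b.Fits B s)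
      (hb : b.Holds s) (hp : Exec B p s T s') : Exec B (.ite b p q) s (b.cost + T) s'
  | ite_false (b : Test) (p q : Prog) (s s' : State) (T : ℕ) (hf : b.Fits B s)
      (hb : ¬ b.Holds s) (hq : Exec B q s T s') : Exec B (.ite b p q) s (b.cost + T) s'
  | while_true (b : Test) (p : Prog) (s s₁ s₂ : State) (T₁ T₂ : ℕ) (hf : b.Fits B s)
      (hb : b.Holds s) (hp : Exec B p s T₁ s₁) (hw : Exec B (.while b p) s₁ T₂ s₂) :
      Exec B (.while b p) s (b.cost + T₁ + T₂) s₂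
  | while_false (b : Test) (p : Prog) (s : State) (hf : b.Fits B s) (hb : ¬ b.Holds s) :
      Exec B (.while b p) s b.cost s

end WordRAM

/-! ## Input and output conventions -/

/-- The initial memory. The vertices are `0, …, n - 1`, the nodes of the decomposition are
`0, …, N - 1`.
* word registers `0, 1, 2, 3`: `n`, `N`, the root, the number of arcs;
* word array `0`: the parent of every node;
* word array `1`: the bags as bit vectors of length `n`, one after the other;
* word arrays `2`, `3` and weight array `0`: tails, heads and weights of the listed arcs.
Every other cell is `0`. -/
noncomputable def inputState {n N : ℕ} {E : Finset (Fin n × Fin n)}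
    (arcs : List (Fin n × Fin n)) (w : Fin n × Fin n → ℚ)
    (D : TreeDecomposition E (Fin N)) : WordRAM.State where
  reg
    | 0 => n
    | 1 => N
    | 2 => D.root
    | 3 => arcs.length
    | _ => 0
  arr
    | 0 => fun i => if h : i < N then D.parent ⟨i, h⟩ else 0
    | 1 => fun k => if ∃ i : Fin N, ∃ v : Fin n, k = i * n + v ∧ v ∈ D.bag i then 1 else 0
    | 2 => fun k => (arcs.map fun e => (e.1 : ℕ)).getD k 0
    | 3 => fun k => (arcs.map fun e => (e.2 : ℕ)).getD k 0
    | _ => fun _ => 0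
  wreg := fun _ => 0
  warr
    | 0 => fun k => (arcs.map w).getD k 0
    | _ => fun _ => 0

/-- The final memory shows an optimal bisection `S` (as a bit vector in word array `4`) and the
optimal value (in weight register `0`). -/
def IsCorrectOutput {n : ℕ} (E : Finset (Fin n × Fin n)) (w : Fin n × Fin n → ℚ)
    (s : WordRAM.State) : Prop :=
  ∃ S : Finset (Fin n), IsMaxBisection E w S ∧
    (∀ v : Fin n, s.arr 4 v = if v ∈ S then 1 else 0) ∧ s.wreg 0 = cutValue E w S

/-!
The algorithm is dynamic programming over the nodes of the tree. Each node `j` starts with the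
vertices of its bag; merging it into its parent `p`, after all its own children, joins the two
vertex sets, which then meet only in the intersection of the two bags (`Inst.Forest.verts_inter`).
A partial solution `U` on the vertices merged into a node matters to the rest only through its
trace `S` on the bag and the number `k` of its vertices outside the bag, so a table keeps a best
`U` for each pair `(S, k)`. A merge takes two tables: one shows the partial solutions of `j`
relative to the bag of `p` (`Fam.forget`), the other combines these with those of `p` (`Fam.join`,
`Fam.split`). In the end the root knows a best vertex set of every size, hence a best bisection.
No arc is counted twice, because each is charged to one node that contains its two ends.

Two points make the running time `O(2 ^ t * n ^ 2)`, without a factor for the number of tree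
nodes or for the bag size. The join of `p` with `a` and `j` with `b` vertices outside the bag of
`p` takes about `2 ^ t * (a + 1) * (b + 1)` steps, and this product is bounded by the growth of
the sum of the squares of the sizes (`Inst.Forest.pot_merge`), so that all joins together take
`O(2 ^ t * (n + N) ^ 2)` steps for `N` nodes (`Inst.Forest.pot_le`). The translation of a mask
from one bag to another takes `O(n)` steps and is done once for each of the `O(2 ^ t * N)` rows of
the tables (`Inst.proj_spec`), not once for each entry. The tables do not contain vertex sets, but
each entry points to the two entries from which it was made. A cell lies above the cells to which
it points, so a single downward sweep marks everything below the optimal entry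
(`Inst.follow_spec`), and the marked cells of the initial tables give the solution.

The semantics of programs is handled by a weakest precondition with a clock, `WordRAM.WP`. Its
consequence rule `WordRAM.WP.mono` provides that cells to which a program does not assign stay
unchanged. A loop that collects something is described by the union over its passes
(`WordRAM.WP.for_union`). Thus the content of a table is a set of offers (`Inst.Offers`), in which
the order of the passes is irrelevant.

Numbers in the descriptions of programs are the numbers of the registers that hold the objects.
Beyond the input, the memory is used as follows. Word register `4` is the largest number of
subsets of a bag, `5` the first unused table, `0` and `1` are the input parameters `n` and `N`.
The word arrays are `4` the output, `5` the weights of the bits in masks, `6` the numbers of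
subsets of the bags, `7` common nodes of pairs of vertices, `8` the flags of nonempty table cells,
`9` the tables of the nodes, `10` the depths, `11` the numbers of vertices outside the bags, `12`
and `13` the pointers, `14` the marks of the final sweep. Weight array `1` holds the values of
table cells.
-/

/-! ### A calculus for the word RAM: frames, weakest preconditions, counting loops -/

namespace WordRAM

/-- Sequential composition of programs. -/
infixr:35 " ;; " => Prog.seq

namespace State

variable (s : State) (r x q a i : ℕ) (y : ℚ)

@[simp] lemma setReg_reg : (s.setReg r x).reg q = if q = r then x else s.reg q := by
  simp [setReg, Function.update_apply]
@[simp] lemma setReg_arr : (s.setReg r x).arr = s.arr := rfl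
@[simp] lemma setReg_wreg : (s.setReg r x).wreg = s.wreg := rfl
@[simp] lemma setReg_warr : (s.setReg r x).warr = s.warr := rfl
@[simp] lemma setArr_reg : (s.setArr a i x).reg = s.reg := rfl
@[simp] lemma setArr_arr : (s.setArr a i x).arr q =
    if q = a then Function.update (s.arr a) i x else s.arr q := by
  simp [setArr, Function.update_apply]
@[simp] lemma setArr_wreg : (s.setArr a i x).wreg = s.wreg := rfl
@[simp] lemma setArr_warr : (s.setArr a i x).warr = s.warr := rfl
@[simp] lemma setWReg_reg : (s.setWReg r y).reg = s.reg := rfl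
@[simp] lemma setWReg_arr : (s.setWReg r y).arr = s.arr := rfl
@[simp] lemma setWReg_wreg : (s.setWReg r y).wreg q = if q = r then y else s.wreg q := by
  simp [setWReg, Function.update_apply]
@[simp] lemma setWReg_warr : (s.setWReg r y).warr = s.warr := rfl
@[simp] lemma setWArr_reg : (s.setWArr a i y).reg = s.reg := rfl
@[simp] lemma setWArr_arr : (s.setWArr a i y).arr = s.arr := rfl
@[simp] lemma setWArr_wreg : (s.setWArr a i y).wreg = s.wreg := rfl
@[simp] lemma setWArr_warr : (s.setWArr a i y).warr q =
    if q = a then Function.update (s.warr a) i y else s.warr q := by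
  simp [setWArr, Function.update_apply]

end State

namespace Prog

/-- The program contains an assignment to the word register `q`. -/
def setsReg : Prog → ℕ → Bool
  | setReg r _, q => r == q
  | seq p p', q => p.setsReg q || p'.setsReg q
  | ite _ p p', q => p.setsReg q || p'.setsReg q
  | .while _ p, q => p.setsReg q
  | _, _ => false

/-- The program contains an assignment to a cell of the word array `q`. -/
def setsArr : Prog → ℕ → Bool
  | setArr a _ _, q => a == q
  | seq p p', q => p.setsArr q || p'.setsArr q
  | ite _ p p', q => p.setsArr q || p'.setsArr q
  | .while _ p, q => p.setsArr q
  | _, _ => false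

/-- The program contains an assignment to the weight register `q`. -/
def setsWReg : Prog → ℕ → Bool
  | setWReg r _, q => r == q
  | seq p p', q => p.setsWReg q || p'.setsWReg q
  | ite _ p p', q => p.setsWReg q || p'.setsWReg q
  | .while _ p, q => p.setsWReg q
  | _, _ => false

/-- The program contains an assignment to a cell of the weight array `q`. -/
def setsWArr : Prog → ℕ → Bool
  | setWArr a _ _, q => a == q
  | seq p p', q => p.setsWArr q || p'.setsWArr q
  | ite _ p p', q => p.setsWArr q || p'.setsWArr q
  | .while _ p, q => p.setsWArr q
  | _, _ => false

/-- The loop `for r = 0, …, b - 1 do body`, where the bound `b` is read from a register. -/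
def forTo (r b : ℕ) (body : Prog) : Prog :=
  setReg r (.const 0) ;;
    .while (.lt (.reg r) (.reg b)) (body ;; setReg r (.add (.reg r) (.const 1)))

end Prog

/-- The states `s` and `s'` differ only in registers and arrays that `p` assigns to. -/
structure Agree (p : Prog) (s s' : State) : Prop where
  reg : ∀ r, p.setsReg r = false → s'.reg r = s.reg r
  arr : ∀ a, p.setsArr a = false → s'.arr a = s.arr a
  wreg : ∀ r, p.setsWReg r = false → s'.wreg r = s.wreg r
  warr : ∀ a, p.setsWArr a = false → s'.warr a = s.warr a

lemma Agree.refl (p : Prog) (s : State) : Agree p s s :=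
  ⟨fun _ _ => rfl, fun _ _ => rfl, fun _ _ => rfl, fun _ _ => rfl⟩

lemma Agree.trans {p : Prog} {s s' s'' : State} (h : Agree p s s') (h' : Agree p s' s'') :
    Agree p s s'' :=
  ⟨fun r hr => (h'.reg r hr).trans (h.reg r hr), fun r hr => (h'.arr r hr).trans (h.arr r hr),
    fun r hr => (h'.wreg r hr).trans (h.wreg r hr), fun r hr => (h'.warr r hr).trans (h.warr r hr)⟩

lemma Agree.mono {p q : Prog} {s s' : State} (h : Agree p s s')
    (h1 : ∀ r, q.setsReg r = false → p.setsReg r = false)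
    (h2 : ∀ r, q.setsArr r = false → p.setsArr r = false)
    (h3 : ∀ r, q.setsWReg r = false → p.setsWReg r = false)
    (h4 : ∀ r, q.setsWArr r = false → p.setsWArr r = false) : Agree q s s' :=
  ⟨fun r hr => h.reg r (h1 r hr), fun r hr => h.arr r (h2 r hr),
    fun r hr => h.wreg r (h3 r hr), fun r hr => h.warr r (h4 r hr)⟩

/-- The frame property. -/
lemma Exec.agree {B : ℕ} {p : Prog} {s s' : State} {T : ℕ} (h : Exec B p s T s') :
    Agree p s s' := by
  induction h with
  | skip s => exact .refl _ _
  | setReg s r x hx =>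
    refine ⟨fun q hq => ?_, fun _ _ => rfl, fun _ _ => rfl, fun _ _ => rfl⟩
    have : r ≠ q := by simpa [Prog.setsReg] using hq
    simp [this.symm]
  | setArr s a i x hi hx =>
    refine ⟨fun _ _ => rfl, fun q hq => ?_, fun _ _ => rfl, fun _ _ => rfl⟩
    have : a ≠ q := by simpa [Prog.setsArr] using hq
    simp [this.symm]
  | setWReg s r x hx =>
    refine ⟨fun _ _ => rfl, fun _ _ => rfl, fun q hq => ?_, fun _ _ => rfl⟩
    have : r ≠ q := by simpa [Prog.setsWReg] using hq
    simp [this.symm]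
  | setWArr s a i x hi hx =>
    refine ⟨fun _ _ => rfl, fun _ _ => rfl, fun _ _ => rfl, fun q hq => ?_⟩
    have : a ≠ q := by simpa [Prog.setsWArr] using hq
    simp [this.symm]
  | seq p q s s₁ s₂ T₁ T₂ hp hq ihp ihq =>
    exact (ihp.mono (by simp +contextual [Prog.setsReg]) (by simp +contextual [Prog.setsArr])
      (by simp +contextual [Prog.setsWReg]) (by simp +contextual [Prog.setsWArr])).trans
      (ihq.mono (by simp +contextual [Prog.setsReg]) (by simp +contextual [Prog.setsArr])
      (by simp +contextual [Prog.setsWReg]) (by simp +contextual [Prog.setsWArr]))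
  | ite_true b p q s s' T hf hb hp ih =>
    exact ih.mono (by simp +contextual [Prog.setsReg]) (by simp +contextual [Prog.setsArr])
      (by simp +contextual [Prog.setsWReg]) (by simp +contextual [Prog.setsWArr])
  | ite_false b p q s s' T hf hb hp ih =>
    exact ih.mono (by simp +contextual [Prog.setsReg]) (by simp +contextual [Prog.setsArr])
      (by simp +contextual [Prog.setsWReg]) (by simp +contextual [Prog.setsWArr])
  | while_true b p s s₁ s₂ T₁ T₂ hf hb hp hw ihp ihw =>
    exact (ihp.mono (by simp [Prog.setsReg]) (by simp [Prog.setsArr])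
      (by simp [Prog.setsWReg]) (by simp [Prog.setsWArr])).trans ihw
  | while_false b p s hf hb => exact .refl _ _

/-- Total correctness with a clock: started in `s` at time `t`, the program `p` halts without
exceeding the word bound `B`, in a state and at a time that satisfy `Q`. -/
def WP (B : ℕ) (p : Prog) (s : State) (t : ℕ) (Q : State → ℕ → Prop) : Prop :=
  ∃ T s', Exec B p s T s' ∧ Q s' (t + T)

section rules

variable {B : ℕ} {s : State} {t : ℕ} {Q : State → ℕ → Prop}

/-- The consequence rule, with the frame property of the program built in. -/
lemma WP.mono {p : Prog} {R : State → ℕ → Prop} (h : WP B p s t R)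
    (hQ : ∀ s' t', Agree p s s' → R s' t' → Q s' t') : WP B p s t Q := by
  obtain ⟨T, s', he, hR⟩ := h
  exact ⟨T, s', he, hQ _ _ he.agree hR⟩

@[simp] lemma wp_skip : WP B .skip s t Q ↔ Q s (t + 1) := by
  constructor
  · rintro ⟨T, s', h, hQ⟩
    cases h
    exact hQ
  · intro h
    exact ⟨_, _, .skip s, h⟩

@[simp] lemma wp_setReg {r : ℕ} {x : Expr} : WP B (.setReg r x) s t Q ↔
    x.Fits B s ∧ Q (s.setReg r (x.eval s)) (t + (x.cost + 1)) := by
  constructor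
  · rintro ⟨T, s', h, hQ⟩
    cases h with
    | setReg _ _ _ hx => exact ⟨hx, hQ⟩
  · rintro ⟨hx, h⟩
    exact ⟨_, _, .setReg s r x hx, h⟩

@[simp] lemma wp_setArr {a : ℕ} {i x : Expr} : WP B (.setArr a i x) s t Q ↔
    i.Fits B s ∧ x.Fits B s ∧
      Q (s.setArr a (i.eval s) (x.eval s)) (t + (i.cost + x.cost + 1)) := by
  constructor
  · rintro ⟨T, s', h, hQ⟩
    cases h with
    | setArr _ _ _ _ hi hx => exact ⟨hi, hx, hQ⟩
  · rintro ⟨hi, hx, h⟩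
    exact ⟨_, _, .setArr s a i x hi hx, h⟩

@[simp] lemma wp_setWReg {r : ℕ} {x : WExpr} : WP B (.setWReg r x) s t Q ↔
    x.Fits B s ∧ Q (s.setWReg r (x.eval s)) (t + (x.cost + 1)) := by
  constructor
  · rintro ⟨T, s', h, hQ⟩
    cases h with
    | setWReg _ _ _ hx => exact ⟨hx, hQ⟩
  · rintro ⟨hx, h⟩
    exact ⟨_, _, .setWReg s r x hx, h⟩

@[simp] lemma wp_setWArr {a : ℕ} {i : Expr} {x : WExpr} : WP B (.setWArr a i x) s t Q ↔
    i.Fits B s ∧ x.Fits B s ∧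
      Q (s.setWArr a (i.eval s) (x.eval s)) (t + (i.cost + x.cost + 1)) := by
  constructor
  · rintro ⟨T, s', h, hQ⟩
    cases h with
    | setWArr _ _ _ _ hi hx => exact ⟨hi, hx, hQ⟩
  · rintro ⟨hi, hx, h⟩
    exact ⟨_, _, .setWArr s a i x hi hx, h⟩

@[simp] lemma wp_seq {p q : Prog} : WP B (p ;; q) s t Q ↔
    WP B p s t fun s' t' => WP B q s' t' Q := by
  constructor
  · rintro ⟨T, s', h, hQ⟩
    cases h with
    | seq _ _ _ s₁ _ T₁ T₂ hp hq => exact ⟨T₁, s₁, hp, T₂, s', hq, by rwa [add_assoc]⟩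
  · rintro ⟨T₁, s₁, hp, T₂, s', hq, h⟩
    exact ⟨_, _, .seq _ _ _ _ _ _ _ hp hq, by rwa [← add_assoc]⟩

@[simp] lemma wp_ite {b : Test} {p q : Prog} : WP B (.ite b p q) s t Q ↔
    b.Fits B s ∧ (b.Holds s → WP B p s (t + b.cost) Q) ∧
      (¬ b.Holds s → WP B q s (t + b.cost) Q) := by
  constructor
  · rintro ⟨T, s', h, hQ⟩
    cases h with
    | ite_true _ _ _ _ _ T hf hb hp =>
      exact ⟨hf, fun _ => ⟨T, s', hp, by rwa [add_assoc]⟩, fun h => absurd hb h⟩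
    | ite_false _ _ _ _ _ T hf hb hp =>
      exact ⟨hf, fun h => absurd h hb, fun _ => ⟨T, s', hp, by rwa [add_assoc]⟩⟩
  · rintro ⟨hf, h1, h2⟩
    by_cases hb : b.Holds s
    · obtain ⟨T, s', hp, h⟩ := h1 hb
      exact ⟨_, _, .ite_true _ _ _ _ _ _ hf hb hp, by rwa [← add_assoc]⟩
    · obtain ⟨T, s', hp, h⟩ := h2 hb
      exact ⟨_, _, .ite_false _ _ _ _ _ _ hf hb hp, by rwa [← add_assoc]⟩

/-- The rule for counting loops, with an invariant that may speak about the clock. -/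
lemma WP.forTo {r b : ℕ} {body : Prog} (m : ℕ) (Inv : ℕ → State → ℕ → Prop)
    (hb : s.reg b = m) (hm : m ≤ B) (hrb : r ≠ b)
    (hr : body.setsReg r = false) (hb' : body.setsReg b = false)
    (h0 : Inv 0 (s.setReg r 0) (t + 2))
    (hstep : ∀ k s' t', k < m → s'.reg r = k → Agree (.forTo r b body) s s' → Inv k s' t' →
      WP B body s' (t' + 3) fun s'' t'' => Inv (k + 1) (s''.setReg r (k + 1)) (t'' + 4))
    (hend : ∀ s' t', Agree (.forTo r b body) s s' → Inv m s' t' → Q s' (t' + 3)) :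
    WP B (.forTo r b body) s t Q := by
  have key : ∀ d k s' t', k + d = m → s'.reg r = k → Agree (.forTo r b body) s s' →
      Inv k s' t' → WP B (.while (.lt (.reg r) (.reg b))
        (body ;; .setReg r (.add (.reg r) (.const 1)))) s' t' Q := by
    intro d
    induction d with
    | zero =>
      intro k s' t' hk hs' ha hI
      have hbs : s'.reg b = m := by
        rw [ha.reg b (by simp [Prog.forTo, Prog.setsReg, hb', hrb]), hb]
      refine ⟨_, _, .while_false _ _ _ ?_ ?_, ?_⟩
      · simp only [Test.Fits, Expr.Fits]
        omega
      · simp only [Test.Holds, Expr.eval]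
        omega
      · obtain rfl : k = m := by omega
        exact hend _ _ ha hI
    | succ d ih =>
      intro k s' t' hk hs' ha hI
      have hbs : s'.reg b = m := by
        rw [ha.reg b (by simp [Prog.forTo, Prog.setsReg, hb', hrb]), hb]
      obtain ⟨T₁, s₁, h₁, hI₁⟩ := hstep k s' t' (by omega) hs' ha hI
      have hr₁ : s₁.reg r = k := by rw [h₁.agree.reg r hr, hs']
      have ha₁ : Agree (.forTo r b body) s (s₁.setReg r (k + 1)) := by
        refine (ha.trans (h₁.agree.mono ?_ ?_ ?_ ?_)).trans ⟨?_, ?_, ?_, ?_⟩ <;>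
          simp +contextual [Prog.forTo, Prog.setsReg, Prog.setsArr, Prog.setsWReg, Prog.setsWArr]
        intro q hq _ h
        exact absurd h.symm hq
      obtain ⟨T₂, s₂, h₂, hQ⟩ := ih (k + 1) _ _ (by omega) (by simp) ha₁ hI₁
      refine ⟨_, s₂, .while_true _ _ _ _ _ _ T₂ ?_ ?_
        (.seq _ _ _ _ _ _ _ h₁ (.setReg _ _ _ ?_)) ?_, ?_⟩
      · simp only [Test.Fits, Expr.Fits]
        omega
      · simp only [Test.Holds, Expr.eval]
        omega
      · simp only [Expr.Fits, Expr.eval]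
        omega
      · simpa [Expr.eval, hr₁] using h₂
      · convert hQ using 1
        simp [Expr.cost, Test.cost]
        omega
  refine wp_seq.2 (wp_setReg.2 ⟨by simp [Expr.Fits], key m 0 _ _ (by omega) (by simp [Expr.eval])
    ⟨?_, ?_, ?_, ?_⟩ h0⟩) <;>
    simp +contextual [Prog.forTo, Prog.setsReg, Expr.eval]
  intro q hq _ h
  exact absurd h.symm hq

/-- The rule for counting loops whose `k`-th pass takes at most `f k` steps. -/
lemma WP.for_sum {r b : ℕ} {body : Prog} (m : ℕ) (Inv : ℕ → State → Prop) (f : ℕ → ℕ)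
    (hb : s.reg b = m) (hm : m ≤ B) (hrb : r ≠ b)
    (hr : body.setsReg r = false) (hb' : body.setsReg b = false)
    (hset : ∀ k s x, Inv k s → Inv k (s.setReg r x)) (h0 : Inv 0 s)
    (hstep : ∀ k s' t', k < m → s'.reg r = k → Agree (.forTo r b body) s s' → Inv k s' →
      WP B body s' t' fun s'' t'' => Inv (k + 1) s'' ∧ t'' ≤ t' + f k)
    (hend : ∀ s' t', Agree (.forTo r b body) s s' → Inv m s' →
      t' ≤ t + 5 + ∑ k ∈ Finset.range m, (f k + 7) → Q s' t') :
    WP B (.forTo r b body) s t Q := by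
  refine WP.forTo m (fun k s' t' => Inv k s' ∧ t' ≤ t + 2 + ∑ k ∈ Finset.range k, (f k + 7))
    hb hm hrb hr hb' ⟨hset _ _ _ h0, by simp⟩ ?_ ?_
  · rintro k s' t' hk hs' ha ⟨hI, ht⟩
    refine (hstep k s' (t' + 3) hk hs' ha hI).mono fun s'' t'' _ ⟨h, h'⟩ => ⟨hset _ _ _ h, ?_⟩
    rw [Finset.sum_range_succ]
    omega
  · rintro s' t' ha ⟨hI, ht⟩
    exact hend _ _ ha hI (by omega)

/-- The rule for counting loops whose passes take at most `c` steps each. -/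
lemma WP.for_const {r b : ℕ} {body : Prog} (m : ℕ) (Inv : ℕ → State → Prop) (c : ℕ)
    (hb : s.reg b = m) (hm : m ≤ B) (hrb : r ≠ b)
    (hr : body.setsReg r = false) (hb' : body.setsReg b = false)
    (hset : ∀ k s x, Inv k s → Inv k (s.setReg r x)) (h0 : Inv 0 s)
    (hstep : ∀ k s' t', k < m → s'.reg r = k → Agree (.forTo r b body) s s' → Inv k s' →
      WP B body s' t' fun s'' t'' => Inv (k + 1) s'' ∧ t'' ≤ t' + c)
    (hend : ∀ s' t', Agree (.forTo r b body) s s' → Inv m s' →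
      t' ≤ t + 5 + m * (c + 7) → Q s' t') :
    WP B (.forTo r b body) s t Q :=
  WP.for_sum m Inv (fun _ => c) hb hm hrb hr hb' hset h0 hstep
    fun s' t' ha hI ht => hend s' t' ha hI (by simpa using ht)

/-- The rule for counting loops in which the `k`-th pass takes at most `f k` steps and adds the
set `G k` to a set that the state represents. -/
lemma WP.for_union_sum {α : Type*} {r b : ℕ} {body : Prog} (m : ℕ) (Inv : Set α → State → Prop)
    (G : ℕ → Set α) (f : ℕ → ℕ) (X : Set α)
    (hb : s.reg b = m) (hm : m ≤ B) (hrb : r ≠ b)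
    (hr : body.setsReg r = false) (hb' : body.setsReg b = false)
    (hset : ∀ X s x, Inv X s → Inv X (s.setReg r x)) (h0 : Inv X s)
    (hstep : ∀ k s' t' X, k < m → s'.reg r = k → Agree (.forTo r b body) s s' → Inv X s' →
      WP B body s' t' fun s'' t'' => Inv (X ∪ G k) s'' ∧ t'' ≤ t' + f k)
    (hend : ∀ s' t', Agree (.forTo r b body) s s' → Inv (X ∪ ⋃ k < m, G k) s' →
      t' ≤ t + 5 + ∑ k ∈ Finset.range m, (f k + 7) → Q s' t') :
    WP B (.forTo r b body) s t Q := by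
  refine WP.for_sum m (fun k s' => Inv (X ∪ ⋃ l < k, G l) s') f hb hm hrb hr hb'
    (fun k s x h => hset _ _ _ h) (by simpa using h0) ?_ hend
  intro k s' t' hk hs' ha hI
  have := hstep k s' t' _ hk hs' ha hI
  rwa [Set.union_assoc, ← Set.biUnion_lt_succ] at this

/-- The rule for counting loops in which the `k`-th pass adds the set `G k` to a set that the
state represents. -/
lemma WP.for_union {α : Type*} {r b : ℕ} {body : Prog} (m : ℕ) (Inv : Set α → State → Prop)
    (G : ℕ → Set α) (c : ℕ) (X : Set α)
    (hb : s.reg b = m) (hm : m ≤ B) (hrb : r ≠ b)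
    (hr : body.setsReg r = false) (hb' : body.setsReg b = false)
    (hset : ∀ X s x, Inv X s → Inv X (s.setReg r x)) (h0 : Inv X s)
    (hstep : ∀ k s' t' X, k < m → s'.reg r = k → Agree (.forTo r b body) s s' → Inv X s' →
      WP B body s' t' fun s'' t'' => Inv (X ∪ G k) s'' ∧ t'' ≤ t' + c)
    (hend : ∀ s' t', Agree (.forTo r b body) s s' → Inv (X ∪ ⋃ k < m, G k) s' →
      t' ≤ t + 5 + m * (c + 7) → Q s' t') :
    WP B (.forTo r b body) s t Q :=
  WP.for_union_sum m Inv G (fun _ => c) X hb hm hrb hr hb' hset h0 hstep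
    fun s' t' ha hI ht => hend s' t' ha hI (by simpa using ht)

end rules

end WordRAM

/-! ### Subsets of a bag as numbers -/

namespace MaxBisection

open Finset

/-- The weight of the vertex `v` in the encoding of subsets of `X`: `2` to the number of smaller
elements of `X`. -/
def pw (X : Finset ℕ) (v : ℕ) : ℕ := 2 ^ #{u ∈ X | u < v}

/-- The number that encodes the set `U ∩ X` as a subset of `X`. -/
def mask (X U : Finset ℕ) : ℕ := ∑ v ∈ U ∩ X, pw X v

/-- The subset of `X` that the number `S` encodes. -/
def bits (X : Finset ℕ) (S : ℕ) : Finset ℕ := {v ∈ X | S / pw X v % 2 = 1}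

lemma bits_subset (X : Finset ℕ) (S : ℕ) : bits X S ⊆ X := filter_subset _ _

lemma rank_lt_rank {X : Finset ℕ} {u v : ℕ} (hu : u ∈ X) (h : u < v) :
    #{x ∈ X | x < u} < #{x ∈ X | x < v} := by
  refine card_lt_card ⟨fun x => ?_, fun hs => ?_⟩
  · simp only [mem_filter]
    exact fun hx => ⟨hx.1, hx.2.trans h⟩
  · have := hs (mem_filter.2 ⟨hu, h⟩)
    simp at this

lemma rank_injOn (X : Finset ℕ) : Set.InjOn (fun v => #{x ∈ X | x < v}) X := by
  intro u hu v hv h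
  rcases lt_trichotomy u v with h' | h' | h'
  · exact absurd h (rank_lt_rank hu h').ne
  · exact h'
  · exact absurd h (rank_lt_rank hv h').ne'

lemma rank_lt_card {X : Finset ℕ} {v : ℕ} (hv : v ∈ X) : #{x ∈ X | x < v} < #X := by
  refine card_lt_card ⟨filter_subset _ _, fun hs => ?_⟩
  have := hs hv
  simp at this

lemma mask_inter (X U : Finset ℕ) : mask X (U ∩ X) = mask X U := by
  simp [mask, inter_assoc]

lemma mask_eq_sum_two_pow (X U : Finset ℕ) :
    mask X U = ∑ r ∈ (U ∩ X).image (fun v => #{x ∈ X | x < v}), 2 ^ r := by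
  rw [sum_image fun u hu v hv => rank_injOn X (mem_inter.1 hu).2 (mem_inter.1 hv).2]
  rfl

lemma bits_mask (X U : Finset ℕ) : bits X (mask X U) = U ∩ X := by
  ext v
  rw [bits, mem_filter, mem_inter, and_comm]
  refine and_congr_left fun hv => ?_
  have h1 : mask X U / pw X v % 2 = 1 ↔ (mask X U).testBit #{x ∈ X | x < v} = true := by
    rw [Nat.testBit_eq_decide_div_mod_eq]
    simp [pw]
  rw [h1, ← Nat.mem_bitIndices, ← List.mem_toFinset, mask_eq_sum_two_pow,
    toFinset_bitIndices_sum_two_pow, mem_image]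
  constructor
  · rintro ⟨u, hu, h⟩
    obtain rfl := rank_injOn X (mem_inter.1 hu).2 hv h
    exact (mem_inter.1 hu).1
  · exact fun h => ⟨v, mem_inter.2 ⟨h, hv⟩, rfl⟩

lemma mask_lt (X U : Finset ℕ) : mask X U < 2 ^ #X := by
  rw [mask_eq_sum_two_pow]
  refine Nat.geomSum_lt le_rfl fun r hr => ?_
  obtain ⟨v, hv, rfl⟩ := mem_image.1 hr
  exact rank_lt_card (mem_inter.1 hv).2

lemma inter_eq_of_mask_eq {X U U' : Finset ℕ} (h : mask X U = mask X U') : U ∩ X = U' ∩ X := by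
  rw [← bits_mask, h, bits_mask]

/-- Every number below `2 ^ #X` encodes a set: the encoding of subsets is injective, and there
are as many subsets as numbers. -/
lemma mask_bits {X : Finset ℕ} {S : ℕ} (hS : S < 2 ^ #X) : mask X (bits X S) = S := by
  have hinj : Set.InjOn (mask X) X.powerset := by
    intro U hU U' hU' h
    have := inter_eq_of_mask_eq h
    rwa [inter_eq_left.2 (mem_powerset.1 hU), inter_eq_left.2 (mem_powerset.1 hU')] at this
  have himg : X.powerset.image (mask X) = range (2 ^ #X) := by
    refine eq_of_subset_of_card_le (fun x hx => ?_) ?_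
    · obtain ⟨U, -, rfl⟩ := mem_image.1 hx
      exact mem_range.2 (mask_lt X U)
    · rw [card_image_of_injOn hinj]
      simp
  obtain ⟨U, hU, rfl⟩ := mem_image.1 (himg.symm ▸ mem_range.2 hS : S ∈ X.powerset.image (mask X))
  rw [bits_mask, mask_inter]

/-! ### Partial solutions and how they are combined -/

/-- `U` is a partial solution on the vertex set `V` with interface `X`: its trace on `X` is
encoded by `S`, and `k` of its vertices lie outside `X`. -/
def Fam (V X : Finset ℕ) (S k : ℕ) (U : Finset ℕ) : Prop :=
  U ⊆ V ∧ mask X U = S ∧ #(U \ X) = k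

/-- The same for a new interface `X`, where the trace on `X` is encoded as a subset of the old
interface `Y`. -/
def FamG (V Y X : Finset ℕ) (e k : ℕ) (U : Finset ℕ) : Prop :=
  U ⊆ V ∧ mask Y (U ∩ X) = e ∧ #(U \ X) = k

section combine

variable {Vp Vj Xp Xj U U₁ U₂ : Finset ℕ} {S k k₁ k₂ : ℕ}

/-- A change of the interface from `Xj` to `Xp` only moves the vertices of the trace outside `Xp`
to the counted ones. -/
lemma Fam.forget (hp : Xp ⊆ Vp) (hsep : Vp ∩ Vj ⊆ Xp ∩ Xj) (h : Fam Vj Xj S k U) :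
    FamG Vj Xj Xp (mask Xj (bits Xj S ∩ Xp)) (k + #(bits Xj S \ Xp)) U := by
  obtain ⟨hU, rfl, rfl⟩ := h
  have hX : ∀ v ∈ U, v ∈ Xp → v ∈ Xj := fun v hv hv' =>
    (mem_inter.1 (hsep (mem_inter.2 ⟨hp hv', hU hv⟩))).2
  refine ⟨hU, ?_, ?_⟩
  · rw [bits_mask, ← mask_inter Xj (U ∩ Xp)]
    congr 1
    ext v
    simp only [mem_inter]
    tauto
  · rw [bits_mask, ← card_union_of_disjoint]
    · congr 1
      ext v
      simp only [mem_union, mem_sdiff, mem_inter]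
      have := hX v
      tauto
    · rw [disjoint_left]
      simp only [mem_sdiff, mem_inter]
      tauto

/-- Partial solutions on both sides with the same trace on the intersection of the interfaces
have a union that restricts to each of them. -/
lemma Fam.join (hp : Xp ⊆ Vp) (hsep : Vp ∩ Vj ⊆ Xp ∩ Xj) (h₁ : Fam Vp Xp S k₁ U₁)
    (h₂ : FamG Vj Xj Xp (mask Xj (bits Xp S)) k₂ U₂) :
    Fam (Vp ∪ Vj) Xp S (k₁ + k₂) (U₁ ∪ U₂) ∧ (U₁ ∪ U₂) ∩ Vp = U₁ ∧ (U₁ ∪ U₂) ∩ Vj = U₂ := by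
  obtain ⟨hU₁, rfl, rfl⟩ := h₁
  obtain ⟨hU₂, he, rfl⟩ := h₂
  rw [bits_mask] at he
  have he := inter_eq_of_mask_eq he
  have hs : ∀ v, v ∈ Vp → v ∈ Vj → v ∈ Xp ∧ v ∈ Xj := fun v h h' => by
    simpa using hsep (mem_inter.2 ⟨h, h'⟩)
  have he' : ∀ v, v ∈ Xp → v ∈ Xj → (v ∈ U₁ ↔ v ∈ U₂) := fun v h h' => by
    have := Finset.ext_iff.1 he v
    simp only [mem_inter] at this
    tauto
  have e₁ : (U₁ ∪ U₂) ∩ Vp = U₁ := by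
    ext v
    simp only [mem_inter, mem_union]
    have := hs v; have := he' v; have := @hU₁ v; have := @hU₂ v
    tauto
  have e₂ : (U₁ ∪ U₂) ∩ Vj = U₂ := by
    ext v
    simp only [mem_inter, mem_union]
    have := hs v; have := he' v; have := @hU₁ v; have := @hU₂ v
    tauto
  refine ⟨⟨union_subset_union hU₁ hU₂, ?_, ?_⟩, e₁, e₂⟩
  · rw [← mask_inter, ← mask_inter Xp U₁]
    congr 1
    ext v
    have := Finset.ext_iff.1 he v
    simp only [mem_inter, mem_union] at this ⊢
    have := hs v; have := @hp v; have := @hU₁ v; have := @hU₂ v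
    tauto
  · rw [union_sdiff_distrib, card_union_of_disjoint]
    rw [disjoint_left]
    simp only [mem_sdiff]
    intro v h h'
    exact h.2 (hs v (hU₁ h.1) (hU₂ h'.1)).1

/-- Every partial solution on the union arises by a join. -/
lemma Fam.split (hp : Xp ⊆ Vp) (hj : Xj ⊆ Vj) (hsep : Vp ∩ Vj ⊆ Xp ∩ Xj)
    (h : Fam (Vp ∪ Vj) Xp S k U) :
    Fam Vp Xp S #((U ∩ Vp) \ Xp) (U ∩ Vp) ∧
      FamG Vj Xj Xp (mask Xj (bits Xp S)) #((U ∩ Vj) \ Xp) (U ∩ Vj) ∧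
      #((U ∩ Vp) \ Xp) + #((U ∩ Vj) \ Xp) = k := by
  obtain ⟨hU, rfl, rfl⟩ := h
  have hs : ∀ v, v ∈ Vp → v ∈ Vj → v ∈ Xp ∧ v ∈ Xj := fun v h h' => by
    simpa using hsep (mem_inter.2 ⟨h, h'⟩)
  refine ⟨⟨inter_subset_right, ?_, rfl⟩, ⟨inter_subset_right, ?_, rfl⟩, ?_⟩
  · rw [← mask_inter, ← mask_inter Xp U, inter_assoc, inter_eq_right.2 hp]
  · rw [bits_mask, ← mask_inter, ← mask_inter Xj (U ∩ Xp)]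
    congr 1
    ext v
    simp only [mem_inter]
    have := @hj v
    tauto
  · rw [← card_union_of_disjoint]
    · congr 1
      ext v
      have := @hU v
      simp only [mem_union, mem_sdiff, mem_inter] at this ⊢
      tauto
    · rw [disjoint_left]
      simp only [mem_sdiff, mem_inter]
      have := hs
      grind

/-- The number of vertices outside the interface adds up when two vertex sets are joined. -/
lemma card_union_sdiff (hp : Xp ⊆ Vp) (hj : Xj ⊆ Vj) (hsep : Vp ∩ Vj ⊆ Xp ∩ Xj) :
    #((Vp ∪ Vj) \ Xp) = #(Vp \ Xp) + (#(Vj \ Xj) + #(Xj \ Xp)) ∧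
      #(Vj \ Xp) = #(Vj \ Xj) + #(Xj \ Xp) := by
  have hs : ∀ v, v ∈ Vp → v ∈ Vj → v ∈ Xp ∧ v ∈ Xj := fun v h h' => by
    simpa using hsep (mem_inter.2 ⟨h, h'⟩)
  have h2 : #(Vj \ Xp) = #(Vj \ Xj) + #(Xj \ Xp) := by
    rw [← card_union_of_disjoint]
    · congr 1
      ext v
      simp only [mem_union, mem_sdiff]
      have := @hp v; have := @hj v; have := hs v
      tauto
    · rw [disjoint_left]
      simp only [mem_sdiff]
      tauto
  refine ⟨?_, h2⟩
  rw [← h2, union_sdiff_distrib, card_union_of_disjoint]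
  rw [disjoint_left]
  simp only [mem_sdiff]
  intro v h h'
  exact h.2 (hs v h.1 h'.1).1

end combine

/-! ### Instances and the merging of tree nodes -/

/-- An instance of the problem, with vertices `0, …, n - 1`, tree nodes `0, …, N - 1` and arcs
numbered `0, …, m - 1`. The tree is given by parents and depths. The connectedness of
the nodes that contain a vertex enters as `cross`: a set of nodes that contains some, but not all
nodes of `v` is left through a tree edge whose two ends contain `v`. -/
structure Inst where
  n : ℕ
  N : ℕ
  root : ℕ
  m : ℕ
  t : ℕ
  par : ℕ → ℕ
  dep : ℕ → ℕ
  bag : ℕ → Finset ℕ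
  tail : ℕ → ℕ
  head : ℕ → ℕ
  wt : ℕ → ℚ
  one_le : 1 ≤ n
  N_le : N ≤ 4 * (n + 1)
  root_lt : root < N
  m_le : m ≤ n ^ 2
  bag_lt : ∀ i v, v ∈ bag i → v < n
  bag_card : ∀ i, #(bag i) ≤ t + 1
  par_lt : ∀ i, i < N → par i < N
  dep_root : dep root = 0
  dep_par : ∀ i, i < N → i ≠ root → dep i = dep (par i) + 1
  dep_lt : ∀ i, i < N → dep i < N
  cover : ∀ v, v < n → ∃ i, i < N ∧ v ∈ bag i
  arc : ∀ a, a < m → ∃ i, i < N ∧ tail a ∈ bag i ∧ head a ∈ bag i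
  cross : ∀ v (A : Set ℕ) x y, x < N → y < N → x ∈ A → y ∉ A → v ∈ bag x → v ∈ bag y →
    ∃ z, z < N ∧ z ≠ root ∧ v ∈ bag z ∧ v ∈ bag (par z) ∧
      (z ∈ A ∧ par z ∉ A ∨ z ∉ A ∧ par z ∈ A)

namespace Inst

variable (I : Inst)

/-- The contribution of the arc `a` to the cut `U`. -/
def term (a : ℕ) (U : Finset ℕ) : ℚ := if I.tail a ∈ U ∧ I.head a ∉ U then I.wt a else 0

/-- The size of the cut `U`. -/
def cut (U : Finset ℕ) : ℚ := ∑ a ∈ range I.m, I.term a U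

/-- The set of nodes merged into the node `i`, if `comp` maps each node to the node into which it
has been merged. -/
def nodes (comp : ℕ → ℕ) (i : ℕ) : Finset ℕ := {x ∈ range I.N | comp x = i}

/-- The vertices in the bags of the nodes merged into `i`. -/
def verts (comp : ℕ → ℕ) (i : ℕ) : Finset ℕ := (I.nodes comp i).biUnion I.bag

/-- The part of the cut `U` that is due to the arcs whose node (given by `nd`) is merged
into `i`. -/
def val (nd comp : ℕ → ℕ) (i : ℕ) (U : Finset ℕ) : ℚ :=
  ∑ a ∈ range I.m with comp (nd a) = i, I.term a U

/-- Every arc `a` has been assigned to a node `nd a` that contains its two ends. -/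
def IsNode (nd : ℕ → ℕ) : Prop :=
  ∀ a, a < I.m → nd a < I.N ∧ I.tail a ∈ I.bag (nd a) ∧ I.head a ∈ I.bag (nd a)

/-- The nodes in `done` have been merged into their parents, every node after its children;
`comp` gives the node into which a node has eventually been merged. -/
structure Forest (done : Set ℕ) (comp : ℕ → ℕ) : Prop where
  root : I.root ∉ done
  self : ∀ x, x < I.N → x ∉ done → comp x = x
  step : ∀ x, x < I.N → x ∈ done → comp x = comp (I.par x)
  lt : ∀ x, x < I.N → comp x < I.N
  active : ∀ x, x < I.N → comp x ∉ done
  child : ∀ x, x < I.N → x ≠ I.root → I.par x ∈ done → x ∈ done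

/-- The map `comp` after merging `j` into its parent. -/
def merge (comp : ℕ → ℕ) (j x : ℕ) : ℕ := if comp x = j then I.par j else comp x

variable {I} {done : Set ℕ} {comp nd : ℕ → ℕ} {j : ℕ}

lemma forest_empty : I.Forest ∅ id where
  root := by simp
  self := by simp
  step := by simp
  lt := by simp
  active := by simp
  child := by simp

lemma mem_verts {i v : ℕ} : v ∈ I.verts comp i ↔ ∃ x, x < I.N ∧ comp x = i ∧ v ∈ I.bag x := by
  simp [verts, nodes, and_assoc]

lemma par_ne (hj : j < I.N) (hr : j ≠ I.root) : I.par j ≠ j := by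
  intro h
  have := I.dep_par j hj hr
  rw [h] at this
  omega

section merge

variable (hF : I.Forest done comp) (hj : j < I.N) (hr : j ≠ I.root) (hd : j ∉ done)
  (hc : ∀ x, x < I.N → x ≠ I.root → I.par x = j → x ∈ done)

include hF hj hr hd

lemma Forest.par_notMem : I.par j ∉ done := fun h => hd (hF.child j hj hr h)

lemma Forest.comp_par : comp (I.par j) = I.par j :=
  hF.self _ (I.par_lt j hj) (hF.par_notMem hj hr hd)

include hc

lemma Forest.merge : I.Forest (insert j done) (I.merge comp j) := by
  have hp := hF.par_notMem hj hr hd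
  have hcp := hF.comp_par hj hr hd
  have hpj := par_ne hj hr
  have hcj := hF.self j hj hd
  refine ⟨?_, ?_, ?_, ?_, ?_, ?_⟩
  · simp [Ne.symm hr, hF.root]
  · intro x hx h
    simp only [Set.mem_insert_iff, not_or] at h
    simp [Inst.merge, hF.self x hx h.2, h.1]
  · rintro x hx (rfl | h)
    · simp [Inst.merge, hcj, hcp, hpj]
    · simp [Inst.merge, hF.step x hx h]
  · intro x hx
    unfold Inst.merge
    split_ifs
    exacts [I.par_lt j hj, hF.lt x hx]
  · intro x hx
    unfold Inst.merge
    split_ifs with h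
    · simp [hpj, hp]
    · simp [h, hF.active x hx]
  · rintro x hx hxr (h | h)
    · exact .inr (hc x hx hxr h)
    · exact .inr (hF.child x hx hxr h)

/-- When a node is merged into its parent after all its children, the vertices on both sides lie
in both bags. -/
lemma Forest.verts_inter :
    I.verts comp (I.par j) ∩ I.verts comp j ⊆ I.bag (I.par j) ∩ I.bag j := by
  have hcp := hF.comp_par hj hr hd
  have hcj := hF.self j hj hd
  have hpj := par_ne hj hr
  intro v hv
  simp only [mem_inter, mem_verts] at hv
  obtain ⟨⟨y, hy, hyp, hvy⟩, x, hx, hxj, hvx⟩ := hv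
  -- a vertex on both sides is in both bags of a tree edge that leaves the part of `j`
  obtain ⟨z, hz, hzr, hvz, hvpz, h | h⟩ := I.cross v {x | comp x = j} x y hx hy hxj
    (by simp [hyp, hpj]) hvx hvy
  · by_cases hzd : z ∈ done
    · have := hF.step z hz hzd
      exact absurd (this.symm.trans h.1) h.2
    · obtain rfl : z = j := by rw [← hF.self z hz hzd]; exact h.1
      exact mem_inter.2 ⟨hvpz, hvz⟩
  -- the edge cannot enter the part of `j` from below: all children have been merged before
  · exfalso
    have hzd : z ∈ done := by
      by_cases hpd : I.par z ∈ done
      · exact hF.child z hz hzr hpd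
      · exact hc z hz hzr (by rw [← hF.self _ (I.par_lt z hz) hpd]; exact h.2)
    exact h.1 ((hF.step z hz hzd).trans h.2)

omit hc hF hd

omit hj hr in
lemma nodes_merge_par :
    I.nodes (I.merge comp j) (I.par j) = I.nodes comp (I.par j) ∪ I.nodes comp j := by
  ext x
  simp only [nodes, mem_filter, mem_union]
  unfold Inst.merge
  split_ifs with h
  · simp +contextual [h]
  · simp [h]

lemma disjoint_nodes : Disjoint (I.nodes comp (I.par j)) (I.nodes comp j) := by
  rw [disjoint_left]
  simp only [nodes, mem_filter]
  rintro x ⟨_, h⟩ ⟨_, h'⟩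
  exact par_ne hj hr (h.symm.trans h')

omit hj hr in
lemma verts_merge_par :
    I.verts (I.merge comp j) (I.par j) = I.verts comp (I.par j) ∪ I.verts comp j := by
  rw [verts, nodes_merge_par, union_biUnion]
  rfl

omit hj hr in
lemma nodes_merge_of_ne {i : ℕ} (hi : i ≠ I.par j) (hij : i ≠ j) :
    I.nodes (I.merge comp j) i = I.nodes comp i := by
  ext x
  simp only [nodes, mem_filter]
  unfold Inst.merge
  split_ifs with h
  · simp [h, hi.symm, hij.symm]
  · rfl

omit hj hr in
lemma verts_merge_of_ne {i : ℕ} (hi : i ≠ I.par j) (hij : i ≠ j) :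
    I.verts (I.merge comp j) i = I.verts comp i := by
  rw [verts, nodes_merge_of_ne hi hij, verts]

omit hj hr in
lemma val_merge_of_ne {i : ℕ} (hi : i ≠ I.par j) (hij : i ≠ j) :
    I.val nd (I.merge comp j) i = I.val nd comp i := by
  funext U
  unfold val
  congr 1
  ext a
  simp only [mem_filter]
  unfold Inst.merge
  split_ifs with h
  · simp [h, hi.symm, hij.symm]
  · rfl

end merge

lemma Forest.bag_subset (hF : I.Forest done comp) {i : ℕ} (hi : i < I.N) (hd : i ∉ done) :
    I.bag i ⊆ I.verts comp i := fun _ hv => mem_verts.2 ⟨i, hi, hF.self i hi hd, hv⟩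

lemma verts_subset (i : ℕ) : I.verts comp i ⊆ range I.n := by
  intro v hv
  obtain ⟨x, -, -, h⟩ := mem_verts.1 hv
  exact mem_range.2 (I.bag_lt _ _ h)

lemma card_sdiff_add_card_bag_le (hF : I.Forest done comp) {i : ℕ} (hi : i < I.N)
    (hd : i ∉ done) : #(I.verts comp i \ I.bag i) + #(I.bag i) ≤ I.n := by
  rw [card_sdiff_add_card_eq_card (hF.bag_subset hi hd)]
  simpa using card_le_card (verts_subset (I := I) (comp := comp) i)

/-- Only the vertices on its side matter for the part of the cut that belongs to a node. -/
lemma val_inter (hnd : I.IsNode nd) (i : ℕ) (U : Finset ℕ) :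
    I.val nd comp i (U ∩ I.verts comp i) = I.val nd comp i U := by
  refine sum_congr rfl fun a ha => ?_
  simp only [mem_filter, mem_range] at ha
  obtain ⟨h1, h2, h3⟩ := hnd a ha.1
  have h4 : I.tail a ∈ I.verts comp i := mem_verts.2 ⟨_, h1, ha.2, h2⟩
  have h5 : I.head a ∈ I.verts comp i := mem_verts.2 ⟨_, h1, ha.2, h3⟩
  simp [term, h4, h5]

lemma val_merge_par (hj : j < I.N) (hr : j ≠ I.root)
    (U : Finset ℕ) : I.val nd (I.merge comp j) (I.par j) U =
      I.val nd comp (I.par j) U + I.val nd comp j U := by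
  unfold val
  rw [← sum_union]
  · congr 1
    ext a
    simp only [mem_filter, mem_union]
    unfold Inst.merge
    split_ifs with h
    · simp +contextual [h]
    · simp [h]
  · rw [disjoint_left]
    simp only [mem_filter]
    rintro x ⟨_, h⟩ ⟨_, h'⟩
    exact par_ne hj hr (h.symm.trans h')

/-- After all merges every node belongs to the root. -/
lemma Forest.comp_eq_root (hF : I.Forest done comp)
    (h : ∀ x, x < I.N → x ≠ I.root → x ∈ done) {x : ℕ} (hx : x < I.N) : comp x = I.root := by
  by_contra hne
  exact hF.active x hx (h _ (hF.lt x hx) hne)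

lemma Forest.verts_root (hF : I.Forest done comp)
    (h : ∀ x, x < I.N → x ≠ I.root → x ∈ done) : I.verts comp I.root = range I.n := by
  refine (verts_subset _).antisymm fun v hv => ?_
  obtain ⟨i, hi, hvi⟩ := I.cover v (mem_range.1 hv)
  exact mem_verts.2 ⟨i, hi, hF.comp_eq_root h hi, hvi⟩

lemma Forest.val_root (hF : I.Forest done comp) (hnd : I.IsNode nd)
    (h : ∀ x, x < I.N → x ≠ I.root → x ∈ done) : I.val nd comp I.root = I.cut := by
  funext U
  unfold val cut
  congr 1
  refine filter_true_of_mem fun a ha => hF.comp_eq_root h (hnd a (mem_range.1 ha)).1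

/-- The potential that pays for the joins: the sum over the nodes that have not been merged of
the square of their number of forgotten vertices and of merged nodes. -/
noncomputable def pot (I : Inst) (done : Set ℕ) (comp : ℕ → ℕ) : ℕ :=
  ∑ i ∈ range I.N,
    doneᶜ.indicator (fun i => (#(I.verts comp i \ I.bag i) + #(I.nodes comp i)) ^ 2) i

lemma card_nodes_pos (hF : I.Forest done comp) {i : ℕ} (hi : i < I.N) (hd : i ∉ done) :
    1 ≤ #(I.nodes comp i) :=
  card_pos.2 ⟨i, by simp [nodes, hi, hF.self i hi hd]⟩

/-- The join of a node with its parent takes about as many steps as the potential grows: the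
square of a sum exceeds the sum of the squares by twice the product. -/
lemma Forest.pot_merge (hF : I.Forest done comp) (hj : j < I.N) (hr : j ≠ I.root) (hd : j ∉ done)
    (hc : ∀ x, x < I.N → x ≠ I.root → I.par x = j → x ∈ done) :
    I.pot done comp + (#(I.verts comp (I.par j) \ I.bag (I.par j)) + 1) *
        (#(I.verts comp j \ I.bag j) + #(I.bag j \ I.bag (I.par j)) + 1) ≤
      I.pot (insert j done) (I.merge comp j) := by
  classical
  have hp := hF.par_notMem hj hr hd
  have hpj := par_ne hj hr
  have hpN := I.par_lt j hj
  have h1 : j ∈ range I.N := mem_range.2 hj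
  have h2 : I.par j ∈ (range I.N).erase j := mem_erase.2 ⟨hpj, mem_range.2 hpN⟩
  unfold pot
  rw [← add_sum_erase _ _ h1, ← add_sum_erase _ _ h2, ← add_sum_erase _ _ h1,
    ← add_sum_erase _ _ h2]
  have h3 : ∀ x ∈ ((range I.N).erase j).erase (I.par j), (insert j done)ᶜ.indicator (fun x =>
      (#(I.verts (I.merge comp j) x \ I.bag x) + #(I.nodes (I.merge comp j) x)) ^ 2) x =
      doneᶜ.indicator (fun x => (#(I.verts comp x \ I.bag x) + #(I.nodes comp x)) ^ 2) x := by
    intro x hx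
    simp only [mem_erase] at hx
    by_cases hxd : x ∈ done
    · simp [hxd]
    · rw [Set.indicator_of_mem (by simp [hxd, hx.2.1]), Set.indicator_of_mem (by simp [hxd]),
        verts_merge_of_ne hx.1 hx.2.1, nodes_merge_of_ne hx.1 hx.2.1]
  have hb := hF.bag_subset hpN hp
  rw [sum_congr rfl h3, Set.indicator_of_mem (by simpa using hd),
    Set.indicator_of_mem (by simpa using hp), Set.indicator_of_notMem (by simp),
    Set.indicator_of_mem (by simp [hp, hpj]), verts_merge_par, nodes_merge_par,
    card_union_of_disjoint (disjoint_nodes hj hr),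
    (card_union_sdiff hb (hF.bag_subset hj hd) (hF.verts_inter hj hr hd hc)).1]
  have n1 := card_nodes_pos hF hj hd
  have n2 := card_nodes_pos hF hpN hp
  -- `a`, `b` count merged nodes, `c`, `d` forgotten vertices, `e` the vertices forgotten now
  have key : ∀ a b c d e f : ℕ, 1 ≤ a → 1 ≤ b → (c + a) ^ 2 + ((d + b) ^ 2 + f) +
      (d + 1) * (c + e + 1) ≤ 0 + ((d + (c + e) + (b + a)) ^ 2 + f) := by
    intro a b c d e f ha hb
    have h : (d + 1) * (c + e + 1) ≤ (d + b) * (c + e + a) := Nat.mul_le_mul (by omega) (by omega)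
    nlinarith [Nat.zero_le ((d + b) * (c + e + a)), Nat.zero_le (e * (c + a)), Nat.zero_le (e * e)]
  exact key _ _ _ _ _ _ n1 n2

lemma Forest.pot_le (hF : I.Forest done comp)
    (h : ∀ x, x < I.N → x ≠ I.root → x ∈ done) : I.pot done comp ≤ (I.n + I.N) ^ 2 := by
  classical
  unfold pot
  rw [sum_eq_single_of_mem I.root (mem_range.2 I.root_lt)]
  · rw [Set.indicator_of_mem (by simpa using hF.root)]
    have h1 := card_sdiff_add_card_bag_le hF I.root_lt hF.root
    have h2 : #(I.nodes comp I.root) ≤ I.N := (card_filter_le _ _).trans (by simp)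
    exact Nat.pow_le_pow_left (by omega) 2
  · intro x hx hxr
    rw [Set.indicator_of_notMem (by simpa using h x (mem_range.1 hx) hxr)]

end Inst

end MaxBisection

/-! ### From tree decompositions to instances -/

namespace TreeDecomposition

open SimpleGraph

variable {V I : Type*} {E : Finset (V × V)} (D : TreeDecomposition E I)

lemma parent_eq_snd {i : I} {p : D.tree.Walk i D.root} (hp : p.IsPath) : D.parent i = p.snd := by
  have h := D.isTree.existsUnique_path i D.root
  have : h.choose = p := h.unique h.choose_spec.1 hp
  unfold parent
  rw [this]

lemma parent_root : D.parent D.root = D.root := by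
  rw [D.parent_eq_snd (p := .nil) .nil]
  rfl

lemma parent_eq_or_of_adj {i j : I} (h : D.tree.Adj i j) : D.parent i = j ∨ D.parent j = i := by
  obtain ⟨p, hp, -⟩ := D.isTree.existsUnique_path j D.root
  by_cases hi : i ∈ p.support
  · right
    rw [D.parent_eq_snd hp]
    exact (D.isTree.isAcyclic.eq_snd_of_adj_start hp h.symm hi).symm
  · left
    rw [D.parent_eq_snd (p := .cons h p) (hp.cons hi)]
    simp

lemma dist_parent {i : I} (h : i ≠ D.root) :
    D.tree.dist i D.root = D.tree.dist (D.parent i) D.root + 1 := by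
  have hlen : ∀ {a : I} {p : D.tree.Walk a D.root}, p.IsPath → p.length = D.tree.dist a D.root := by
    intro a p hp
    obtain ⟨q, hq, hl⟩ := D.isTree.connected.exists_path_of_dist a D.root
    rw [← hl, (D.isTree.existsUnique_path a D.root).unique hp hq]
  obtain ⟨p, hp, -⟩ := D.isTree.existsUnique_path i D.root
  rw [D.parent_eq_snd hp, ← hlen hp]
  cases p with
  | nil => exact absurd rfl h
  | cons h' q =>
    have hq := hp.of_cons
    rw [Walk.length_cons, hlen hq]
    simp

lemma dist_lt_card [Fintype I] (i : I) : D.tree.dist i D.root < Fintype.card I := by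
  obtain ⟨q, hq, hl⟩ := D.isTree.connected.exists_path_of_dist i D.root
  rw [← hl]
  exact hq.length_lt

end TreeDecomposition

namespace MaxBisection

open Finset

variable {n N : ℕ} {E : Finset (Fin n × Fin n)}

/-- The bag of the node `i`, as a set of numbers. -/
def natBag (D : TreeDecomposition E (Fin N)) (i : ℕ) : Finset ℕ :=
  if h : i < N then (D.bag ⟨i, h⟩).map Fin.valEmbedding else ∅

lemma mem_natBag {D : TreeDecomposition E (Fin N)} {i v : ℕ} :
    v ∈ natBag D i ↔ ∃ (h : i < N) (hv : v < n), ⟨v, hv⟩ ∈ D.bag ⟨i, h⟩ := by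
  unfold natBag
  split_ifs with h
  · simp only [mem_map, Fin.valEmbedding_apply, h, exists_true_left]
    constructor
    · rintro ⟨u, hu, rfl⟩
      exact ⟨u.2, hu⟩
    · rintro ⟨hv, h'⟩
      exact ⟨_, h', rfl⟩
  · simp [h]

/-- The instance given by a list of arcs and a small tree decomposition. -/
noncomputable def instOf (arcs : List (Fin n × Fin n)) (w : Fin n × Fin n → ℚ)
    (D : TreeDecomposition E (Fin N)) (hn : 1 ≤ n) (hnd : arcs.Nodup) (hE : arcs.toFinset = E)
    (hD : D.IsSmall) : Inst where
  n := n
  N := N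
  root := D.root
  m := arcs.length
  t := D.width
  par i := if h : i < N then D.parent ⟨i, h⟩ else 0
  dep i := if h : i < N then D.tree.dist ⟨i, h⟩ D.root else 0
  bag := natBag D
  tail k := (arcs.map fun e => (e.1 : ℕ)).getD k 0
  head k := (arcs.map fun e => (e.2 : ℕ)).getD k 0
  wt k := (arcs.map w).getD k 0
  one_le := hn
  N_le := by simpa [TreeDecomposition.IsSmall] using hD
  root_lt := D.root.2
  m_le := by
    rw [← List.toFinset_card_of_nodup hnd]
    simpa [sq] using card_le_univ arcs.toFinset
  bag_lt i v h := (mem_natBag.1 h).2.1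
  bag_card i := by
    unfold natBag
    split_ifs with h
    · rw [card_map]
      have := le_sup (f := fun i => #(D.bag i)) (mem_univ (⟨i, h⟩ : Fin N))
      unfold TreeDecomposition.width
      omega
    · simp
  par_lt i h := by simp [h]
  dep_root := by simp
  dep_par i h hr := by
    simp only [h, dif_pos, Fin.is_lt, Fin.eta]
    exact D.dist_parent fun h' => hr (by rw [← h'])
  dep_lt i h := by
    simp only [h, dif_pos]
    simpa using D.dist_lt_card ⟨i, h⟩
  cover v hv := by
    obtain ⟨i, hi⟩ := D.node_coverage ⟨v, hv⟩
    exact ⟨i, i.2, mem_natBag.2 ⟨i.2, hv, hi⟩⟩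
  arc a ha := by
    obtain ⟨i, h1, h2⟩ := D.edge_coverage arcs[a] (by simp [← hE])
    exact ⟨i, i.2, mem_natBag.2 ⟨i.2, by simp [ha], by simpa [ha] using h1⟩,
      mem_natBag.2 ⟨i.2, by simp [ha], by simpa [ha] using h2⟩⟩
  cross := by
    intro v A x y hx hy hxA hyA hvx hvy
    obtain ⟨_, hv, hvx'⟩ := mem_natBag.1 hvx
    obtain ⟨_, _, hvy'⟩ := mem_natBag.1 hvy
    obtain ⟨p⟩ := (D.coherence ⟨v, hv⟩).preconnected ⟨⟨x, hx⟩, hvx'⟩ ⟨⟨y, hy⟩, hvy'⟩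
    obtain ⟨d, -, h1, h2⟩ := p.exists_boundary_dart {z | (z.1 : ℕ) ∈ A} hxA hyA
    obtain ⟨⟨⟨a, ha⟩, ⟨b, hb⟩⟩, hab⟩ := d
    have hadj : D.tree.Adj a b := hab
    have key : ∀ {a b : Fin N}, D.tree.Adj a b → D.parent a = b → (a : ℕ) ≠ D.root := by
      intro a b h h' h''
      obtain rfl : a = D.root := Fin.ext h''
      rw [D.parent_root] at h'
      exact h.ne h'
    rcases D.parent_eq_or_of_adj hadj with h | h
    · refine ⟨a, a.2, key hadj h, mem_natBag.2 ⟨a.2, hv, ha⟩, ?_⟩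
      simp only [a.2, dif_pos, Fin.eta, h]
      exact ⟨mem_natBag.2 ⟨b.2, hv, hb⟩, .inl ⟨h1, h2⟩⟩
    · refine ⟨b, b.2, key hadj.symm h, mem_natBag.2 ⟨b.2, hv, hb⟩, ?_⟩
      simp only [b.2, dif_pos, Fin.eta, h]
      exact ⟨mem_natBag.2 ⟨a.2, hv, ha⟩, .inr ⟨h2, h1⟩⟩

namespace Inst

/-- The memory `s` shows the input. -/
structure Input (I : Inst) (s : WordRAM.State) : Prop where
  n : s.reg 0 = I.n
  N : s.reg 1 = I.N
  root : s.reg 2 = I.root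
  m : s.reg 3 = I.m
  par : ∀ i, i < I.N → s.arr 0 i = I.par i
  bag : ∀ i v, i < I.N → v < I.n → s.arr 1 (i * I.n + v) = if v ∈ I.bag i then 1 else 0
  tail : ∀ a, a < I.m → s.arr 2 a = I.tail a
  head : ∀ a, a < I.m → s.arr 3 a = I.head a
  wt : ∀ a, a < I.m → s.warr 0 a = I.wt a

/-- `U` is a bisection. -/
def Balanced (I : Inst) (U : Finset ℕ) : Prop :=
  U ⊆ range I.n ∧ 2 * #U ≤ I.n + 1 ∧ I.n ≤ 2 * #U + 1

/-- The memory `s` shows an optimal bisection and its value. -/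
def Output (I : Inst) (s : WordRAM.State) : Prop :=
  ∃ U, I.Balanced U ∧ (∀ U', I.Balanced U' → I.cut U' ≤ I.cut U) ∧
    (∀ v, v < I.n → s.arr 4 v = if v ∈ U then 1 else 0) ∧ s.wreg 0 = I.cut U

end Inst

section instOf

variable {arcs : List (Fin n × Fin n)} {w : Fin n × Fin n → ℚ}
  {D : TreeDecomposition E (Fin N)} (hn : 1 ≤ n) (hnd : arcs.Nodup) (hE : arcs.toFinset = E)
  (hD : D.IsSmall)

lemma input_instOf : (instOf arcs w D hn hnd hE hD).Input (inputState arcs w D) where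
  n := rfl
  N := rfl
  root := rfl
  m := rfl
  par i hi := rfl
  bag i v hi hv := by
    replace hi : i < N := hi
    replace hv : v < n := hv
    have : (∃ i' : Fin N, ∃ v' : Fin n, i * n + v = i' * n + v' ∧ v' ∈ D.bag i') ↔
        v ∈ natBag D i := by
      rw [mem_natBag]
      constructor
      · rintro ⟨i', v', h, hb⟩
        have h1 : i = i' := by
          have := congrArg (· / n) h
          simpa [Nat.add_div_of_dvd_right (Dvd.intro_left _ rfl), hn, Nat.div_eq_of_lt, hv,
            Nat.mul_div_cancel _ hn] using this
        subst h1
        obtain rfl : v = v' := by omega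
        exact ⟨hi, hv, hb⟩
      · rintro ⟨_, _, h⟩
        exact ⟨⟨i, hi⟩, ⟨v, hv⟩, rfl, h⟩
    change (if (∃ i' : Fin N, ∃ v' : Fin n, i * n + v = i' * n + v' ∧ v' ∈ D.bag i')
      then 1 else 0) = if v ∈ natBag D i then 1 else 0
    simp only [this]
  tail a ha := rfl
  head a ha := rfl
  wt a ha := rfl

lemma cut_instOf (S : Finset (Fin n)) :
    (instOf arcs w D hn hnd hE hD).cut (S.map Fin.valEmbedding) = cutValue E w S := by
  subst hE
  unfold Inst.cut cutValue
  rw [sum_filter, List.sum_toFinset _ hnd]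
  change ∑ a ∈ range arcs.length, _ = _
  rw [sum_range, ← Fin.sum_univ_fun_getElem]
  refine sum_congr rfl fun a _ => ?_
  have h1 : ∀ v : Fin n, (v : ℕ) ∈ S.map Fin.valEmbedding ↔ v ∈ S := fun v => by simp [Fin.val_inj]
  simp [Inst.term, instOf, Fin.val_inj]

lemma balanced_instOf (S : Finset (Fin n)) :
    (instOf arcs w D hn hnd hE hD).Balanced (S.map Fin.valEmbedding) ↔ IsBisection S := by
  have h1 : S.map Fin.valEmbedding ⊆ range n := fun x hx => by
    obtain ⟨v, -, rfl⟩ := mem_map.1 hx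
    simp
  have h2 : #S ≤ n := by simpa using card_le_univ S
  have h3 : #Sᶜ = n - #S := by simp [card_compl]
  unfold Inst.Balanced IsBisection
  change (_ ⊆ range n ∧ 2 * _ ≤ n + 1 ∧ n ≤ _) ↔ _
  rw [card_map, h3, abs_le]
  simp only [h1, true_and]
  omega

lemma isCorrectOutput_of_output {s : WordRAM.State}
    (h : (instOf arcs w D hn hnd hE hD).Output s) : IsCorrectOutput E w s := by
  obtain ⟨U, hU, hopt, hout, hval⟩ := h
  have hsub : U ⊆ range n := hU.1
  obtain ⟨S, rfl⟩ : ∃ S : Finset (Fin n), S.map Fin.valEmbedding = U := by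
    refine ⟨univ.filter fun v => (v : ℕ) ∈ U, ?_⟩
    ext v
    simp only [mem_map, mem_filter, mem_univ, true_and, Fin.valEmbedding_apply]
    constructor
    · rintro ⟨v, hv, rfl⟩
      exact hv
    · exact fun hv => ⟨⟨v, mem_range.1 (hsub hv)⟩, hv, rfl⟩
  rw [balanced_instOf] at hU
  rw [cut_instOf] at hval hopt
  refine ⟨S, ⟨hU, fun S' hS' => ?_⟩, fun v => ?_, hval⟩
  · rw [← cut_instOf hn hnd hE hD]
    exact hopt _ ((balanced_instOf hn hnd hE hD S').2 hS')
  · rw [hout v v.2]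
    simp [Fin.val_inj]

end instOf

end MaxBisection

/-! ### Preprocessing -/

namespace MaxBisection

open WordRAM Finset

/-- The index `i * n + v`, where `i` and `v` are held in registers. -/
def idxE (i v : ℕ) : Expr := .add (.mul (.reg i) (.reg 0)) (.reg v)

/-- Whether the vertex in register `v` lies in the bag of the node in register `i`. -/
def bagE (i v : ℕ) : Expr := .arr 1 (idxE i v)

/-- The bit of the vertex in register `v` in the mask in register `S` for the node in
register `i`. -/
def bitE (i v S : ℕ) : Expr := .mod (.div (.reg S) (.arr 5 (idxE i v))) (.const 2)

/-- The cell `k` of the row `S` of the table `T`, all held in registers. -/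
def cellE (T S k : ℕ) : Expr :=
  .add (.mul (.add (.mul (.reg T) (.reg 4)) (.reg S)) (.add (.reg 0) (.const 1))) (.reg k)

/-- The word bound `B` suffices for the instance: `3 * N + 4` tables have indices below `B`, and so
do the pairs of vertices. -/
structure Inst.Fit (I : Inst) (B : ℕ) : Prop where
  cells : (3 * I.N + 4) * 2 ^ (I.t + 1) * (I.n + 1) ≤ B
  sq : I.n ^ 2 ≤ B

namespace Inst.Fit

variable {I : Inst} {B : ℕ} (h : I.Fit B)
include h

lemma lin : (3 * I.N + 4) * (I.n + 1) ≤ B := by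
  refine le_trans ?_ h.cells
  have : 1 ≤ 2 ^ (I.t + 1) := Nat.one_le_two_pow
  gcongr
  exact Nat.le_mul_of_pos_right _ this

lemma n_le : 2 * I.n + 4 ≤ B := by
  have := h.lin
  nlinarith [Nat.zero_le (I.N * I.n)]

lemma N_le : 3 * I.N + 4 ≤ B := (Nat.le_mul_of_pos_right _ (by omega)).trans h.lin

lemma m_le : I.m ≤ B := I.m_le.trans h.sq

lemma two_pow_le : 4 * 2 ^ (I.t + 1) ≤ B := by
  refine le_trans ?_ h.cells
  calc 4 * 2 ^ (I.t + 1) ≤ (3 * I.N + 4) * 2 ^ (I.t + 1) := by gcongr; omega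
    _ ≤ _ := Nat.le_mul_of_pos_right _ (by omega)

lemma mul_le {i : ℕ} (hi : i < I.N) : i * I.n ≤ B := by
  have := h.lin
  nlinarith [Nat.zero_le (I.N * I.n)]

lemma idx_le {i v : ℕ} (hi : i < I.N) (hv : v < I.n) : i * I.n + v ≤ B := by
  have := h.lin
  nlinarith [Nat.zero_le (I.N * I.n)]

lemma mul_le' {u : ℕ} (hu : u < I.n) : u * I.n ≤ B := by
  have := h.sq
  nlinarith

lemma idx_le' {u v : ℕ} (hu : u < I.n) (hv : v < I.n) : u * I.n + v ≤ B := by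
  have := h.sq
  nlinarith

end Inst.Fit

lemma idx_inj {n i v i' v' : ℕ} (hv : v < n) (hv' : v' < n) :
    i * n + v = i' * n + v' ↔ i = i' ∧ v = v' := by
  constructor
  · intro h
    have hi : i = i' := by
      rcases lt_trichotomy i i' with h' | h' | h'
      · nlinarith
      · exact h'
      · nlinarith
    subst hi
    exact ⟨rfl, by omega⟩
  · rintro ⟨rfl, rfl⟩
    rfl

end MaxBisection

namespace WordRAM.Prog

/-- The program does not change the cells that hold the input. -/
def keepsInput (p : Prog) : Bool :=
  !(p.setsReg 0 || p.setsReg 1 || p.setsReg 2 || p.setsReg 3 || p.setsArr 0 || p.setsArr 1 ||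
    p.setsArr 2 || p.setsArr 3 || p.setsWArr 0)

/-- The program does not change the cells that hold the input and the encoding of subsets. -/
def keepsCtx (p : Prog) : Bool := p.keepsInput && !(p.setsReg 4 || p.setsArr 5 || p.setsArr 6)

end WordRAM.Prog

namespace MaxBisection

open WordRAM Finset

namespace Inst

variable {I : Inst} {B W : ℕ} {s s' : State} {t : ℕ}

lemma Input.agree {p : Prog} (h : I.Input s) (ha : Agree p s s') (hp : p.keepsInput = true) :
    I.Input s' := by
  simp only [Prog.keepsInput, Bool.not_eq_true', Bool.or_eq_false_iff] at hp
  obtain ⟨⟨⟨⟨⟨⟨⟨⟨r0, r1⟩, r2⟩, r3⟩, a0⟩, a1⟩, a2⟩, a3⟩, w0⟩ := hp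
  constructor
  · rw [ha.reg _ r0, h.n]
  · rw [ha.reg _ r1, h.N]
  · rw [ha.reg _ r2, h.root]
  · rw [ha.reg _ r3, h.m]
  · rw [ha.arr _ a0]; exact h.par
  · rw [ha.arr _ a1]; exact h.bag
  · rw [ha.arr _ a2]; exact h.tail
  · rw [ha.arr _ a3]; exact h.head
  · rw [ha.warr _ w0]; exact h.wt

lemma Input.setReg {r x : ℕ} (h : I.Input s) (hr : 4 ≤ r) : I.Input (s.setReg r x) := by
  obtain ⟨h0, h1, h2, h3, h4, h5, h6, h7, h8⟩ := h
  constructor <;> simp only [State.setReg_reg, State.setReg_arr, State.setReg_warr] <;>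
    first | assumption | (rw [if_neg (by omega)]; assumption)

/-- The memory `s` shows the input and the tables for the encoding of subsets of bags; register
`4` holds a common bound `W` for the numbers of subsets. -/
structure Ctx (I : Inst) (W : ℕ) (s : State) : Prop extends I.Input s where
  reg4 : s.reg 4 = W
  pw : ∀ i v, i < I.N → v ∈ I.bag i → s.arr 5 (i * I.n + v) = pw (I.bag i) v
  sz : ∀ i, i < I.N → s.arr 6 i = 2 ^ #(I.bag i)
  sz_le : ∀ i, i < I.N → 2 ^ #(I.bag i) ≤ W
  W_le : W ≤ 2 ^ (I.t + 1)

lemma Ctx.agree {p : Prog} (h : I.Ctx W s) (ha : Agree p s s') (hp : p.keepsCtx = true) :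
    I.Ctx W s' := by
  simp only [Prog.keepsCtx, Bool.and_eq_true, Bool.not_eq_true', Bool.or_eq_false_iff] at hp
  obtain ⟨hi, ⟨r4, a5⟩, a6⟩ := hp
  refine ⟨h.toInput.agree ha hi, ?_, ?_, ?_, h.sz_le, h.W_le⟩
  · rw [ha.reg _ r4, h.reg4]
  · rw [ha.arr _ a5]; exact h.pw
  · rw [ha.arr _ a6]; exact h.sz

lemma Ctx.setReg {r x : ℕ} (h : I.Ctx W s) (hr : 5 ≤ r) : I.Ctx W (s.setReg r x) where
  toInput := h.toInput.setReg (by omega)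
  reg4 := by
    rw [State.setReg_reg, if_neg (by omega)]
    exact h.reg4
  pw := h.pw
  sz := h.sz
  sz_le := h.sz_le
  W_le := h.W_le

end Inst

/-- The pass for vertex `11` of the numbering of the bag of node `10`. -/
def posStep : Prog :=
  .ite (.eq (bagE 10 11) (.const 1))
    (.setArr 5 (idxE 10 11) (.reg 20) ;; .setReg 20 (.add (.reg 20) (.reg 20))) .skip

/-- The numbering of the bag of node `10`. -/
def posRow : Prog :=
  .setReg 20 (.const 1) ;; .forTo 11 0 posStep ;; .setArr 6 (.reg 10) (.reg 20) ;;
    .ite (.lt (.reg 4) (.reg 20)) (.setReg 4 (.reg 20)) .skip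

/-- Computes the encoding of the subsets of all bags. -/
def positions : Prog := .forTo 10 1 posRow

namespace Inst

variable {I : Inst} {B W : ℕ} {s s' : State} {t : ℕ}

lemma filter_lt_succ (X : Finset ℕ) (v : ℕ) :
    #{u ∈ X | u < v + 1} = #{u ∈ X | u < v} + if v ∈ X then 1 else 0 := by
  split_ifs with h
  · have : {u ∈ X | u < v + 1} = insert v {u ∈ X | u < v} := by
      ext u
      simp only [mem_filter, mem_insert]
      constructor
      · intro hu
        rcases (Nat.lt_succ_iff.1 hu.2).lt_or_eq with h' | h'
        · exact .inr ⟨hu.1, h'⟩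
        · exact .inl h'
      · rintro (rfl | hu)
        · exact ⟨h, by omega⟩
        · exact ⟨hu.1, by omega⟩
    rw [this, card_insert_of_notMem (by simp)]
  · rw [add_zero]
    congr 1
    ext u
    simp only [mem_filter]
    refine and_congr_right fun hu => ?_
    have : u ≠ v := fun h' => h (h' ▸ hu)
    omega

lemma posRow_spec (hB : I.Fit B) (hI : I.Input s) {i : ℕ} (hi : i < I.N) (hs : s.reg 10 = i)
    (h4 : s.reg 4 ≤ 2 ^ (I.t + 1))
    (h5 : ∀ i' v, i' < i → v ∈ I.bag i' → s.arr 5 (i' * I.n + v) = pw (I.bag i') v) :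
    WP B posRow s t fun s' t' =>
      ((∀ i' v, i' < i + 1 → v ∈ I.bag i' → s'.arr 5 (i' * I.n + v) = pw (I.bag i') v) ∧
        s'.arr 6 = Function.update (s.arr 6) i (2 ^ #(I.bag i)) ∧
        s'.reg 4 = max (s.reg 4) (2 ^ #(I.bag i))) ∧ t' ≤ t + (20 + I.n * 40) := by
  have hn := hB.n_le
  have hN := hB.N_le
  have h2 := hB.two_pow_le
  have hc := I.bag_card i
  have hle : ∀ v, 2 ^ #{u ∈ I.bag i | u < v} ≤ 2 ^ (I.t + 1) := fun v =>
    Nat.pow_le_pow_right (by omega) ((card_filter_le _ _).trans hc)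
  simp only [posRow, wp_seq, wp_setReg, Expr.Fits, Expr.eval, Expr.cost]
  refine ⟨by omega, WP.for_const I.n (fun k s' =>
    s'.reg 20 = 2 ^ #{u ∈ I.bag i | u < k} ∧
      ∀ i' v, i' < i ∨ i' = i ∧ v < k → v ∈ I.bag i' → s'.arr 5 (i' * I.n + v) = pw (I.bag i') v)
    30 (by simpa using hI.n) (by omega) (by decide) rfl rfl ?_ ?_ ?_ ?_⟩
  · intro k s x h
    exact h
  · simpa using h5
  · rintro k s₁ t₁ hk hs₁ ha ⟨h20, h5'⟩
    have e0 : s₁.reg 0 = I.n := by rw [ha.reg 0 rfl]; simpa using hI.n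
    have e1 : s₁.arr 1 (i * I.n + k) = if k ∈ I.bag i then 1 else 0 := by
      rw [ha.arr 1 rfl]; simpa using hI.bag i k hi hk
    have e10 : s₁.reg 10 = i := by rw [ha.reg 10 rfl]; simpa using hs
    have f1 := hB.mul_le hi
    have f2 := hB.idx_le hi hk
    have f3 := hle k
    simp only [posStep, bagE, idxE, wp_ite, Test.Fits, Expr.Fits, Test.Holds, Expr.eval, e0, e10,
      hs₁, e1, h20, wp_seq, wp_setArr, wp_setReg, wp_skip, Test.cost, Expr.cost]
    refine ⟨⟨⟨⟨⟨by omega, by omega, f1⟩, by omega, f2⟩, by split_ifs <;> omega⟩, by omega⟩, ?_, ?_⟩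
    · intro hb
      have hb : k ∈ I.bag i := by by_contra h; simp [h] at hb
      refine ⟨⟨⟨by omega, by omega, f1⟩, by omega, f2⟩, by omega, ⟨?_, ?_⟩, ?_⟩
      · simp [h20]; omega
      · simp [h20]; omega
      · refine ⟨⟨?_, ?_⟩, by omega⟩
        · simp only [State.setReg_reg, if_true, State.setArr_reg, h20, filter_lt_succ, hb, pow_succ]
          ring
        · intro i' v hv hvb
          have hvn := I.bag_lt _ _ hvb
          simp only [State.setReg_arr, State.setArr_arr, if_true, Function.update_apply,
            idx_inj hvn hk]
          split_ifs with h
          · rw [h.1, h.2]; rfl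
          · exact h5' i' v (by omega) hvb
    · intro hb
      have hb : k ∉ I.bag i := by intro h; simp [h] at hb
      refine ⟨⟨by rw [filter_lt_succ, if_neg hb, add_zero], fun i' v hv hvb => h5' i' v ?_ hvb⟩,
        by omega⟩
      have : ¬ (i' = i ∧ v = k) := by rintro ⟨rfl, rfl⟩; exact hb hvb
      omega
  · rintro s₁ t₁ ha ⟨h20, h5'⟩ ht
    have e10 : s₁.reg 10 = i := by rw [ha.reg 10 rfl]; simpa using hs
    have e4 : s₁.reg 4 = s.reg 4 := by rw [ha.reg 4 rfl]; simp
    have e6 : s₁.arr 6 = s.arr 6 := by rw [ha.arr 6 rfl]; simp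
    have hfull : {u ∈ I.bag i | u < I.n} = I.bag i :=
      filter_true_of_mem fun v hv => I.bag_lt _ _ hv
    rw [hfull] at h20
    have f3 := hle I.n
    rw [hfull] at f3
    simp only [wp_setArr, Expr.Fits, Expr.eval, e10, h20, wp_ite, Test.Fits, Test.Holds,
      State.setArr_reg, e4, wp_setReg, wp_skip, Expr.cost, Test.cost]
    refine ⟨by omega, by omega, ⟨by omega, by omega⟩, fun h => ⟨by omega, ⟨?_, ?_, ?_⟩, by omega⟩,
      fun h => ⟨⟨?_, ?_, ?_⟩, by omega⟩⟩
    · intro i' v hi' hv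
      simpa using h5' i' v (by have := I.bag_lt _ _ hv; omega) hv
    · simp [e6]
    · simp; omega
    · intro i' v hi' hv
      simpa using h5' i' v (by have := I.bag_lt _ _ hv; omega) hv
    · simp [e6]
    · simp; omega

/-- The bound `W` is the largest number of subsets of a bag. -/
lemma positions_spec (hB : I.Fit B) (hI : I.Input s) (h4 : s.reg 4 = 0) :
    WP B positions s t fun s' t' => (∃ W, I.Ctx W s') ∧ t' ≤ t + 5 + I.N * (20 + I.n * 40 + 7) := by
  have hN := hB.N_le
  refine WP.for_const I.N (fun k s' =>
    (∀ i v, i < k → v ∈ I.bag i → s'.arr 5 (i * I.n + v) = pw (I.bag i) v) ∧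
    (∀ i, i < k → s'.arr 6 i = 2 ^ #(I.bag i)) ∧ (∀ i, i < k → 2 ^ #(I.bag i) ≤ s'.reg 4) ∧
    s'.reg 4 ≤ 2 ^ (I.t + 1)) (20 + I.n * 40)
    hI.N (by omega) (by decide) rfl rfl ?_ ?_ ?_ ?_
  · exact fun k s x h => h
  · simp [h4]
  · rintro k s₁ t₁ hk hs₁ ha ⟨h5, h6, hW, hW'⟩
    refine (posRow_spec hB (hI.agree ha rfl) hk hs₁ hW' h5).mono ?_
    rintro s₂ t₂ - ⟨⟨h5', h6', h4'⟩, ht⟩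
    have hk' : 2 ^ #(I.bag k) ≤ 2 ^ (I.t + 1) := Nat.pow_le_pow_right (by omega) (I.bag_card k)
    refine ⟨⟨h5', fun i hi => ?_, fun i hi => ?_, ?_⟩, ht⟩
    · rw [h6', Function.update_apply]
      split_ifs with h
      · rw [h]
      · exact h6 i (by omega)
    · rw [h4']
      rcases Nat.lt_succ_iff_lt_or_eq.1 hi with h | rfl
      · exact (hW i h).trans (le_max_left _ _)
      · exact le_max_right _ _
    · rw [h4']
      exact max_le hW' hk'
  · rintro s₁ t₁ ha ⟨h5, h6, hW, hW'⟩ ht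
    exact ⟨⟨s₁.reg 4, hI.agree ha rfl, rfl, h5, h6, hW, hW'⟩, ht⟩

end Inst

end MaxBisection

/-! ### Common nodes of the arcs, initial tables, depths -/

namespace MaxBisection

open WordRAM Finset

/-- Records the node `10` for the pair of the vertices `11` and `12`. -/
def pairStep : Prog :=
  .ite (.eq (bagE 10 12) (.const 1)) (.setArr 7 (idxE 11 12) (.reg 10)) .skip

/-- Records the node `10` for the pairs that start with the vertex `11`. -/
def pairRow : Prog := .ite (.eq (bagE 10 11) (.const 1)) (.forTo 12 0 pairStep) .skip

/-- Computes a common node for every pair of vertices that has one. -/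
def pairs : Prog := .forTo 10 1 (.forTo 11 0 pairRow)

/-- Marks the entries with no forgotten vertices of the first `N` tables as valid. -/
def leaves : Prog :=
  .setReg 13 (.const 0) ;; .forTo 10 1 (.setReg 21 (.arr 6 (.reg 10)) ;;
    .forTo 12 21 (.setArr 8 (cellE 10 12 13) (.const 1)))

/-- Assigns the `i`-th table to the node `i`. -/
def tables : Prog := .forTo 10 1 (.setArr 9 (.reg 10) (.reg 10))

/-- Adds the weight of the arc `10` to the entry for the mask `12`, if the mask cuts the arc. -/
def arcStep : Prog :=
  .ite (.eq (bitE 11 14 12) (.const 1)) (.ite (.eq (bitE 11 15 12) (.const 0))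
    (.setWArr 1 (cellE 11 12 13) (.add (.arr 1 (cellE 11 12 13)) (.arr 0 (.reg 10)))) .skip) .skip

/-- Adds the weight of the arc `10` to the table of its node. -/
def arcRow : Prog :=
  .setReg 14 (.arr 2 (.reg 10)) ;; .setReg 15 (.arr 3 (.reg 10)) ;;
    .setReg 11 (.arr 7 (idxE 14 15)) ;; .setReg 21 (.arr 6 (.reg 11)) ;; .forTo 12 21 arcStep

/-- Computes the values in the first `N` tables. -/
def arcs : Prog := .setReg 13 (.const 0) ;; .forTo 10 3 arcRow

/-- One step towards the root. -/
def depStep : Prog :=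
  .ite (.eq (.reg 11) (.reg 2)) .skip
    (.setReg 11 (.arr 0 (.reg 11)) ;; .setReg 20 (.add (.reg 20) (.const 1)))

/-- Computes the depths of all nodes by walking up `N` steps from each of them, where a walk stays
at the root once it is there. -/
def depths : Prog :=
  .forTo 10 1 (.setReg 11 (.reg 10) ;; .setReg 20 (.const 0) ;; .forTo 12 1 depStep ;;
    .setArr 10 (.reg 10) (.reg 20))

namespace Inst

variable {I : Inst} {B W : ℕ} {s s' : State} {t : ℕ}

/-- The cell `k` of the row `S` of the table `T`, where a table has `W` rows of `n + 1` cells. -/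
def cell (I : Inst) (W T S k : ℕ) : ℕ := (T * W + S) * (I.n + 1) + k

lemma cell_inj {T S k T' S' k' : ℕ} (hS : S < W) (hS' : S' < W) (hk : k ≤ I.n) (hk' : k' ≤ I.n) :
    I.cell W T S k = I.cell W T' S' k' ↔ T = T' ∧ S = S' ∧ k = k' := by
  unfold cell
  rw [idx_inj (by omega) (by omega), idx_inj hS hS', and_assoc]

lemma cell_lt {T S k T' : ℕ} (hS : S < W) (hk : k ≤ I.n) (hT : T < T') :
    I.cell W T S k < I.cell W T' 0 0 := by
  unfold cell
  have h1 : T * W + S + 1 ≤ T' * W := by nlinarith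
  nlinarith

lemma cell_ge (T S k : ℕ) : I.cell W T 0 0 ≤ I.cell W T S k := by
  unfold cell
  nlinarith [Nat.zero_le (S * (I.n + 1))]

/-- The index of a cell and the intermediate results of its computation respect the bound. -/
lemma Fit.cell_le (hB : I.Fit B) (hW : W ≤ 2 ^ (I.t + 1)) {T S k : ℕ} (hT : T < 3 * I.N + 4)
    (hS : S < W) (hk : k ≤ I.n) : T * W ≤ B ∧ T * W + S ≤ B ∧ (T * W + S) * (I.n + 1) ≤ B ∧
      I.cell W T S k ≤ B := by
  have h1 : T * W + S + 1 ≤ (3 * I.N + 4) * 2 ^ (I.t + 1) :=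
    calc T * W + S + 1 ≤ (T + 1) * W := by nlinarith
      _ ≤ _ := Nat.mul_le_mul hT hW
  have h2 : (T * W + S + 1) * (I.n + 1) ≤ B := (Nat.mul_le_mul_right _ h1).trans hB.cells
  have h3 : T * W + S ≤ (T * W + S) * (I.n + 1) := Nat.le_mul_of_pos_right _ (by omega)
  have h4 : I.cell W T S k ≤ B := by unfold cell; nlinarith
  have h5 : (T * W + S) * (I.n + 1) ≤ I.cell W T S k := by unfold cell; omega
  omega

lemma fits_cellE (hB : I.Fit B) (hW : W ≤ 2 ^ (I.t + 1)) {T S k : ℕ} (h0 : s.reg 0 = I.n)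
    (h4 : s.reg 4 = W) (hT : s.reg T < 3 * I.N + 4) (hS : s.reg S < W) (hk : s.reg k ≤ I.n) :
    (cellE T S k).Fits B s := by
  obtain ⟨h1, h2, h3, h5⟩ := hB.cell_le hW hT hS hk
  have := hB.n_le
  have := hB.N_le
  have := hB.two_pow_le
  simp only [cellE, Expr.Fits, Expr.eval, h0, h4]
  unfold cell at h5
  refine ⟨⟨⟨⟨?_, ?_, ?_⟩, ?_, ?_⟩, ⟨?_, ?_, ?_⟩, ?_⟩, ?_, ?_⟩ <;> omega

lemma eval_cellE {T S k : ℕ} (h0 : s.reg 0 = I.n) (h4 : s.reg 4 = W) :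
    (cellE T S k).eval s = I.cell W (s.reg T) (s.reg S) (s.reg k) := by
  simp [cellE, Expr.eval, h0, h4, cell]

/-- The pair array shows a common node of `p.1` and `p.2`. -/
def PairOK (I : Inst) (s : State) (p : ℕ × ℕ) : Prop :=
  s.arr 7 (p.1 * I.n + p.2) < I.N ∧ p.1 ∈ I.bag (s.arr 7 (p.1 * I.n + p.2)) ∧
    p.2 ∈ I.bag (s.arr 7 (p.1 * I.n + p.2))

/-- The inner loop runs only for the at most `t + 1` vertices of the bag. -/
lemma pairs_spec (hB : I.Fit B) (hI : I.Input s) :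
    WP B pairs s t fun s' t' =>
      (∀ i u v, i < I.N → u ∈ I.bag i → v ∈ I.bag i → I.PairOK s' (u, v)) ∧
      t' ≤ t + 5 + I.N * (I.n * 30 + 5 + (I.t + 1) * (I.n * 30 + 5) + 7) := by
  have hn := hB.n_le
  have hN := hB.N_le
  refine WP.for_union I.N (fun X s => ∀ p ∈ X, I.PairOK s p)
    (fun i => ⋃ u < I.n, ⋃ v < I.n, {p | u ∈ I.bag i ∧ v ∈ I.bag i ∧ p = (u, v)})
    (I.n * 30 + 5 + (I.t + 1) * (I.n * 30 + 5)) ∅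
    hI.N (by omega) (by decide) rfl rfl (fun _ _ _ h => h) (by simp) ?_ ?_
  · intro i s₁ t₁ X hi hs₁ ha₁ hX
    replace hI := hI.agree ha₁ rfl
    refine WP.for_union_sum I.n (fun X s => ∀ p ∈ X, I.PairOK s p)
      (fun u => ⋃ v < I.n, {p | u ∈ I.bag i ∧ v ∈ I.bag i ∧ p = (u, v)})
      (fun u => 15 + if u ∈ I.bag i then I.n * 30 + 5 else 0) X
      hI.n (by omega) (by decide) rfl rfl (fun _ _ _ h => h) hX ?_ ?_
    · intro u s₂ t₂ X hu hs₂ ha₂ hX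
      replace hI := hI.agree ha₂ rfl
      have e10 : s₂.reg 10 = i := by rw [ha₂.reg 10 rfl, hs₁]
      have f1 := hB.mul_le hi
      have f2 := hB.idx_le hi hu
      have e1 := hI.bag i u hi hu
      simp only [pairRow, bagE, idxE, wp_ite, Test.Fits, Expr.Fits, Expr.eval, Test.Holds, hs₂, e10,
        hI.n, e1, Test.cost, Expr.cost]
      refine ⟨⟨⟨⟨⟨by omega, by omega, f1⟩, by omega, f2⟩, by split_ifs <;> omega⟩, by omega⟩,
        ?_, ?_⟩
      · intro hb
        have hb : u ∈ I.bag i := by by_contra h; simp [h] at hb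
        refine WP.for_union I.n (fun X s => ∀ p ∈ X, I.PairOK s p)
          (fun v => {p | u ∈ I.bag i ∧ v ∈ I.bag i ∧ p = (u, v)}) 22 X
          hI.n (by omega) (by decide) rfl rfl (fun _ _ _ h => h) hX ?_ ?_
        · intro v s₃ t₃ X hv hs₃ ha₃ hX
          replace hI := hI.agree ha₃ rfl
          replace e10 : s₃.reg 10 = i := by rw [ha₃.reg 10 rfl, e10]
          have e11 : s₃.reg 11 = u := by rw [ha₃.reg 11 rfl, hs₂]
          have f3 := hB.idx_le hi hv
          have f4 := hB.mul_le' hu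
          have f5 := hB.idx_le' hu hv
          have e1 := hI.bag i v hi hv
          simp only [pairStep, bagE, idxE, wp_ite, Test.Fits, Expr.Fits, Expr.eval, Test.Holds, hs₃,
            e10, e11, hI.n, e1, Test.cost, Expr.cost, wp_setArr, wp_skip]
          refine ⟨⟨⟨⟨⟨by omega, by omega, f1⟩, by omega, f3⟩, by split_ifs <;> omega⟩, by omega⟩,
            ?_, ?_⟩
          · intro hb'
            have hb' : v ∈ I.bag i := by by_contra h; simp [h] at hb'
            refine ⟨⟨⟨by omega, by omega, f4⟩, by omega, f5⟩, by omega, ?_, by omega⟩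
            rintro ⟨u', v'⟩ hp
            simp only [PairOK, State.setArr_arr, if_true, Function.update_apply]
            split_ifs with h
            · have hv' : v' < I.n := by
                rcases hp with hp | ⟨-, -, hp⟩
                · exact I.bag_lt _ _ (hX _ hp).2.2
                · cases hp; exact hv
              obtain ⟨rfl, rfl⟩ := (idx_inj hv' hv).1 h
              exact ⟨hi, hb, hb'⟩
            · rcases hp with hp | ⟨-, -, hp⟩
              · exact hX _ hp
              · cases hp
                exact absurd rfl h
          · intro hb'
            refine ⟨?_, by omega⟩
            rintro p (hp | ⟨-, h, -⟩)
            · exact hX p hp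
            · simp [h] at hb'
        · intro s₃ t₃ ha₃ hX ht
          refine ⟨hX, ?_⟩
          simp only [hb, if_true]
          omega
      · intro hb
        have hb : u ∉ I.bag i := by intro h; simp [h] at hb
        simp only [wp_skip, hb, false_and, if_false]
        refine ⟨?_, by omega⟩
        rintro p (hp | hp)
        · exact hX p hp
        · simp at hp
    · intro s₂ t₂ ha₂ hX ht
      refine ⟨hX, ht.trans ?_⟩
      have h1 : ∑ k ∈ range I.n, (15 + (if k ∈ I.bag i then I.n * 30 + 5 else 0) + 7) =
          I.n * 22 + #{k ∈ range I.n | k ∈ I.bag i} * (I.n * 30 + 5) := by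
        simp only [sum_add_distrib, sum_const, card_range, smul_eq_mul, ← sum_filter]
        ring
      have h2 : #{k ∈ range I.n | k ∈ I.bag i} ≤ I.t + 1 :=
        (card_le_card fun k hk => (mem_filter.1 hk).2).trans (I.bag_card i)
      have h3 := Nat.mul_le_mul_right (I.n * 30 + 5) h2
      omega
  · intro s₁ t₁ ha₁ hX ht
    refine ⟨fun i u v hi hu hv => hX _ (.inr ?_), ht⟩
    simp only [Set.mem_iUnion]
    exact ⟨i, hi, u, I.bag_lt _ _ hu, v, I.bag_lt _ _ hv, hu, hv, rfl⟩

/-- The cells for which `C` holds are exactly the cells of the array `a` that contain `1`, all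
others contain `0`. -/
def Shows (a : ℕ) (C : Set ℕ) (s : State) : Prop :=
  ∀ c, s.arr a c ≤ 1 ∧ (s.arr a c = 1 ↔ c ∈ C)

lemma Shows.update {a c : ℕ} {C : Set ℕ} (h : Shows a C s) :
    Shows a (C ∪ {c}) (s.setArr a c 1) := by
  intro d
  simp only [State.setArr_arr, if_true, Function.update_apply]
  split_ifs with hd
  · simp [hd]
  · simpa [hd] using h d

lemma leaves_spec (hB : I.Fit B) (hI : I.Ctx W s) (h8 : ∀ c, s.arr 8 c = 0) :
    WP B leaves s t fun s' t' =>
      Shows 8 {c | ∃ i S, i < I.N ∧ S < 2 ^ #(I.bag i) ∧ c = I.cell W i S 0} s' ∧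
      t' ≤ t + 10 + I.N * (W * 30 + 10 + 7) := by
  have hn := hB.n_le
  have hN := hB.N_le
  have h2 := hB.two_pow_le
  have hW := hI.W_le
  simp only [leaves, wp_seq, wp_setReg, Expr.Fits, Expr.eval, Expr.cost]
  refine ⟨by omega, WP.for_union I.N (fun X s => Shows 8 X s)
    (fun i => ⋃ S < 2 ^ #(I.bag i), {I.cell W i S 0}) (W * 30 + 10) ∅
    (by simpa using hI.N) (by omega) (by decide) rfl rfl (fun _ _ _ h => h)
    (fun c => by simp [h8]) ?_ ?_⟩
  · intro i s₁ t₁ X hi hs₁ ha₁ hX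
    have e13 : s₁.reg 13 = 0 := by rw [ha₁.reg 13 rfl]; simp
    replace hI := (hI.setReg (r := 13) (x := 0) (by omega)).agree ha₁ rfl
    have hWi := hI.sz_le i hi
    simp only [wp_seq, wp_setReg, Expr.Fits, Expr.eval, Expr.cost, hs₁, hI.sz i hi]
    refine ⟨⟨by omega, by omega⟩, WP.for_union (2 ^ #(I.bag i)) (fun X s => Shows 8 X s)
      (fun S => {I.cell W i S 0}) 17 X (by simp) (by omega) (by decide) rfl rfl (fun _ _ _ h => h)
      hX ?_ ?_⟩
    · intro S s₂ t₂ X hS hs₂ ha₂ hX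
      have e0 : s₂.reg 0 = I.n := by rw [ha₂.reg 0 rfl]; simpa using hI.n
      have e4 : s₂.reg 4 = W := by rw [ha₂.reg 4 rfl]; simpa using hI.reg4
      have e10 : s₂.reg 10 = i := by rw [ha₂.reg 10 rfl]; simpa using hs₁
      have e13 : s₂.reg 13 = 0 := by rw [ha₂.reg 13 rfl]; simpa using e13
      simp only [wp_setArr, eval_cellE e0 e4, e10, e13, hs₂, Expr.Fits, Expr.eval]
      refine ⟨fits_cellE hB hW e0 e4 (by omega) (by omega) (by omega), by omega, hX.update, ?_⟩
      simp only [cellE, Expr.cost]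
      omega
    · intro s₂ t₂ ha₂ hX ht
      refine ⟨hX, ?_⟩
      nlinarith
  · intro s₁ t₁ ha₁ hX ht
    refine ⟨fun c => ?_, by omega⟩
    have := hX c
    simp only [Set.mem_union, Set.mem_empty_iff_false, false_or, Set.mem_iUnion,
      Set.mem_singleton_iff] at this
    refine ⟨this.1, this.2.trans ⟨?_, ?_⟩⟩
    · rintro ⟨i, h, S, h', h''⟩
      exact ⟨i, S, h, h', h''⟩
    · rintro ⟨i, S, h, h', h''⟩
      exact ⟨i, h, S, h', h''⟩

lemma tables_spec (hB : I.Fit B) (hI : I.Input s) :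
    WP B tables s t fun s' t' => (∀ i, i < I.N → s'.arr 9 i = i) ∧ t' ≤ t + 5 + I.N * 10 := by
  have hN := hB.N_le
  refine WP.for_const I.N (fun k s' => ∀ i, i < k → s'.arr 9 i = i) 3
    hI.N (by omega) (by decide) rfl rfl (fun _ _ _ h => h) (by simp) ?_ ?_
  · intro k s₁ t₁ hk hs₁ ha h
    simp only [wp_setArr, Expr.Fits, Expr.eval, Expr.cost, hs₁]
    refine ⟨by omega, by omega, fun i hi => ?_, by omega⟩
    simp only [State.setArr_arr, if_true, Function.update_apply]
    split_ifs with h'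
    · exact h'.symm
    · exact h i (by omega)
  · exact fun s₁ t₁ ha h ht => ⟨h, ht⟩

lemma depths_spec (hB : I.Fit B) (hI : I.Input s) :
    WP B depths s t fun s' t' => (∀ i, i < I.N → s'.arr 10 i = I.dep i) ∧
      t' ≤ t + 5 + I.N * (I.N * 20 + 20) := by
  have hN := hB.N_le
  refine WP.for_const I.N (fun k s' => ∀ i, i < k → s'.arr 10 i = I.dep i) (I.N * 20 + 13)
    hI.N (by omega) (by decide) rfl rfl (fun _ _ _ h => h) (by simp) ?_ ?_
  · intro i s₁ t₁ hi hs₁ ha h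
    replace hI := hI.agree ha rfl
    simp only [wp_seq, wp_setReg, Expr.Fits, Expr.eval, Expr.cost, hs₁]
    refine ⟨by omega, by omega, WP.for_const I.N (fun k s' => s'.reg 11 < I.N ∧
      s'.reg 20 + I.dep (s'.reg 11) = I.dep i ∧ (s'.reg 11 = I.root ∨ k ≤ s'.reg 20)) 13
      (by simpa using hI.N) (by omega) (by decide) rfl rfl (fun _ _ _ h => h)
      (by simpa using hi) ?_ ?_⟩
    · rintro k s₂ t₂ hk hs₂ ha₂ ⟨h1, h2, h3⟩
      have e2 : s₂.reg 2 = I.root := by rw [ha₂.reg 2 rfl]; simpa using hI.root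
      have e0 : s₂.arr 0 (s₂.reg 11) = I.par (s₂.reg 11) := by
        rw [ha₂.arr 0 rfl]; simpa using hI.par _ h1
      have hp := I.par_lt _ h1
      have hd := I.dep_lt i hi
      have hr := I.root_lt
      simp only [depStep, wp_ite, wp_seq, wp_setReg, wp_skip, Test.Fits, Expr.Fits, Test.Holds,
        Expr.eval, e2, e0, Test.cost, Expr.cost, State.setReg_reg, Nat.reduceEqDiff, if_true,
        if_false]
      refine ⟨by omega, fun h => ⟨⟨h1, h2, .inl h⟩, by omega⟩, fun h => ?_⟩
      have := I.dep_par _ h1 h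
      and_intros <;> omega
    · rintro s₂ t₂ ha₂ ⟨h1, h2, h3⟩ ht
      have e10 : s₂.reg 10 = i := by rw [ha₂.reg 10 rfl]; simpa using hs₁
      have e0 : s₂.arr 10 = s₁.arr 10 := by rw [ha₂.arr 10 rfl]; simp
      have hd := I.dep_lt i hi
      -- the walk is longer than the depth of `i`, so that it has reached the root
      have h4 : s₂.reg 11 = I.root := by
        rcases h3 with h3 | h3 <;> omega
      rw [h4, I.dep_root, add_zero] at h2
      simp only [wp_setArr, Expr.Fits, Expr.eval, Expr.cost, e10, h2]
      refine ⟨by omega, by omega, fun j hj => ?_, by omega⟩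
      simp only [State.setArr_arr, if_true, Function.update_apply]
      split_ifs with h'
      · rw [h']
      · rw [e0]
        exact h j (by omega)
  · exact fun s₁ t₁ ha h ht => ⟨h, by omega⟩

/-- The contribution to the cut `U` of those of the first `k` arcs that belong to node `i`. -/
def partialVal (I : Inst) (nd : ℕ → ℕ) (k i : ℕ) (U : Finset ℕ) : ℚ :=
  ∑ a ∈ range k with nd a = i, I.term a U

lemma partialVal_succ (nd : ℕ → ℕ) (k i : ℕ) (U : Finset ℕ) :
    I.partialVal nd (k + 1) i U = I.partialVal nd k i U + if nd k = i then I.term k U else 0 := by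
  unfold partialVal
  rw [sum_filter, sum_range_succ, sum_filter]

lemma mem_bits {X : Finset ℕ} {S v : ℕ} (hv : v ∈ X) :
    v ∈ bits X S ↔ S / pw X v % 2 = 1 := by simp [bits, hv]

lemma fits_bitE (hB : I.Fit B) (hI : I.Ctx W s) {i v S : ℕ} (hi : s.reg i < I.N)
    (hv : s.reg v ∈ I.bag (s.reg i)) (hS : s.reg S < W) : (bitE i v S).Fits B s := by
  have f1 := hB.mul_le hi
  have f2 := hB.idx_le hi (I.bag_lt _ _ hv)
  have hn := hB.n_le
  have hN := hB.N_le
  have h2 := hB.two_pow_le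
  have hW := hI.W_le
  have hvn := I.bag_lt _ _ hv
  have h3 : pw (I.bag (s.reg i)) (s.reg v) ≤ 2 ^ (I.t + 1) := Nat.pow_le_pow_right (by omega)
    ((card_filter_le _ _).trans (I.bag_card _))
  simp only [bitE, idxE, Expr.Fits, Expr.eval, hI.n, hI.pw _ _ hi hv]
  refine ⟨⟨?_, ⟨⟨?_, ?_, ?_⟩, ?_, ?_⟩, ?_⟩, ?_⟩ <;> omega

lemma eval_bitE (hI : I.Ctx W s) {i v S : ℕ} (hi : s.reg i < I.N)
    (hv : s.reg v ∈ I.bag (s.reg i)) :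
    (bitE i v S).eval s = s.reg S / pw (I.bag (s.reg i)) (s.reg v) % 2 := by
  simp [bitE, idxE, Expr.eval, hI.n, hI.pw _ _ hi hv]

lemma arcRow_spec (hB : I.Fit B) (hI : I.Ctx W s) {nd : ℕ → ℕ} (hnd : I.IsNode nd)
    (h7 : ∀ a, a < I.m → s.arr 7 (I.tail a * I.n + I.head a) = nd a) {a : ℕ} (ha : a < I.m)
    (hs : s.reg 10 = a) (h13 : s.reg 13 = 0)
    (hval : ∀ i S, i < I.N → S < 2 ^ #(I.bag i) →
      s.warr 1 (I.cell W i S 0) = I.partialVal nd a i (bits (I.bag i) S)) :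
    WP B arcRow s t fun s' t' =>
      (∀ i S, i < I.N → S < 2 ^ #(I.bag i) →
        s'.warr 1 (I.cell W i S 0) = I.partialVal nd (a + 1) i (bits (I.bag i) S)) ∧
      t' ≤ t + (50 + W * 70) := by
  obtain ⟨hi, ht, hh⟩ := hnd a ha
  have hn := hB.n_le
  have hN := hB.N_le
  have hm := hB.m_le
  have h2 := hB.two_pow_le
  have hW := hI.W_le
  have hvt := I.bag_lt _ _ ht
  have hvh := I.bag_lt _ _ hh
  have f1 := hB.mul_le' hvt
  have f2 := hB.idx_le' hvt hvh
  have hWi := hI.sz_le _ hi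
  simp only [arcRow, idxE, wp_seq, wp_setReg, Expr.Fits, Expr.eval, Expr.cost, hs, hI.tail a ha,
    State.setReg_reg, State.setReg_arr, hI.head a ha, Nat.reduceEqDiff, if_true, if_false, hI.n,
    h7 a ha, hI.sz _ hi]
  refine ⟨by omega, by omega, by omega, by omega, WP.for_const (2 ^ #(I.bag (nd a)))
    (fun k s' => ∀ i S, i < I.N → S < 2 ^ #(I.bag i) → s'.warr 1 (I.cell W i S 0) =
      I.partialVal nd (if i = nd a ∧ S < k then a + 1 else a) i (bits (I.bag i) S)) 55 (by simp)
    (by omega) (by decide) rfl rfl (fun _ _ _ h => h) (by simpa using hval) ?_ ?_⟩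
  · intro k s₁ t₁ hk hs₁ ha₁ hval
    have hI' : I.Ctx W s₁ := Ctx.agree ((((hI.setReg (by omega)).setReg (by omega)).setReg
      (by omega)).setReg (by omega)) ha₁ rfl
    have e10 : s₁.reg 10 = a := by rw [ha₁.reg 10 rfl]; simpa using hs
    have e11 : s₁.reg 11 = nd a := by rw [ha₁.reg 11 rfl]; simp
    have e13 : s₁.reg 13 = 0 := by rw [ha₁.reg 13 rfl]; simpa using h13
    have e14 : s₁.reg 14 = I.tail a := by rw [ha₁.reg 14 rfl]; simp
    have e15 : s₁.reg 15 = I.head a := by rw [ha₁.reg 15 rfl]; simp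
    have b1 := fits_bitE hB hI' (i := 11) (v := 14) (S := 12) (by rwa [e11]) (by rwa [e11, e14])
      (by omega)
    have b2 := fits_bitE hB hI' (i := 11) (v := 15) (S := 12) (by rwa [e11]) (by rwa [e11, e15])
      (by omega)
    have e1 := eval_bitE hI' (i := 11) (v := 14) (S := 12) (by rwa [e11]) (by rwa [e11, e14])
    have e2 := eval_bitE hI' (i := 11) (v := 15) (S := 12) (by rwa [e11]) (by rwa [e11, e15])
    have c1 := fits_cellE hB hW hI'.n hI'.reg4 (T := 11) (S := 12) (k := 13) (by omega) (by omega)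
      (by omega)
    have m1 : I.tail a ∈ bits (I.bag (nd a)) k ↔ _ := mem_bits ht
    have m2 : I.head a ∈ bits (I.bag (nd a)) k ↔ _ := mem_bits hh
    have hother : ∀ i S, ¬ (i = nd a ∧ S = k) →
        (i = nd a ∧ S < k + 1 ↔ i = nd a ∧ S < k) := by omega
    have hkeep : (¬ (I.tail a ∈ bits (I.bag (nd a)) k ∧ I.head a ∉ bits (I.bag (nd a)) k)) →
        ∀ i S, i < I.N → S < 2 ^ #(I.bag i) → s₁.warr 1 (I.cell W i S 0) =
        I.partialVal nd (if i = nd a ∧ S < k + 1 then a + 1 else a) i (bits (I.bag i) S) := by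
      intro hno i S hi' hS
      rw [hval i S hi' hS]
      by_cases h : i = nd a ∧ S = k
      · obtain ⟨rfl, rfl⟩ := h
        simp [partialVal_succ, term, hno]
      · simp only [hother i S h]
    simp only [arcStep, wp_ite, Test.Fits, b1, b2, c1, Expr.Fits, Test.Holds, Expr.eval, e1, e2,
      hs₁, e11, e14, e15, ← m1, wp_setWArr, WExpr.Fits, WExpr.eval, eval_cellE hI'.n hI'.reg4, e13,
      e10, wp_skip, true_and, hI'.wt a ha]
    refine ⟨by omega, fun h1 => ⟨by omega, fun h2 => ⟨by omega, ?_, ?_⟩, fun h2 => ⟨?_, ?_⟩⟩,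
      fun h1 => ⟨hkeep fun h => h1 h.1, ?_⟩⟩
    · intro i S hi' hS
      have h3 : I.head a ∉ bits (I.bag (nd a)) k := by rw [m2]; omega
      simp only [State.setWArr_warr, if_true, Function.update_apply]
      simp only [cell_inj (by have := hI.sz_le i hi'; omega : S < W) (by omega : k < W)
        (Nat.zero_le _) (Nat.zero_le _), and_true]
      by_cases h : i = nd a ∧ S = k
      · obtain ⟨rfl, rfl⟩ := h
        simp [partialVal_succ, term, h1, h3, hval _ _ hi hk]
      · rw [if_neg (by tauto), hval i S hi' hS]
        simp only [hother i S h]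
    · simp [Test.cost, Expr.cost, WExpr.cost, bitE, idxE, cellE]
    · exact hkeep fun h => h.2 (by rw [m2]; omega)
    · simp [Test.cost, Expr.cost, bitE, idxE]
    · simp [Test.cost, Expr.cost, bitE, idxE]
  · intro s₁ t₁ ha₁ hval ht
    refine ⟨fun i S hi' hS => ?_, by nlinarith⟩
    rw [hval i S hi' hS]
    by_cases h : i = nd a
    · subst h
      simp [hS]
    · simp [h, partialVal_succ, Ne.symm h]

lemma arcs_spec (hB : I.Fit B) (hI : I.Ctx W s) {nd : ℕ → ℕ} (hnd : I.IsNode nd)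
    (h7 : ∀ a, a < I.m → s.arr 7 (I.tail a * I.n + I.head a) = nd a) (h0 : ∀ c, s.warr 1 c = 0) :
    WP B arcs s t fun s' t' =>
      (∀ i S, i < I.N → S < 2 ^ #(I.bag i) →
        s'.warr 1 (I.cell W i S 0) = I.val nd id i (bits (I.bag i) S)) ∧
      t' ≤ t + 7 + I.m * (50 + W * 70 + 7) := by
  have hm := hB.m_le
  simp only [arcs, wp_seq, wp_setReg, Expr.Fits, Expr.eval, Expr.cost]
  refine ⟨by omega, WP.for_const I.m
    (fun k s' => ∀ i S, i < I.N → S < 2 ^ #(I.bag i) → s'.warr 1 (I.cell W i S 0) =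
      I.partialVal nd k i (bits (I.bag i) S)) (50 + W * 70) (by simpa using hI.m)
    hm (by decide) rfl rfl (fun _ _ _ h => h) (by simp [h0, partialVal]) ?_ ?_⟩
  · intro a s₁ t₁ ha hs₁ ha₁ hval
    have e7 : s₁.arr 7 = s.arr 7 := by rw [ha₁.arr 7 rfl]; simp
    exact arcRow_spec hB ((hI.setReg (by omega)).agree ha₁ rfl) hnd (by rwa [e7]) ha hs₁
      (by rw [ha₁.reg 13 rfl]; simp) hval
  · exact fun s₁ t₁ ha₁ hval ht => ⟨hval, by omega⟩

end Inst

end MaxBisection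

/-! ### Tables: offers, the change of interface, the join -/

namespace MaxBisection

open WordRAM Finset

/-- Stores the value in weight register `1` and the pointers `31` and `32` in the cell `30`, if
this cell is empty or has a smaller value. -/
def offer : Prog :=
  .ite (.lt (.arr 8 (.reg 30)) (.const 1))
    (.setArr 8 (.reg 30) (.const 1) ;; .setWArr 1 (.reg 30) (.reg 1) ;;
      .setArr 12 (.reg 30) (.reg 31) ;; .setArr 13 (.reg 30) (.reg 32))
    (.ite (.wlt (.arr 1 (.reg 30)) (.reg 1))
      (.setWArr 1 (.reg 30) (.reg 1) ;; .setArr 12 (.reg 30) (.reg 31) ;;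
        .setArr 13 (.reg 30) (.reg 32)) .skip)

/-- The pass for the vertex `11` of the program `proj`. -/
def projStep : Prog :=
  .ite (.eq (bagE 17 11) (.const 1)) (.ite (.eq (bitE 17 11 12) (.const 1))
    (.setReg 23 (.add (.reg 23) (.const 1)) ;; .ite (.eq (bagE 18 11) (.const 1))
      (.setReg 20 (.add (.reg 20) (.arr 5 (idxE 19 11))))
      (.setReg 22 (.add (.reg 22) (.const 1)))) .skip) .skip

/-- For the subset of the bag of node `17` with mask `12`: register `20` gets the mask, with
respect to node `19`, of the part in the bag of node `18`, register `22` the size of the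
remaining part, register `23` the size of the subset. -/
def proj : Prog :=
  .setReg 20 (.const 0) ;; .setReg 22 (.const 0) ;; .setReg 23 (.const 0) ;; .forTo 11 0 projStep

namespace Inst

variable {I : Inst} {B W : ℕ} {s s' s₀ : State} {t : ℕ}

/-- Between the states `s₀` and `s` the entries in `O` have been offered to the tables: an
element `(d, x, l, r)` of `O` is the offer of the value `x` and the pointers `l`, `r` to the
cell `d`. -/
structure Offers (lo : ℕ) (s₀ s : State) (O : Set (ℕ × ℚ × ℕ × ℕ)) : Prop where
  ge : ∀ o ∈ O, lo ≤ o.1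
  old : ∀ d, (∀ o ∈ O, o.1 ≠ d) → s.arr 8 d = s₀.arr 8 d ∧ s.warr 1 d = s₀.warr 1 d ∧
    s.arr 12 d = s₀.arr 12 d ∧ s.arr 13 d = s₀.arr 13 d
  new : ∀ o ∈ O, s.arr 8 o.1 = 1 ∧ (o.1, s.warr 1 o.1, s.arr 12 o.1, s.arr 13 o.1) ∈ O ∧
    o.2.1 ≤ s.warr 1 o.1

lemma Offers.refl (lo : ℕ) (s : State) : Offers lo s s ∅ := ⟨by simp, by simp, by simp⟩

lemma Offers.setReg {lo r x : ℕ} {O} (h : Offers lo s₀ s O) : Offers lo s₀ (s.setReg r x) O :=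
  ⟨h.ge, h.old, h.new⟩

lemma Offers.below {lo d : ℕ} {O} (h : Offers lo s₀ s O) (hd : d < lo) :
    s.arr 8 d = s₀.arr 8 d ∧ s.warr 1 d = s₀.warr 1 d ∧
    s.arr 12 d = s₀.arr 12 d ∧ s.arr 13 d = s₀.arr 13 d :=
  h.old d fun o ho h' => by have := h.ge o ho; omega

lemma Offers.le_one {lo : ℕ} {O} (h : Offers lo s₀ s O) (h0 : ∀ c, s₀.arr 8 c ≤ 1) (d : ℕ) :
    s.arr 8 d ≤ 1 := by
  by_cases hd : ∃ o ∈ O, o.1 = d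
  · obtain ⟨o, ho, rfl⟩ := hd
    exact (h.new o ho).1.le
  · rw [(h.old d fun o ho h' => hd ⟨o, ho, h'⟩).1]
    exact h0 d

lemma offer_spec {lo d l r : ℕ} {O} (hB : 1 ≤ B) (hO : Offers lo s₀ s O) (hd : lo ≤ d)
    (h0 : s₀.arr 8 d = 0) (h1 : ∀ c, s₀.arr 8 c ≤ 1) (e30 : s.reg 30 = d) (e31 : s.reg 31 = l)
    (e32 : s.reg 32 = r) (hdB : d ≤ B) (hlB : l ≤ B) (hrB : r ≤ B) :
    WP B offer s t fun s' t' =>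
      Offers lo s₀ s' (O ∪ {(d, s.wreg 1, l, r)}) ∧ t' ≤ t + 23 := by
  have h8 := hO.le_one h1 d
  have hmem : ∀ o ∈ O, o.1 = d → s.arr 8 d = 1 := fun o ho h => h ▸ (hO.new o ho).1
  have hge : ∀ o ∈ O ∪ {(d, s.wreg 1, l, r)}, lo ≤ o.1 := by
    rintro o (ho | rfl)
    exacts [hO.ge o ho, hd]
  have hold : ∀ d', (∀ o ∈ O ∪ {(d, s.wreg 1, l, r)}, o.1 ≠ d') → d' ≠ d ∧ ∀ o ∈ O, o.1 ≠ d' :=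
    fun d' h => ⟨(h _ (.inr rfl)).symm, fun o ho => h o (.inl ho)⟩
  -- storing the offer is right if no earlier offer for the cell is larger
  have hset : ∀ s' : State, s'.arr 8 d = 1 → (∀ c, c ≠ d → s'.arr 8 c = s.arr 8 c) →
      s'.warr 1 = Function.update (s.warr 1) d (s.wreg 1) →
      s'.arr 12 = Function.update (s.arr 12) d l → s'.arr 13 = Function.update (s.arr 13) d r →
      (∀ o ∈ O, o.1 = d → o.2.1 ≤ s.wreg 1) →
      Offers lo s₀ s' (O ∪ {(d, s.wreg 1, l, r)}) := by
    intro s' a1 a2 a3 a4 a5 a6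
    refine ⟨hge, fun d' hd' => ?_, ?_⟩
    · obtain ⟨hne, h⟩ := hold d' hd'
      rw [a2 d' hne, a3, a4, a5, Function.update_of_ne hne, Function.update_of_ne hne,
        Function.update_of_ne hne]
      exact hO.old d' h
    · rintro o (ho | rfl)
      · by_cases h : o.1 = d
        · refine ⟨by rw [h, a1], .inr ?_, ?_⟩
          · simp [h, a3, a4, a5]
          · simpa [h, a3] using a6 o ho h
        · rw [a2 _ h, a3, a4, a5, Function.update_of_ne h, Function.update_of_ne h,
            Function.update_of_ne h]
          obtain ⟨b1, b2, b3⟩ := hO.new o ho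
          exact ⟨b1, .inl b2, b3⟩
      · exact ⟨a1, .inr (by simp [a3, a4, a5]), by simp [a3]⟩
  simp only [offer, wp_ite, wp_seq, wp_setArr, wp_setWArr, wp_skip, Test.Fits, Test.Holds,
    Expr.Fits, WExpr.Fits, Expr.eval, WExpr.eval, Test.cost, Expr.cost, WExpr.cost, e30, e31, e32,
    State.setArr_reg, State.setWArr_reg, State.setArr_wreg, true_and, and_true]
  refine ⟨⟨⟨hdB, by omega⟩, hB⟩, fun h => ⟨hdB, hB, hdB, hdB, hlB, hdB, hrB, ?_, by omega⟩,
    fun h => ⟨hdB, fun h' => ⟨hdB, hdB, hlB, hdB, hrB, ?_, by omega⟩, fun h' => ⟨?_, by omega⟩⟩⟩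
  · refine hset _ (by simp) (by simp +contextual) (by simp) (by simp) (by simp) ?_
    intro o ho h'
    have := hmem o ho h'
    omega
  · refine hset _ (by simp; omega) (by simp) (by simp) (by simp) (by simp) ?_
    intro o ho h''
    refine (hO.new o ho).2.2.trans ?_
    rw [h'']
    exact h'.le
  · refine ⟨hge, fun d' hd' => hO.old d' (hold d' hd').2, ?_⟩
    -- the cell is not empty any more, which is due to an earlier offer
    obtain ⟨o', ho', hd'⟩ : ∃ o ∈ O, o.1 = d := by
      by_contra hno
      have := (hO.old d fun o ho h' => hno ⟨o, ho, h'⟩).1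
      omega
    rintro o (ho | rfl)
    · obtain ⟨b1, b2, b3⟩ := hO.new o ho
      exact ⟨b1, .inl b2, b3⟩
    · obtain ⟨b1, b2, b3⟩ := hO.new o' ho'
      rw [hd'] at b1 b2
      exact ⟨b1, .inl b2, not_lt.1 h'⟩

lemma mask_insert {X U : Finset ℕ} {v : ℕ} (hv : v ∈ X) (hU : v ∉ U) :
    mask X (insert v U) = mask X U + pw X v := by
  rw [mask, insert_inter_of_mem hv, sum_insert (by simp [hU]), add_comm]
  rfl

lemma fits_bagE (hB : I.Fit B) (hI : I.Input s) {i v : ℕ} (hi : s.reg i < I.N)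
    (hv : s.reg v < I.n) : (bagE i v).Fits B s := by
  have f1 := hB.mul_le hi
  have f2 := hB.idx_le hi hv
  have hn := hB.n_le
  have hN := hB.N_le
  simp only [bagE, idxE, Expr.Fits, Expr.eval, hI.n, hI.bag _ _ hi hv]
  refine ⟨⟨⟨?_, ?_, ?_⟩, ?_, ?_⟩, ?_⟩ <;> (try split_ifs) <;> omega

lemma eval_bagE (hI : I.Input s) {i v : ℕ} (hi : s.reg i < I.N) (hv : s.reg v < I.n) :
    (bagE i v).eval s = if s.reg v ∈ I.bag (s.reg i) then 1 else 0 := by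
  simp [bagE, idxE, Expr.eval, hI.n, hI.bag _ _ hi hv]

lemma eval_bagE_eq_one (hI : I.Input s) {i v : ℕ} (hi : s.reg i < I.N) (hv : s.reg v < I.n) :
    (bagE i v).eval s = 1 ↔ s.reg v ∈ I.bag (s.reg i) := by
  simp [eval_bagE hI hi hv]

lemma proj_spec (hB : I.Fit B) (hI : I.Ctx W s) {a b c S : ℕ} (ha : a < I.N) (hb : b < I.N)
    (hc : c < I.N) (e17 : s.reg 17 = a) (e18 : s.reg 18 = b) (e19 : s.reg 19 = c)
    (e12 : s.reg 12 = S) (hS : S < W) (hsub : I.bag a ∩ I.bag b ⊆ I.bag c) :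
    WP B proj s t fun s' t' =>
      (s'.reg 20 = mask (I.bag c) (bits (I.bag a) S ∩ I.bag b) ∧
        s'.reg 22 = #(bits (I.bag a) S \ I.bag b) ∧ s'.reg 23 = #(bits (I.bag a) S)) ∧
      t' ≤ t + (11 + I.n * 60) := by
  have hn := hB.n_le
  have hN := hB.N_le
  have h2 := hB.two_pow_le
  have hWc := hI.sz_le c hc
  have hW := hI.W_le
  have hbits := bits_subset (I.bag a) S
  have hcard : ∀ k, #{v ∈ bits (I.bag a) S | v < k} ≤ I.n := fun k => by
    simpa using card_le_card (s := {v ∈ bits (I.bag a) S | v < k}) (t := range I.n)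
      fun v hv => mem_range.2 (I.bag_lt a v (hbits (mem_filter.1 hv).1))
  simp only [proj, wp_seq, wp_setReg, Expr.Fits, Expr.eval, Expr.cost]
  refine ⟨by omega, by omega, by omega, WP.for_const I.n (fun k s' =>
    s'.reg 20 = mask (I.bag c) ({v ∈ bits (I.bag a) S | v < k} ∩ I.bag b) ∧
    s'.reg 22 = #({v ∈ bits (I.bag a) S | v < k} \ I.bag b) ∧
    s'.reg 23 = #{v ∈ bits (I.bag a) S | v < k}) 50 (by simpa using hI.n) (by omega) (by decide)
    rfl rfl (fun _ _ _ h => h) (by simp [mask]) ?_ ?_⟩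
  · rintro k s₁ t₁ hk e11 ha₁ ⟨h20, h22, h23⟩
    have hI' : I.Ctx W s₁ := Ctx.agree (((hI.setReg (by omega)).setReg (by omega)).setReg
      (by omega)) ha₁ rfl
    replace e17 : s₁.reg 17 = a := by rw [ha₁.reg 17 rfl]; simpa using e17
    replace e18 : s₁.reg 18 = b := by rw [ha₁.reg 18 rfl]; simpa using e18
    replace e19 : s₁.reg 19 = c := by rw [ha₁.reg 19 rfl]; simpa using e19
    replace e12 : s₁.reg 12 = S := by rw [ha₁.reg 12 rfl]; simpa using e12
    have b1 := fits_bagE hB hI'.toInput (i := 17) (v := 11) (by omega) (by omega)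
    have v1 := eval_bagE_eq_one hI'.toInput (i := 17) (v := 11) (by omega) (by omega)
    have hstay : k ∉ bits (I.bag a) S →
        {v ∈ bits (I.bag a) S | v < k + 1} = {v ∈ bits (I.bag a) S | v < k} := by
      intro h
      ext v
      simp only [mem_filter]
      refine and_congr_right fun hv => ?_
      have : v ≠ k := fun h' => h (h' ▸ hv)
      omega
    simp only [projStep, wp_ite, Test.Fits, Test.Holds, b1, v1, Expr.Fits, Expr.eval, e11, e17,
      wp_skip, true_and]
    refine ⟨by omega, fun hka => ?_, fun hka => ?_⟩
    · have b2 := fits_bitE hB hI' (i := 17) (v := 11) (S := 12) (by omega) (by rwa [e11, e17])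
        (by omega)
      have v2 := eval_bitE hI' (i := 17) (v := 11) (S := 12) (by omega) (by rwa [e11, e17])
      rw [e11, e17, e12] at v2
      have m1 : k ∈ bits (I.bag a) S ↔ _ := mem_bits hka
      simp only [b2, v2, ← m1, true_and]
      refine ⟨by omega, fun hk' => ?_, fun hk' => ?_⟩
      · have hgrow : {v ∈ bits (I.bag a) S | v < k + 1} =
            insert k {v ∈ bits (I.bag a) S | v < k} := by
          ext v
          simp only [mem_filter, mem_insert]
          constructor
          · rintro ⟨h1, h2⟩
            rcases (Nat.lt_succ_iff.1 h2).lt_or_eq with h | h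
            exacts [.inr ⟨h1, h⟩, .inl h]
          · rintro (rfl | ⟨h1, h2⟩)
            exacts [⟨hk', by omega⟩, ⟨h1, by omega⟩]
        have hck := hcard k
        have hck' := hcard (k + 1)
        rw [hgrow, card_insert_of_notMem (by simp)] at hck'
        have hI'' := hI'.setReg (r := 23) (x := s₁.reg 23 + 1) (by omega)
        have b3 := fits_bagE hB hI''.toInput (i := 18) (v := 11) (by simp [e18, hb])
          (by simp [e11, hk])
        have v3 := eval_bagE_eq_one hI''.toInput (i := 18) (v := 11) (by simp [e18, hb])
          (by simp [e11, hk])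
        simp only [State.setReg_reg, Nat.reduceEqDiff, if_false, e11, e18] at v3
        rw [h23] at b3 v3
        simp only [wp_seq, wp_setReg, wp_ite, Test.Fits, Test.Holds, b3, v3, Expr.Fits, Expr.eval,
          true_and, State.setReg_reg, State.setReg_arr, Nat.reduceEqDiff, if_false, if_true, idxE,
          hI'.n, e19, e11, h20, h22, h23, hgrow]
        refine ⟨by omega, by omega, fun hkb => ?_, fun hkb => ?_⟩
        · have hkc := hsub (mem_inter.2 ⟨hka, hkb⟩)
          have f1 := hB.mul_le hc
          have f2 := hB.idx_le hc hk
          rw [hI'.pw c k hc hkc]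
          have hm : mask (I.bag c) (insert k {v ∈ bits (I.bag a) S | v < k} ∩ I.bag b) =
              mask (I.bag c) ({v ∈ bits (I.bag a) S | v < k} ∩ I.bag b) + pw (I.bag c) k := by
            rw [insert_inter_of_mem hkb, mask_insert hkc (by simp)]
          have hlt := mask_lt (I.bag c) (insert k {v ∈ bits (I.bag a) S | v < k} ∩ I.bag b)
          rw [hm] at hlt ⊢
          refine ⟨?_, ⟨rfl, ?_, ?_⟩, ?_⟩
          · and_intros <;> omega
          · rw [insert_sdiff_of_mem _ hkb]
          · rw [card_insert_of_notMem (by simp)]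
          · simp only [Test.cost, bagE, bitE, idxE, Expr.cost]; omega
        · have hcd := card_le_card
            (sdiff_subset (s := {v ∈ bits (I.bag a) S | v < k}) (t := I.bag b))
          refine ⟨by omega, ⟨?_, ?_, ?_⟩, ?_⟩
          · rw [insert_inter_of_notMem hkb]
          · rw [insert_sdiff_of_notMem _ hkb, card_insert_of_notMem (by simp)]
          · rw [card_insert_of_notMem (by simp)]
          · simp only [Test.cost, bagE, bitE, idxE, Expr.cost]; omega
      · rw [hstay hk']
        refine ⟨⟨h20, h22, h23⟩, ?_⟩
        simp only [Test.cost, bagE, bitE, idxE, Expr.cost]; omega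
    · rw [hstay fun h => hka (hbits h)]
      refine ⟨⟨h20, h22, h23⟩, ?_⟩
      simp only [Test.cost, bagE, idxE, Expr.cost]; omega
  · rintro s₁ t₁ ha₁ h ht
    have hfull : {v ∈ bits (I.bag a) S | v < I.n} = bits (I.bag a) S :=
      filter_true_of_mem fun v hv => I.bag_lt a v (hbits hv)
    rw [hfull] at h
    exact ⟨h, by omega⟩

end Inst

end MaxBisection

/-! ### The computation of the tables of a tree edge -/

namespace MaxBisection

open WordRAM Finset

/-- Offers the entry `13` of the row `12` of the table `25` to the table `5`. -/
def forgetStep : Prog :=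
  .setReg 31 (cellE 25 12 13) ;; .setReg 32 (.reg 31) ;;
    .ite (.eq (.arr 8 (.reg 31)) (.const 1))
      (.setReg 33 (.add (.reg 13) (.reg 22)) ;; .setReg 30 (cellE 5 20 33) ;;
        .setWReg 1 (.arr 1 (.reg 31)) ;; offer) .skip

/-- Offers the row `12` of the table `25` to the table `5`. -/
def forgetRow : Prog :=
  .setReg 17 (.reg 10) ;; .setReg 18 (.reg 16) ;; .setReg 19 (.reg 10) ;; proj ;;
    .forTo 13 24 forgetStep

/-- Computes the table `5` of the node `10` with respect to the interface with its parent `16`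
from the table `25` of the node. -/
def forget : Prog := .setReg 21 (.arr 6 (.reg 10)) ;; .forTo 12 21 forgetRow

/-- Offers the combination of the entries `13` of the row `12` of the table `28` and `14` of the
row `20` of the table `5` to the table `6`. -/
def joinStep : Prog :=
  .setReg 31 (cellE 28 12 13) ;; .setReg 32 (cellE 5 20 14) ;;
    .ite (.eq (.arr 8 (.reg 31)) (.const 1)) (.ite (.eq (.arr 8 (.reg 32)) (.const 1))
      (.setReg 33 (.add (.reg 13) (.reg 14)) ;; .setReg 30 (cellE 6 12 33) ;;
        .setWReg 1 (.add (.arr 1 (.reg 31)) (.arr 1 (.reg 32))) ;; offer) .skip) .skip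

/-- Computes the row `12` of the table `6`. -/
def joinRow : Prog :=
  .setReg 17 (.reg 16) ;; .setReg 18 (.reg 10) ;; .setReg 19 (.reg 10) ;; proj ;;
    .forTo 13 26 (.forTo 14 27 joinStep)

/-- Computes the table `6` from the table `28` of the node `16` and the table `5` of its
child `10`. -/
def join : Prog := .setReg 21 (.arr 6 (.reg 16)) ;; .forTo 12 21 joinRow

/-- Computes the number `29` of vertices in the bag of node `10`, but not in that of `16`. -/
def diff : Prog :=
  .setReg 29 (.const 0) ;; .forTo 11 0 (.ite (.eq (bagE 10 11) (.const 1))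
    (.ite (.eq (bagE 16 11) (.const 1)) .skip (.setReg 29 (.add (.reg 29) (.const 1)))) .skip)

namespace Inst

variable {I : Inst} {B W : ℕ} {s s' s₀ : State} {t : ℕ}

/-- The offers made by the row `S` of the table `T` of the node `j` to the table `g`, when the
interface changes to that with the node `p`. -/
def forgetOffers (I : Inst) (W : ℕ) (s : State) (j p T g a S : ℕ) : Set (ℕ × ℚ × ℕ × ℕ) :=
  ⋃ k < a, {o | s.arr 8 (I.cell W T S k) = 1 ∧
    o = (I.cell W g (mask (I.bag j) (bits (I.bag j) S ∩ I.bag p))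
        (k + #(bits (I.bag j) S \ I.bag p)),
      s.warr 1 (I.cell W T S k), I.cell W T S k, I.cell W T S k)}

lemma forgetRow_spec (hB : I.Fit B) (hI : I.Ctx W s) {j p S T g a : ℕ} {O} (hj : j < I.N)
    (hp : p < I.N) (hS : S < 2 ^ #(I.bag j)) (e10 : s.reg 10 = j) (e16 : s.reg 16 = p)
    (e12 : s.reg 12 = S) (e25 : s.reg 25 = T) (e5 : s.reg 5 = g) (e24 : s.reg 24 = a + 1)
    (hg : g < 3 * I.N + 4) (hT : T < g) (ha : a + #(I.bag j \ I.bag p) ≤ I.n)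
    (hO : Offers (I.cell W g 0 0) s₀ s O)
    (h0 : ∀ c, I.cell W g 0 0 ≤ c → s₀.arr 8 c = 0) (h1 : ∀ c, s₀.arr 8 c ≤ 1) :
    WP B forgetRow s t fun s' t' =>
      Offers (I.cell W g 0 0) s₀ s' (O ∪ I.forgetOffers W s₀ j p T g (a + 1) S) ∧
        t' ≤ t + I.n * 300 := by
  have hn := hB.n_le
  have hN := hB.N_le
  have hW := hI.W_le
  have hWj := hI.sz_le j hj
  have hone := I.one_le
  simp only [forgetRow, wp_seq, wp_setReg, Expr.Fits, Expr.eval, Expr.cost, State.setReg_reg,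
    Nat.reduceEqDiff, if_false, e10, e16]
  refine ⟨by omega, by omega, by omega, (proj_spec (a := j) (b := p) (c := j) (S := S) hB
    (((hI.setReg (by omega)).setReg (by omega)).setReg (by omega)) hj hp hj (by simp) (by simp)
    (by simp) (by simpa using e12) (by omega) inter_subset_left).mono ?_⟩
  rintro s₁ t₁ ha₁ ⟨⟨h20, h22, -⟩, ht₁⟩
  replace hI : I.Ctx W s₁ := Ctx.agree (((hI.setReg (by omega)).setReg (by omega)).setReg
    (by omega)) ha₁ rfl
  replace e12 : s₁.reg 12 = S := by rw [ha₁.reg 12 rfl]; simpa using e12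
  replace e25 : s₁.reg 25 = T := by rw [ha₁.reg 25 rfl]; simpa using e25
  replace e5 : s₁.reg 5 = g := by rw [ha₁.reg 5 rfl]; simpa using e5
  replace e24 : s₁.reg 24 = a + 1 := by rw [ha₁.reg 24 rfl]; simpa using e24
  replace hO : Offers (I.cell W g 0 0) s₀ s₁ O := by
    refine ⟨hO.ge, ?_, ?_⟩ <;>
      rw [ha₁.arr 8 rfl, ha₁.arr 12 rfl, ha₁.arr 13 rfl, ha₁.warr 1 rfl]
    exacts [hO.old, hO.new]
  have hf : #(bits (I.bag j) S \ I.bag p) ≤ #(I.bag j \ I.bag p) :=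
    card_le_card (sdiff_subset_sdiff (bits_subset _ _) subset_rfl)
  have he : s₁.reg 20 < W := h20 ▸ (mask_lt _ _).trans_le hWj
  refine WP.for_union (a + 1) (fun X s => Offers (I.cell W g 0 0) s₀ s X) _ 100 O e24 (by omega)
    (by decide) rfl rfl (fun _ _ _ h => h.setReg) hO ?_ fun s₂ t₂ _ h ht => ⟨h, by nlinarith⟩
  intro k s₂ t₂ X hk e13 ha₂ hX
  replace hI := hI.agree ha₂ rfl
  replace e12 : s₂.reg 12 = S := by rw [ha₂.reg 12 rfl, e12]
  replace e25 : s₂.reg 25 = T := by rw [ha₂.reg 25 rfl, e25]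
  replace e5 : s₂.reg 5 = g := by rw [ha₂.reg 5 rfl, e5]
  have e20 : s₂.reg 20 = s₁.reg 20 := ha₂.reg 20 rfl
  have e22 : s₂.reg 22 = s₁.reg 22 := ha₂.reg 22 rfl
  have hcl := cell_lt (I := I) (W := W) (S := S) (k := k) (by omega) (by omega) hT
  have hX' := hX.below hcl
  have hc1 := (hB.cell_le hW (T := T) (S := S) (k := k) (by omega) (by omega) (by omega)).2.2.2
  have hc2 := (hB.cell_le hW (T := g) (S := s₁.reg 20) (k := k + s₁.reg 22) (by omega) he
    (by omega)).2.2.2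
  simp only [forgetStep, wp_seq, wp_setReg, eval_cellE hI.n hI.reg4, e12, e25, e13]
  refine ⟨fits_cellE hB hW hI.n hI.reg4 (by omega) (by omega) (by omega), by simpa [Expr.Fits], ?_⟩
  simp only [wp_ite, Test.Fits, Test.Holds, Expr.Fits, Expr.eval, State.setReg_reg, if_true,
    State.setReg_arr, wp_seq, wp_setReg, wp_setWReg, WExpr.Fits, WExpr.eval, wp_skip,
    Nat.reduceEqDiff, if_false, e13, e22, hX'.1]
  have h8 := h1 (I.cell W T S k)
  refine ⟨by omega, fun hv => ⟨by omega, fits_cellE (W := W) hB hW ?_ ?_ ?_ ?_ ?_, hc1, ?_⟩,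
    fun hv => ⟨?_, ?_⟩⟩
  · simpa using hI.n
  · simpa using hI.reg4
  · simpa [e5] using hg
  · simpa [e20] using he
  · simp; omega
  · rw [eval_cellE (W := W) (by simpa using hI.n) (by simpa using hI.reg4)]
    simp only [State.setReg_reg, Nat.reduceEqDiff, if_true, if_false, e5, e20]
    refine (offer_spec (O := X) (l := I.cell W T S k) (r := I.cell W T S k) (by omega : 1 ≤ B) ?_
      (I.cell_ge g _ _) (h0 _ (I.cell_ge g _ _)) h1 (by simp) (by simp) (by simp) hc2 hc1
      hc1).mono ?_
    · exact ⟨hX.ge, hX.old, hX.new⟩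
    · rintro s₃ t₃ - ⟨h, ht⟩
      refine ⟨?_, ?_⟩
      · convert h using 2
        ext o
        simp [hX'.2.1, hv, h20, h22]
      · simp only [Test.cost, Expr.cost, cellE, WExpr.cost] at ht
        omega
  · refine Offers.setReg (Offers.setReg ?_)
    convert hX using 1
    simp [hv]
  · simp only [Test.cost, Expr.cost, cellE]
    omega

lemma forget_spec (hB : I.Fit B) (hI : I.Ctx W s) {j p T g a : ℕ} (hj : j < I.N)
    (hp : p < I.N) (e10 : s.reg 10 = j) (e16 : s.reg 16 = p)
    (e25 : s.reg 25 = T) (e5 : s.reg 5 = g) (e24 : s.reg 24 = a + 1)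
    (hg : g < 3 * I.N + 4) (hT : T < g) (ha : a + #(I.bag j \ I.bag p) ≤ I.n)
    (h0 : ∀ c, I.cell W g 0 0 ≤ c → s.arr 8 c = 0) (h1 : ∀ c, s.arr 8 c ≤ 1) :
    WP B forget s t fun s' t' =>
      Offers (I.cell W g 0 0) s s'
        (⋃ S < 2 ^ #(I.bag j), I.forgetOffers W s j p T g (a + 1) S) ∧
        t' ≤ t + W * (I.n * 320) := by
  have hN := hB.N_le
  have hWj := hI.sz_le j hj
  have hW := hI.W_le
  have h2 := hB.two_pow_le
  have hone := I.one_le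
  simp only [forget, wp_seq, wp_setReg, Expr.Fits, Expr.eval, Expr.cost, e10, hI.sz j hj]
  refine ⟨by omega, WP.for_union (2 ^ #(I.bag j)) (fun X s' => Offers (I.cell W g 0 0) s s' X)
    (fun S => I.forgetOffers W s j p T g (a + 1) S) (I.n * 300) ∅ (by simp) (by omega)
    (by decide) rfl rfl (fun _ _ _ h => h.setReg) (Offers.refl _ s).setReg ?_ ?_⟩
  · intro S s₁ t₁ X hS e12 ha₁ hX
    refine forgetRow_spec hB ((hI.setReg (by omega)).agree ha₁ rfl) hj hp hS ?_ ?_ e12 ?_ ?_ ?_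
      hg hT ha hX h0 h1
    · rw [ha₁.reg 10 rfl]; simpa using e10
    · rw [ha₁.reg 16 rfl]; simpa using e16
    · rw [ha₁.reg 25 rfl]; simpa using e25
    · rw [ha₁.reg 5 rfl]; simpa using e5
    · rw [ha₁.reg 24 rfl]; simpa using e24
  · intro s₁ t₁ ha₁ hX ht
    rw [Set.empty_union] at hX
    refine ⟨hX, ?_⟩
    have h3 : 1 ≤ 2 ^ #(I.bag j) := Nat.one_le_two_pow
    have h4 : 2 ^ #(I.bag j) * (I.n * 300 + 7) ≤ W * (I.n * 300 + 7) := Nat.mul_le_mul_right _ hWj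
    nlinarith

/-- The offers made by the row `S` of the table `T` of the node `p` to the table `q`, in
combination with the table `g` of its child `j`. -/
def joinOffers (I : Inst) (W : ℕ) (s : State) (j p T g q a b S : ℕ) : Set (ℕ × ℚ × ℕ × ℕ) :=
  ⋃ k < a, ⋃ l < b, {o | s.arr 8 (I.cell W T S k) = 1 ∧
    s.arr 8 (I.cell W g (mask (I.bag j) (bits (I.bag p) S)) l) = 1 ∧
    o = (I.cell W q S (k + l),
      s.warr 1 (I.cell W T S k) + s.warr 1 (I.cell W g (mask (I.bag j) (bits (I.bag p) S)) l),
      I.cell W T S k, I.cell W g (mask (I.bag j) (bits (I.bag p) S)) l)}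

lemma joinRow_spec (hB : I.Fit B) (hI : I.Ctx W s) {j p S T g q a b : ℕ} {O} (hj : j < I.N)
    (hp : p < I.N) (hS : S < 2 ^ #(I.bag p)) (e10 : s.reg 10 = j) (e16 : s.reg 16 = p)
    (e12 : s.reg 12 = S) (e28 : s.reg 28 = T) (e5 : s.reg 5 = g) (e6 : s.reg 6 = q)
    (e26 : s.reg 26 = a + 1) (e27 : s.reg 27 = b + 1)
    (hq : q < 3 * I.N + 4) (hT : T < q) (hg : g < q) (hab : a + b ≤ I.n)
    (hO : Offers (I.cell W q 0 0) s₀ s O)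
    (h0 : ∀ c, I.cell W q 0 0 ≤ c → s₀.arr 8 c = 0) (h1 : ∀ c, s₀.arr 8 c ≤ 1) :
    WP B joinRow s t fun s' t' =>
      Offers (I.cell W q 0 0) s₀ s' (O ∪ I.joinOffers W s₀ j p T g q (a + 1) (b + 1) S) ∧
        t' ≤ t + (I.n * 100 + (a + 1) * (b + 1) * 200) := by
  have hn := hB.n_le
  have hN := hB.N_le
  have hW := hI.W_le
  have hWp := hI.sz_le p hp
  have hWj := hI.sz_le j hj
  have hone := I.one_le
  simp only [joinRow, wp_seq, wp_setReg, Expr.Fits, Expr.eval, Expr.cost, State.setReg_reg,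
    Nat.reduceEqDiff, if_false, e10, e16]
  refine ⟨by omega, by omega, by omega, (proj_spec (a := p) (b := j) (c := j) (S := S) hB
    (((hI.setReg (by omega)).setReg (by omega)).setReg (by omega)) hp hj hj (by simp) (by simp)
    (by simp) (by simpa using e12) (by omega) inter_subset_right).mono ?_⟩
  rintro s₁ t₁ ha₁ ⟨⟨h20, -, -⟩, ht₁⟩
  rw [mask_inter] at h20
  replace hI : I.Ctx W s₁ := Ctx.agree (((hI.setReg (by omega)).setReg (by omega)).setReg
    (by omega)) ha₁ rfl
  replace e12 : s₁.reg 12 = S := by rw [ha₁.reg 12 rfl]; simpa using e12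
  replace e28 : s₁.reg 28 = T := by rw [ha₁.reg 28 rfl]; simpa using e28
  replace e5 : s₁.reg 5 = g := by rw [ha₁.reg 5 rfl]; simpa using e5
  replace e6 : s₁.reg 6 = q := by rw [ha₁.reg 6 rfl]; simpa using e6
  replace e26 : s₁.reg 26 = a + 1 := by rw [ha₁.reg 26 rfl]; simpa using e26
  replace e27 : s₁.reg 27 = b + 1 := by rw [ha₁.reg 27 rfl]; simpa using e27
  replace hO : Offers (I.cell W q 0 0) s₀ s₁ O := by
    refine ⟨hO.ge, ?_, ?_⟩ <;>
      rw [ha₁.arr 8 rfl, ha₁.arr 12 rfl, ha₁.arr 13 rfl, ha₁.warr 1 rfl]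
    exacts [hO.old, hO.new]
  have he : mask (I.bag j) (bits (I.bag p) S) < W := (mask_lt _ _).trans_le hWj
  unfold joinOffers
  generalize mask (I.bag j) (bits (I.bag p) S) = e at h20 he ⊢
  refine WP.for_union (a + 1) (fun X s => Offers (I.cell W q 0 0) s₀ s X) _
    (5 + (b + 1) * 140) O e26 (by omega)
    (by decide) rfl rfl (fun _ _ _ h => h.setReg) hO ?_ fun s₂ t₂ _ h ht => ⟨h, by nlinarith⟩
  intro k s₂ t₂ X hk e13 ha₂ hX
  replace hI := hI.agree ha₂ rfl
  replace e12 : s₂.reg 12 = S := by rw [ha₂.reg 12 rfl, e12]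
  replace e28 : s₂.reg 28 = T := by rw [ha₂.reg 28 rfl, e28]
  replace e5 : s₂.reg 5 = g := by rw [ha₂.reg 5 rfl, e5]
  replace e6 : s₂.reg 6 = q := by rw [ha₂.reg 6 rfl, e6]
  replace h20 : s₂.reg 20 = e := by rw [ha₂.reg 20 rfl, h20]
  replace e27 : s₂.reg 27 = b + 1 := by rw [ha₂.reg 27 rfl, e27]
  refine WP.for_union (b + 1) (fun X s => Offers (I.cell W q 0 0) s₀ s X) _
    133 X e27 (by omega)
    (by decide) rfl rfl (fun _ _ _ h => h.setReg) hX ?_ fun s₂ t₂ _ h ht => ⟨h, by omega⟩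
  intro l s₃ t₃ X hl e14 ha₃ hX
  replace hI := hI.agree ha₃ rfl
  replace e12 : s₃.reg 12 = S := by rw [ha₃.reg 12 rfl, e12]
  replace e13 : s₃.reg 13 = k := by rw [ha₃.reg 13 rfl, e13]
  replace e28 : s₃.reg 28 = T := by rw [ha₃.reg 28 rfl, e28]
  replace e5 : s₃.reg 5 = g := by rw [ha₃.reg 5 rfl, e5]
  replace e6 : s₃.reg 6 = q := by rw [ha₃.reg 6 rfl, e6]
  replace h20 : s₃.reg 20 = e := by rw [ha₃.reg 20 rfl, h20]
  have hX1 := hX.below (cell_lt (I := I) (W := W) (S := S) (k := k) (by omega) (by omega) hT)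
  have hX2 := hX.below (cell_lt (I := I) (W := W) (S := e) (k := l) (by omega) (by omega) hg)
  have hc1 := (hB.cell_le hW (T := T) (S := S) (k := k) (by omega) (by omega) (by omega)).2.2.2
  have hc2 := (hB.cell_le hW (T := g) (S := e) (k := l) (by omega) (by omega) (by omega)).2.2.2
  have hc3 := (hB.cell_le hW (T := q) (S := S) (k := k + l) (by omega) (by omega)
    (by omega)).2.2.2
  simp only [joinStep, wp_seq, wp_setReg, eval_cellE hI.n hI.reg4, e12, e28, e13]
  refine ⟨fits_cellE hB hW hI.n hI.reg4 (by omega) (by omega) (by omega),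
    fits_cellE (W := W) hB hW (by simpa using hI.n) (by simpa using hI.reg4) (by simp; omega)
      (by simp; omega) (by simp; omega), ?_⟩
  rw [eval_cellE (W := W) (by simpa using hI.n) (by simpa using hI.reg4)]
  simp only [wp_ite, Test.Fits, Test.Holds, Expr.Fits, Expr.eval, State.setReg_reg, if_true,
    State.setReg_arr, wp_seq, wp_setReg, wp_setWReg, WExpr.Fits, WExpr.eval, wp_skip,
    Nat.reduceEqDiff, if_false, e13, e5, h20, e14, hX1.1, hX2.1]
  have h8 := h1 (I.cell W T S k)
  have h8' := h1 (I.cell W g e l)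
  refine ⟨by omega, fun hv => ⟨by omega, fun hv' => ⟨by omega, fits_cellE (W := W) hB hW ?_ ?_ ?_
    ?_ ?_, ⟨hc1, hc2⟩, ?_⟩, fun hv' => ⟨?_, ?_⟩⟩, fun hv => ⟨?_, ?_⟩⟩
  · simpa using hI.n
  · simpa using hI.reg4
  · simpa [e6] using hq
  · simp; omega
  · simp; omega
  · rw [eval_cellE (W := W) (by simpa using hI.n) (by simpa using hI.reg4)]
    simp only [State.setReg_reg, Nat.reduceEqDiff, if_true, if_false, e6, e12]
    refine (offer_spec (O := X) (l := I.cell W T S k) (r := I.cell W g e l) (by omega : 1 ≤ B) ?_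
      (I.cell_ge q _ _) (h0 _ (I.cell_ge q _ _)) h1 (by simp) (by simp) (by simp) hc3 hc1
      hc2).mono ?_
    · exact ⟨hX.ge, hX.old, hX.new⟩
    · rintro s₃ t₃ - ⟨h, ht⟩
      refine ⟨?_, ?_⟩
      · convert h using 2
        ext o
        simp [hX1.2.1, hX2.2.1, hv, hv']
      · simp only [Test.cost, Expr.cost, cellE, WExpr.cost] at ht
        omega
  · refine Offers.setReg (Offers.setReg ?_)
    convert hX using 1
    simp [hv']
  · simp only [Test.cost, Expr.cost, cellE]
    omega
  · refine Offers.setReg (Offers.setReg ?_)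
    convert hX using 1
    simp [hv]
  · simp only [Test.cost, Expr.cost, cellE]
    omega

lemma join_spec (hB : I.Fit B) (hI : I.Ctx W s) {j p T g q a b : ℕ} (hj : j < I.N)
    (hp : p < I.N) (e10 : s.reg 10 = j) (e16 : s.reg 16 = p)
    (e28 : s.reg 28 = T) (e5 : s.reg 5 = g) (e6 : s.reg 6 = q)
    (e26 : s.reg 26 = a + 1) (e27 : s.reg 27 = b + 1)
    (hq : q < 3 * I.N + 4) (hT : T < q) (hg : g < q) (hab : a + b ≤ I.n)
    (h0 : ∀ c, I.cell W q 0 0 ≤ c → s.arr 8 c = 0) (h1 : ∀ c, s.arr 8 c ≤ 1) :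
    WP B join s t fun s' t' =>
      Offers (I.cell W q 0 0) s s'
        (⋃ S < 2 ^ #(I.bag p), I.joinOffers W s j p T g q (a + 1) (b + 1) S) ∧
        t' ≤ t + W * (I.n * 120 + (a + 1) * (b + 1) * 200) := by
  have hN := hB.N_le
  have hWp := hI.sz_le p hp
  have hW := hI.W_le
  have h2 := hB.two_pow_le
  have hone := I.one_le
  simp only [join, wp_seq, wp_setReg, Expr.Fits, Expr.eval, Expr.cost, e16, hI.sz p hp]
  refine ⟨by omega, WP.for_union (2 ^ #(I.bag p)) (fun X s' => Offers (I.cell W q 0 0) s s' X)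
    (fun S => I.joinOffers W s j p T g q (a + 1) (b + 1) S) (I.n * 100 + (a + 1) * (b + 1) * 200)
    ∅ (by simp) (by omega) (by decide) rfl rfl (fun _ _ _ h => h.setReg)
    (Offers.refl _ s).setReg ?_ ?_⟩
  · intro S s₁ t₁ X hS e12 ha₁ hX
    refine joinRow_spec hB ((hI.setReg (by omega)).agree ha₁ rfl) hj hp hS ?_ ?_ e12 ?_ ?_ ?_ ?_ ?_
      hq hT hg hab hX h0 h1
    · rw [ha₁.reg 10 rfl]; simpa using e10
    · rw [ha₁.reg 16 rfl]; simpa using e16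
    · rw [ha₁.reg 28 rfl]; simpa using e28
    · rw [ha₁.reg 5 rfl]; simpa using e5
    · rw [ha₁.reg 6 rfl]; simpa using e6
    · rw [ha₁.reg 26 rfl]; simpa using e26
    · rw [ha₁.reg 27 rfl]; simpa using e27
  · intro s₁ t₁ ha₁ hX ht
    rw [Set.empty_union] at hX
    refine ⟨hX, ?_⟩
    have h3 : 1 ≤ 2 ^ #(I.bag p) := Nat.one_le_two_pow
    have h4 := Nat.mul_le_mul_right (I.n * 100 + (a + 1) * (b + 1) * 200 + 7) hWp
    generalize (a + 1) * (b + 1) = x at h4 ht ⊢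
    nlinarith

lemma diff_spec (hB : I.Fit B) (hI : I.Ctx W s) {j p : ℕ} (hj : j < I.N)
    (hp : p < I.N) (e10 : s.reg 10 = j) (e16 : s.reg 16 = p) :
    WP B diff s t fun s' t' => s'.reg 29 = #(I.bag j \ I.bag p) ∧ t' ≤ t + I.n * 50 := by
  have hn := hB.n_le
  have hN := hB.N_le
  have hone := I.one_le
  have hcard : ∀ k, #{v ∈ I.bag j \ I.bag p | v < k} ≤ I.n := fun k => by
    simpa using card_le_card (s := {v ∈ I.bag j \ I.bag p | v < k}) (t := range I.n)
      fun v hv => mem_range.2 (I.bag_lt j v (mem_sdiff.1 (mem_filter.1 hv).1).1)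
  simp only [diff, wp_seq, wp_setReg, Expr.Fits, Expr.eval, Expr.cost]
  refine ⟨by omega, WP.for_const I.n (fun k s' => s'.reg 29 = #{v ∈ I.bag j \ I.bag p | v < k})
    30 (by simpa using hI.n) (by omega) (by decide)
    rfl rfl (fun _ _ _ h => h) (by simp) ?_ ?_⟩
  · intro k s₁ t₁ hk e11 ha₁ h29
    have hI' : I.Ctx W s₁ := Ctx.agree (hI.setReg (by omega)) ha₁ rfl
    replace e10 : s₁.reg 10 = j := by rw [ha₁.reg 10 rfl]; simpa using e10
    replace e16 : s₁.reg 16 = p := by rw [ha₁.reg 16 rfl]; simpa using e16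
    have hc := hcard k
    have b1 := fits_bagE hB hI'.toInput (i := 10) (v := 11) (by omega) (by omega)
    have v1 := eval_bagE_eq_one hI'.toInput (i := 10) (v := 11) (by omega) (by omega)
    have b2 := fits_bagE hB hI'.toInput (i := 16) (v := 11) (by omega) (by omega)
    have v2 := eval_bagE_eq_one hI'.toInput (i := 16) (v := 11) (by omega) (by omega)
    have hf := filter_lt_succ (I.bag j \ I.bag p) k
    have hm : k ∈ I.bag j \ I.bag p ↔ _ := mem_sdiff
    simp only [wp_ite, Test.Fits, Test.Holds, b1, v1, b2, v2, Expr.Fits, Expr.eval, e11, e10, e16,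
      wp_skip, wp_setReg, true_and, h29, State.setReg_reg, if_true]
    refine ⟨by omega, fun h => ⟨by omega, fun h' => ⟨?_, ?_⟩, fun h' => ⟨by omega, ?_, ?_⟩⟩,
      fun h => ⟨?_, ?_⟩⟩
    · rw [hf, if_neg (by tauto), add_zero]
    · simp only [Test.cost, bagE, idxE, Expr.cost]; omega
    · rw [hf, if_pos (by tauto)]
    · simp only [Test.cost, bagE, idxE, Expr.cost]; omega
    · rw [hf, if_neg (by tauto), add_zero]
    · simp only [Test.cost, bagE, idxE, Expr.cost]; omega
  · intro s₁ t₁ ha₁ h ht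
    rw [filter_true_of_mem fun v hv => I.bag_lt j v (mem_sdiff.1 hv).1] at h
    exact ⟨h, by omega⟩

end Inst

end MaxBisection

/-! ### What the tables mean -/

namespace MaxBisection

open WordRAM Finset

namespace Inst

variable {I : Inst} {B W : ℕ} {s s' s₀ : State} {t : ℕ} {den den' : ℕ → Finset ℕ}
  {Vp Vj : Finset ℕ} {vp vj : Finset ℕ → ℚ} {O : Set (ℕ × ℚ × ℕ × ℕ)} {T T' : ℕ}

/-- The tables with numbers below `T` represent solutions: the nonempty cell `c` stands for the
vertex set `den c`, which is the union of the sets of the two cells to which `c` points, unless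
`c` belongs to one of the initial tables. -/
structure Heap (I : Inst) (W T : ℕ) (s : State) (den : ℕ → Finset ℕ) : Prop where
  le_one : ∀ c, s.arr 8 c ≤ 1
  fresh : ∀ c, I.cell W T 0 0 ≤ c → s.arr 8 c = 0
  leaf : ∀ c, c < I.cell W I.N 0 0 → s.arr 8 c = 1 →
    ∃ i S, i < I.N ∧ S < 2 ^ #(I.bag i) ∧ c = I.cell W i S 0 ∧ den c = bits (I.bag i) S
  node : ∀ c, I.cell W I.N 0 0 ≤ c → s.arr 8 c = 1 → s.arr 12 c < c ∧ s.arr 13 c < c ∧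
    s.arr 8 (s.arr 12 c) = 1 ∧ s.arr 8 (s.arr 13 c) = 1 ∧
    den c = den (s.arr 12 c) ∪ den (s.arr 13 c)

/-- The entry `(S, k)` of the table `T` shows a set of the class `C S k` that maximizes `val`;
it is empty if there is no such set. -/
structure Tab (I : Inst) (W : ℕ) (s : State) (den : ℕ → Finset ℕ) (T : ℕ)
    (C : ℕ → ℕ → Finset ℕ → Prop) (val : Finset ℕ → ℚ) : Prop where
  sound : ∀ S k, S < W → k ≤ I.n → s.arr 8 (I.cell W T S k) = 1 →
    C S k (den (I.cell W T S k)) ∧ s.warr 1 (I.cell W T S k) = val (den (I.cell W T S k))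
  complete : ∀ S k U, S < W → k ≤ I.n → C S k U →
    s.arr 8 (I.cell W T S k) = 1 ∧ val U ≤ s.warr 1 (I.cell W T S k)

lemma Heap.congr (h : I.Heap W T s den) (h8 : s'.arr 8 = s.arr 8) (h12 : s'.arr 12 = s.arr 12)
    (h13 : s'.arr 13 = s.arr 13) : I.Heap W T s' den := by
  refine ⟨?_, ?_, ?_, ?_⟩
  · rw [h8]; exact h.le_one
  · rw [h8]; exact h.fresh
  · rw [h8]; exact h.leaf
  · rw [h8, h12, h13]; exact h.node

lemma Tab.congr {C val} (h : I.Tab W s den T C val) (h8 : s'.arr 8 = s.arr 8)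
    (hw : s'.warr 1 = s.warr 1) : I.Tab W s' den T C val := by
  refine ⟨?_, ?_⟩
  · rw [h8, hw]; exact h.sound
  · rw [h8, hw]; exact h.complete

/-- If the entries `O` are offered to the empty table `T`, then the tables below do not change,
and `T` shows the best sets of the classes that contain the offers. -/
lemma Heap.extend (hH : I.Heap W T s₀ den) (hT : I.N ≤ T)
    (hO : Offers (I.cell W T 0 0) s₀ s O) (hlt : ∀ o ∈ O, o.1 < I.cell W (T + 1) 0 0)
    (hsrc : ∀ o ∈ O, s₀.arr 8 o.2.2.1 = 1 ∧ s₀.arr 8 o.2.2.2 = 1) :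
    ∃ den', I.Heap W (T + 1) s den' ∧
      (∀ T' C val, T' < T → I.Tab W s₀ den T' C val → I.Tab W s den' T' C val) ∧
      ∀ C val, (∀ o ∈ O, ∀ S k, S < W → k ≤ I.n → o.1 = I.cell W T S k →
          C S k (den o.2.2.1 ∪ den o.2.2.2) ∧ o.2.1 = val (den o.2.2.1 ∪ den o.2.2.2)) →
        (∀ S k U, S < W → k ≤ I.n → C S k U → ∃ o ∈ O, o.1 = I.cell W T S k ∧ val U ≤ o.2.1) →
        I.Tab W s den' T C val := by
  have hmono : I.cell W T 0 0 ≤ I.cell W (T + 1) 0 0 := by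
    simp only [cell]
    gcongr
    omega
  have hbase : I.cell W I.N 0 0 ≤ I.cell W T 0 0 := by
    simp only [cell]
    gcongr
  have hsrc' : ∀ c, s₀.arr 8 c = 1 → c < I.cell W T 0 0 := fun c hc => by
    by_contra h
    have := hH.fresh c (not_lt.1 h)
    omega
  -- a nonempty new cell holds one of the offers
  have hnew : ∀ c, I.cell W T 0 0 ≤ c → s.arr 8 c = 1 →
      (c, s.warr 1 c, s.arr 12 c, s.arr 13 c) ∈ O := by
    intro c hc h1
    by_contra hno
    have h0 := hH.fresh c hc
    rw [← (hO.old c ?_).1] at h0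
    · omega
    · rintro o ho rfl
      exact hno (hO.new o ho).2.1
  refine ⟨fun c => if I.cell W T 0 0 ≤ c then den (s.arr 12 c) ∪ den (s.arr 13 c) else den c,
    ⟨hO.le_one hH.le_one, ?_, ?_, ?_⟩, ?_, ?_⟩
  · intro c hc
    rw [(hO.old c fun o ho h => by have := hlt o ho; omega).1]
    exact hH.fresh c (hmono.trans hc)
  · intro c hc h1
    have hc' := hc.trans_le hbase
    rw [(hO.below hc').1] at h1
    rw [if_neg (not_le.2 hc')]
    exact hH.leaf c hc h1
  · intro c hc h1
    by_cases hcT : I.cell W T 0 0 ≤ c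
    · have ho := hnew c hcT h1
      obtain ⟨h2, h3⟩ := hsrc _ ho
      have h4 := hsrc' _ h2
      have h5 := hsrc' _ h3
      simp only at h2 h3 h4 h5
      rw [if_pos hcT, if_neg (not_le.2 h4), if_neg (not_le.2 h5), (hO.below h4).1,
        (hO.below h5).1]
      exact ⟨by omega, by omega, h2, h3, rfl⟩
    · have hcT' := not_le.1 hcT
      obtain ⟨b1, b2, b3, b4⟩ := hO.below hcT'
      rw [b1] at h1
      obtain ⟨h2, h3, h4, h5, h6⟩ := hH.node c hc h1
      rw [b3, b4, if_neg hcT, if_neg (by omega), if_neg (by omega),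
        (hO.below (h2.trans hcT')).1, (hO.below (h3.trans hcT')).1]
      exact ⟨h2, h3, h4, h5, h6⟩
  · intro T' C val hT' h
    refine ⟨fun S k hS hk h1 => ?_, fun S k U hS hk hC => ?_⟩ <;>
      have hlt := cell_lt hS hk hT' <;> obtain ⟨b1, b2, -⟩ := hO.below hlt
    · rw [if_neg (not_le.2 hlt), b2]
      exact h.sound S k hS hk (b1 ▸ h1)
    · rw [b1, b2]
      exact h.complete S k U hS hk hC
  · intro C val hs hc
    refine ⟨fun S k hS hk h1 => ?_, fun S k U hS hk hC => ?_⟩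
    · have hge := I.cell_ge (W := W) T S k
      rw [if_pos hge]
      exact hs _ (hnew _ hge h1) S k hS hk rfl
    · obtain ⟨o, ho, h1, h2⟩ := hc S k U hS hk hC
      rw [← h1]
      exact ⟨(hO.new o ho).1, h2.trans (hO.new o ho).2.2⟩

/-- The table for the new interface is right: its offers are exactly the partial solutions of `j`
seen from the bag of `p`. -/
lemma Heap.extend_forget {j p a Tj : ℕ} (hH : I.Heap W T s₀ den) (hT : I.N ≤ T)
    (hj : I.Tab W s₀ den Tj (Fam Vj (I.bag j)) vj)
    (hWj : 2 ^ #(I.bag j) ≤ W) (hVn : #(Vj \ I.bag j) + #(I.bag j) ≤ I.n)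
    (hp : I.bag p ⊆ Vp) (hsep : Vp ∩ Vj ⊆ I.bag p ∩ I.bag j) (ha : a = #(Vj \ I.bag j))
    (hO : Offers (I.cell W T 0 0) s₀ s
      (⋃ S < 2 ^ #(I.bag j), I.forgetOffers W s₀ j p Tj T (a + 1) S)) :
    ∃ den', I.Heap W (T + 1) s den' ∧
      (∀ T' C val, T' < T → I.Tab W s₀ den T' C val → I.Tab W s den' T' C val) ∧
      I.Tab W s den' T (FamG Vj (I.bag j) (I.bag p)) vj := by
  have hcard : ∀ S, #(bits (I.bag j) S \ I.bag p) ≤ #(I.bag j) := fun S =>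
    card_le_card (sdiff_subset.trans (bits_subset _ _))
  have hm : ∀ U, mask (I.bag j) U < W := fun U => (mask_lt _ _).trans_le hWj
  have hmem : ∀ o ∈ ⋃ S < 2 ^ #(I.bag j), I.forgetOffers W s₀ j p Tj T (a + 1) S,
      ∃ S k, S < W ∧ k ≤ a ∧ s₀.arr 8 (I.cell W Tj S k) = 1 ∧
      o = (I.cell W T (mask (I.bag j) (bits (I.bag j) S ∩ I.bag p))
        (k + #(bits (I.bag j) S \ I.bag p)),
        s₀.warr 1 (I.cell W Tj S k), I.cell W Tj S k, I.cell W Tj S k) := by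
    intro o ho
    simp only [forgetOffers, Set.mem_iUnion, Set.mem_ofPred_eq] at ho
    obtain ⟨S, hS, k, hk, h1, h2⟩ := ho
    exact ⟨S, k, by omega, by omega, h1, h2⟩
  obtain ⟨den', h1, h2, h3⟩ := hH.extend hT hO (fun o ho => by
      obtain ⟨S, k, hS, hk, h8, rfl⟩ := hmem o ho
      have := hcard S
      exact cell_lt (hm _) (by omega) (by omega)) fun o ho => by
    obtain ⟨S, k, hS, hk, h8, rfl⟩ := hmem o ho
    exact ⟨h8, h8⟩
  refine ⟨den', h1, h2, h3 _ _ ?_ ?_⟩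
  · intro o ho S' k' hS' hk' ho1
    obtain ⟨S, k, hS, hk, h8, rfl⟩ := hmem o ho
    have := hcard S
    obtain ⟨-, h5, h6⟩ := (cell_inj (hm _) hS' (by omega) hk').1 ho1
    obtain ⟨h7, h9⟩ := hj.sound S k hS (by omega) h8
    rw [union_self, ← h5, ← h6]
    exact ⟨h7.forget hp hsep, h9⟩
  · rintro S' k' U - - ⟨hU, rfl, rfl⟩
    have hF : Fam Vj (I.bag j) (mask (I.bag j) U) #(U \ I.bag j) U := ⟨hU, rfl, rfl⟩
    have hk : #(U \ I.bag j) ≤ a := ha ▸ card_le_card (sdiff_subset_sdiff hU subset_rfl)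
    obtain ⟨h4, h5⟩ := hj.complete _ _ U (hm _) (by omega) hF
    obtain ⟨-, h6, h7⟩ := hF.forget hp hsep
    exact ⟨_, Set.mem_iUnion₂.2 ⟨_, mask_lt _ U, 
      Set.mem_iUnion₂.2 ⟨_, Nat.lt_succ_of_le hk, h4, rfl⟩⟩,
      by simp only [h6, h7], h5⟩

/-- The table of the union is right. The values add up because each side only depends on its own
vertices (`hvp`, `hvj`), on which the union restricts to the two parts. -/
lemma Heap.extend_join {j p a b Tp Tj : ℕ} (hH : I.Heap W T s₀ den) (hT : I.N ≤ T)
    (hP : I.Tab W s₀ den Tp (Fam Vp (I.bag p)) vp)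
    (hJ : I.Tab W s₀ den Tj (FamG Vj (I.bag j) (I.bag p)) vj)
    (hWp : 2 ^ #(I.bag p) ≤ W) (hWj : 2 ^ #(I.bag j) ≤ W) (hab : a + b ≤ I.n)
    (hp : I.bag p ⊆ Vp) (hj : I.bag j ⊆ Vj) (hsep : Vp ∩ Vj ⊆ I.bag p ∩ I.bag j)
    (ha : a = #(Vp \ I.bag p)) (hb : b = #(Vj \ I.bag p))
    (hvp : ∀ U, vp (U ∩ Vp) = vp U) (hvj : ∀ U, vj (U ∩ Vj) = vj U)
    (hO : Offers (I.cell W T 0 0) s₀ s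
      (⋃ S < 2 ^ #(I.bag p), I.joinOffers W s₀ j p Tp Tj T (a + 1) (b + 1) S)) :
    ∃ den', I.Heap W (T + 1) s den' ∧
      (∀ T' C val, T' < T → I.Tab W s₀ den T' C val → I.Tab W s den' T' C val) ∧
      I.Tab W s den' T (Fam (Vp ∪ Vj) (I.bag p)) (fun U => vp U + vj U) := by
  have hm : ∀ U, mask (I.bag j) U < W := fun U => (mask_lt _ _).trans_le hWj
  have hmem : ∀ o ∈ ⋃ S < 2 ^ #(I.bag p), I.joinOffers W s₀ j p Tp Tj T (a + 1) (b + 1) S,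
      ∃ S k l, S < W ∧ k ≤ a ∧ l ≤ b ∧ s₀.arr 8 (I.cell W Tp S k) = 1 ∧
      s₀.arr 8 (I.cell W Tj (mask (I.bag j) (bits (I.bag p) S)) l) = 1 ∧
      o = (I.cell W T S (k + l), s₀.warr 1 (I.cell W Tp S k) +
        s₀.warr 1 (I.cell W Tj (mask (I.bag j) (bits (I.bag p) S)) l),
        I.cell W Tp S k, I.cell W Tj (mask (I.bag j) (bits (I.bag p) S)) l) := by
    intro o ho
    simp only [joinOffers, Set.mem_iUnion, Set.mem_ofPred_eq] at ho
    obtain ⟨S, hS, k, hk, l, hl, h1, h2, h3⟩ := ho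
    exact ⟨S, k, l, by omega, by omega, by omega, h1, h2, h3⟩
  obtain ⟨den', h1, h2, h3⟩ := hH.extend hT hO (fun o ho => by
      obtain ⟨S, k, l, hS, hk, hl, h8, h8', rfl⟩ := hmem o ho
      exact cell_lt hS (by omega) (by omega)) fun o ho => by
    obtain ⟨S, k, l, hS, hk, hl, h8, h8', rfl⟩ := hmem o ho
    exact ⟨h8, h8'⟩
  refine ⟨den', h1, h2, h3 _ _ ?_ ?_⟩
  · intro o ho S' k' hS' hk' ho1
    obtain ⟨S, k, l, hS, hk, hl, h8, h8', rfl⟩ := hmem o ho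
    obtain ⟨-, rfl, rfl⟩ := (cell_inj hS hS' (by omega) hk').1 ho1
    obtain ⟨h4, h5⟩ := hP.sound S k hS (by omega) h8
    obtain ⟨h6, h7⟩ := hJ.sound _ l (hm _) (by omega) h8'
    obtain ⟨h9, h10, h11⟩ := Fam.join hp hsep h4 h6
    refine ⟨h9, ?_⟩
    simp only
    rw [← hvp (den _ ∪ den _), ← hvj (den _ ∪ den _), h10, h11, h5, h7]
  · intro S' k' U hS' hk' hU
    obtain ⟨h4, h5, h6⟩ := hU.split hp hj hsep
    obtain ⟨h7, h8⟩ := hP.complete _ _ _ hS' (by omega) h4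
    obtain ⟨h9, h10⟩ := hJ.complete _ _ _ (hm _) (by omega) h5
    rw [hvp] at h8
    rw [hvj] at h10
    have hka : #((U ∩ Vp) \ I.bag p) ≤ a :=
      ha ▸ card_le_card (sdiff_subset_sdiff inter_subset_right subset_rfl)
    have hkb : #((U ∩ Vj) \ I.bag p) ≤ b :=
      hb ▸ card_le_card (sdiff_subset_sdiff inter_subset_right subset_rfl)
    have hS : S' < 2 ^ #(I.bag p) := hU.2.1 ▸ mask_lt _ _
    exact ⟨_, Set.mem_iUnion₂.2 ⟨_, hS, Set.mem_iUnion₂.2 ⟨_, Nat.lt_succ_of_le hka,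
      Set.mem_iUnion₂.2 ⟨_, Nat.lt_succ_of_le hkb, h7, h9, rfl⟩⟩⟩, by simp only [h6],
      add_le_add h8 h10⟩

end Inst

end MaxBisection

/-! ### Dynamic programming along the tree -/

namespace MaxBisection

open WordRAM Finset

/-- Merges the node `10` into its parent: the table and the number of forgotten vertices of the
parent are replaced by those for the union. -/
def process : Prog :=
  .setReg 16 (.arr 0 (.reg 10)) ;; .setReg 25 (.arr 9 (.reg 10)) ;;
  .setReg 28 (.arr 9 (.reg 16)) ;; diff ;; .setReg 24 (.add (.arr 11 (.reg 10)) (.const 1)) ;;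
  .setReg 26 (.add (.arr 11 (.reg 16)) (.const 1)) ;; .setReg 27 (.add (.reg 24) (.reg 29)) ;;
  .setReg 6 (.add (.reg 5) (.const 1)) ;; forget ;; join ;; .setArr 9 (.reg 16) (.reg 6) ;;
  .setArr 11 (.reg 16) (.add (.arr 11 (.reg 16)) (.add (.arr 11 (.reg 10)) (.reg 29))) ;;
  .setReg 5 (.add (.reg 5) (.const 2))

/-- Merges all nodes into the root, the nodes of greater depth first. -/
def dynamic : Prog :=
  .setReg 5 (.reg 1) ;; .forTo 15 1 (.setReg 34 (.sub (.reg 1) (.reg 15)) ;;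
    .forTo 10 1 (.ite (.eq (.arr 10 (.reg 10)) (.reg 34)) process .skip))

namespace Inst

variable {I : Inst} {B W : ℕ} {s s' s₀ : State} {t : ℕ} {den : ℕ → Finset ℕ} {nd : ℕ → ℕ}
  {done : Set ℕ} {comp : ℕ → ℕ}

/-- The nodes that have not been merged into another node. -/
def alive (I : Inst) (comp : ℕ → ℕ) : Finset ℕ := {x ∈ range I.N | comp x = x}

/-- The nodes in `done` have been merged, and register `5` is the number of tables used so far.
For every remaining node `i`, `arr 9` shows the number of a table of the best partial solutions
on the vertices merged into `i`, with the bag of `i` as interface, and `arr 11` shows the number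
of the vertices outside the interface. -/
structure DP (I : Inst) (W : ℕ) (nd : ℕ → ℕ) (s : State) (done : Set ℕ) (comp : ℕ → ℕ)
    (den : ℕ → Finset ℕ) : Prop where
  forest : I.Forest done comp
  heap : I.Heap W (s.reg 5) s den
  ge : I.N ≤ s.reg 5
  le : s.reg 5 + 2 * #(I.alive comp) ≤ 3 * I.N
  tab : ∀ i, i < I.N → i ∉ done → s.arr 9 i < s.reg 5 ∧
    I.Tab W s den (s.arr 9 i) (Fam (I.verts comp i) (I.bag i)) (I.val nd comp i)
  cnt : ∀ i, i < I.N → i ∉ done → s.arr 11 i = #(I.verts comp i \ I.bag i)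

lemma DP.congr (h : I.DP W nd s done comp den) (h5 : s'.reg 5 = s.reg 5)
    (h8 : s'.arr 8 = s.arr 8) (h9 : s'.arr 9 = s.arr 9) (h11 : s'.arr 11 = s.arr 11)
    (h12 : s'.arr 12 = s.arr 12) (h13 : s'.arr 13 = s.arr 13) (hw : s'.warr 1 = s.warr 1) :
    I.DP W nd s' done comp den := by
  refine ⟨h.forest, ?_, ?_, ?_, ?_, ?_⟩
  · rw [h5]; exact h.heap.congr h8 h12 h13
  · rw [h5]; exact h.ge
  · rw [h5]; exact h.le
  · intro i hi hd
    rw [h5, h9]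
    exact ⟨(h.tab i hi hd).1, (h.tab i hi hd).2.congr h8 hw⟩
  · rw [h11]; exact h.cnt

lemma alive_merge {j : ℕ} (hF : I.Forest done comp) (hj : j < I.N) (hr : j ≠ I.root)
    (hd : j ∉ done) : #(I.alive (I.merge comp j)) + 1 = #(I.alive comp) := by
  have hcj := hF.self j hj hd
  have h : I.alive (I.merge comp j) = (I.alive comp).erase j := by
    ext x
    have hpj := par_ne hj hr
    have hcp := hF.comp_par hj hr hd
    simp only [alive, mem_filter, mem_erase, mem_range]
    unfold Inst.merge
    split_ifs with h
    · constructor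
      · rintro ⟨h1, rfl⟩
        exact absurd (hcp.symm.trans h) hpj
      · rintro ⟨h1, h2, h3⟩
        exact absurd (h3.symm.trans h) h1
    · constructor
      · rintro ⟨h1, h2⟩
        exact ⟨fun hx => h (by rw [hx, hcj]), h1, h2⟩
      · rintro ⟨h1, h2, h3⟩
        exact ⟨h2, h3⟩
  rw [h, card_erase_add_one]
  simp [alive, hj, hcj]

/-- The two changes of interface are paid per merge, the join by the potential. -/
lemma process_spec (hB : I.Fit B) (hI : I.Ctx W s) (hnd : I.IsNode nd) {j : ℕ}
    (hD : I.DP W nd s done comp den) (hj : j < I.N) (hr : j ≠ I.root) (hd : j ∉ done)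
    (hc : ∀ x, x < I.N → x ≠ I.root → I.par x = j → x ∈ done) (e10 : s.reg 10 = j) :
    WP B process s t fun s' t' =>
      (∃ den', I.DP W nd s' (insert j done) (I.merge comp j) den') ∧
      t' + W * 200 * I.pot done comp ≤
        t + W * (I.n * 600) + W * 200 * I.pot (insert j done) (I.merge comp j) := by
  have hn := hB.n_le
  have hN := hB.N_le
  have hone := I.one_le
  have hF := hD.forest
  have hp := I.par_lt j hj
  have hpd := hF.par_notMem hj hr hd
  have hpj := par_ne hj hr
  have hpot := hF.pot_merge hj hr hd hc
  have hal := alive_merge hF hj hr hd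
  have hsep := hF.verts_inter hj hr hd hc
  have hbp := hF.bag_subset hp hpd
  have hbj := hF.bag_subset hj hd
  obtain ⟨hu1, hu2⟩ := card_union_sdiff hbp hbj hsep
  have hF' := hF.merge hj hr hd hc
  have hcj := card_sdiff_add_card_bag_le hF hj hd
  have hcp := card_sdiff_add_card_bag_le hF hp hpd
  have hcu := card_sdiff_add_card_bag_le hF' hp (hF'.self _ hp (by
    simp only [Set.mem_insert_iff, not_or]; exact ⟨hpj, hpd⟩) ▸ hF'.active _ hp)
  rw [verts_merge_par, hu1] at hcu
  obtain ⟨hTj, hTabj⟩ := hD.tab j hj hd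
  obtain ⟨hTp, hTabp⟩ := hD.tab _ hp hpd
  have hkj := hD.cnt j hj hd
  have hkp := hD.cnt _ hp hpd
  have hge := hD.ge
  have hle := hD.le
  have hWj := hI.sz_le j hj
  have hWp := hI.sz_le _ hp
  have hW1 : 1 ≤ W := Nat.one_le_two_pow.trans hWj
  have hvm := verts_merge_par (I := I) (comp := comp) (j := j)
  have hvalm : I.val nd (I.merge comp j) (I.par j) = fun U => _ :=
    funext fun U => val_merge_par (nd := nd) (comp := comp) hj hr U
  generalize ep : I.par j = p at *
  generalize ekj : #(I.verts comp j \ I.bag j) = kj at *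
  generalize ekp : #(I.verts comp p \ I.bag p) = kp at *
  generalize ed : #(I.bag j \ I.bag p) = d at *
  generalize eTj : s.arr 9 j = Tj at *
  generalize eTp : s.arr 9 p = Tp at *
  generalize e5 : s.reg 5 = g at *
  simp only [process, wp_seq, wp_setReg, Expr.Fits, Expr.eval, Expr.cost, State.setReg_reg,
    State.setReg_arr, Nat.reduceEqDiff, if_false, if_true, e10, hI.par j hj, ep, eTj, eTp]
  refine ⟨by omega, by omega, by omega, (diff_spec (j := j) (p := p) hB (((hI.setReg
    (by omega)).setReg (by omega)).setReg (by omega)) hj hp (by simpa using e10)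
    (by simp)).mono ?_⟩
  rintro s₁ t₁ ha₁ ⟨h29, ht₁⟩
  rw [ed] at h29
  have hI₁ : I.Ctx W s₁ := Ctx.agree (((hI.setReg (by omega)).setReg (by omega)).setReg
    (by omega)) ha₁ rfl
  have a11 : s₁.arr 11 = s.arr 11 := ha₁.arr 11 rfl
  have a8 : s₁.arr 8 = s.arr 8 := ha₁.arr 8 rfl
  have a9 : s₁.arr 9 = s.arr 9 := ha₁.arr 9 rfl
  have a12 : s₁.arr 12 = s.arr 12 := ha₁.arr 12 rfl
  have a13 : s₁.arr 13 = s.arr 13 := ha₁.arr 13 rfl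
  have w1 : s₁.warr 1 = s.warr 1 := ha₁.warr 1 rfl
  have f10 : s₁.reg 10 = j := by rw [ha₁.reg 10 rfl]; simpa using e10
  have f5 : s₁.reg 5 = g := by rw [ha₁.reg 5 rfl]; simpa using e5
  have f16 : s₁.reg 16 = p := by rw [ha₁.reg 16 rfl]; simp
  have f25 : s₁.reg 25 = Tj := by rw [ha₁.reg 25 rfl]; simp
  have f28 : s₁.reg 28 = Tp := by rw [ha₁.reg 28 rfl]; simp
  simp only [f10, f16, f5, h29, a11, hkj, hkp]
  refine ⟨by omega, by omega, by omega, by omega, ?_⟩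
  have hI₂ : I.Ctx W ((((s₁.setReg 24 (kj + 1)).setReg 26 (kp + 1)).setReg 27
      (kj + 1 + d)).setReg 6 (g + 1)) := (((hI₁.setReg (by omega)).setReg (by omega)).setReg
    (by omega)).setReg (by omega)
  generalize es₂ : (((s₁.setReg 24 (kj + 1)).setReg 26 (kp + 1)).setReg 27
      (kj + 1 + d)).setReg 6 (g + 1) = s₂ at hI₂ ⊢
  have hH : I.Heap W g s₂ den := by
    rw [← es₂]
    exact (e5 ▸ hD.heap).congr a8 a12 a13
  replace hTabj := hTabj.congr (s' := s₂) (by rw [← es₂]; exact a8) (by rw [← es₂]; exact w1)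
  replace hTabp := hTabp.congr (s' := s₂) (by rw [← es₂]; exact a8) (by rw [← es₂]; exact w1)
  refine (forget_spec (j := j) (p := p) (T := Tj) (g := g) (a := kj) hB hI₂ hj hp
    (by simpa [← es₂]) (by simpa [← es₂])
    (by simpa [← es₂]) (by simpa [← es₂]) (by simp [← es₂]) (by omega) hTj (by omega)
    hH.fresh hH.le_one).mono ?_
  rintro s₃ t₃ ha₃ ⟨hO₃, ht₃⟩
  obtain ⟨den₃, hH₃, hold₃, hnew₃⟩ := hH.extend_forget hge hTabj hWj (by omega) hbp hsep
    ekj.symm hO₃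
  have hI₃ := hI₂.agree ha₃ rfl
  refine (join_spec (j := j) (p := p) (T := Tp) (g := g) (q := g + 1) (a := kp) (b := kj + d)
    hB hI₃ hj hp ?_ ?_ ?_ ?_ ?_ ?_ ?_ (by omega) (by omega) (by omega) (by omega)
    hH₃.fresh hH₃.le_one).mono ?_
  · rw [ha₃.reg 10 rfl, ← es₂]; simpa
  · rw [ha₃.reg 16 rfl, ← es₂]; simpa
  · rw [ha₃.reg 28 rfl, ← es₂]; simpa
  · rw [ha₃.reg 5 rfl, ← es₂]; simpa
  · rw [ha₃.reg 6 rfl, ← es₂]; simp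
  · rw [ha₃.reg 26 rfl, ← es₂]; simp
  · rw [ha₃.reg 27 rfl, ← es₂]; simp; omega
  rintro s₄ t₄ ha₄ ⟨hO₄, ht₄⟩
  obtain ⟨den₄, hH₄, hold₄, hnew₄⟩ := hH₃.extend_join (by omega)
    (hold₃ _ _ _ hTp hTabp) hnew₃ hWp hWj (by omega) hbp hbj hsep ekp.symm hu2.symm
    (val_inter hnd p) (val_inter hnd j) hO₄
  have hI₄ := hI₃.agree ha₄ rfl
  have b9 : s₄.arr 9 = s.arr 9 := by
    rw [ha₄.arr 9 rfl, ha₃.arr 9 rfl, ← es₂]; simpa using a9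
  have b11 : s₄.arr 11 = s.arr 11 := by
    rw [ha₄.arr 11 rfl, ha₃.arr 11 rfl, ← es₂]; simpa using a11
  have g16 : s₄.reg 16 = p := by rw [ha₄.reg 16 rfl, ha₃.reg 16 rfl, ← es₂]; simpa
  have g10 : s₄.reg 10 = j := by rw [ha₄.reg 10 rfl, ha₃.reg 10 rfl, ← es₂]; simpa
  have g5 : s₄.reg 5 = g := by rw [ha₄.reg 5 rfl, ha₃.reg 5 rfl, ← es₂]; simpa
  have g6 : s₄.reg 6 = g + 1 := by rw [ha₄.reg 6 rfl, ha₃.reg 6 rfl, ← es₂]; simp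
  have g29 : s₄.reg 29 = d := by rw [ha₄.reg 29 rfl, ha₃.reg 29 rfl, ← es₂]; simpa
  simp only [wp_setArr, Expr.Fits, Expr.eval, Expr.cost, State.setArr_reg, State.setArr_arr,
    Nat.reduceEqDiff, if_false, g16, g10, g5, g6, g29, b11, b9, hkj, hkp]
  refine ⟨by omega, by omega, by omega, by omega, by omega, ⟨den₄, hF', ?_, ?_, ?_, ?_, ?_⟩, ?_⟩
  · simp only [State.setReg_reg, if_true]
    exact hH₄.congr rfl rfl rfl
  · simp; omega
  · simp; omega
  · intro i hi hid
    simp only [Set.mem_insert_iff, not_or] at hid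
    simp only [State.setReg_arr, State.setReg_reg, State.setArr_arr, Nat.reduceEqDiff, if_false,
      if_true]
    by_cases hip : i = p
    · subst hip
      rw [Function.update_self, hvm, hvalm]
      exact ⟨by omega, hnew₄.congr rfl rfl⟩
    · rw [Function.update_of_ne hip, b9, verts_merge_of_ne (by rwa [ep]) hid.1,
        val_merge_of_ne (by rwa [ep]) hid.1]
      obtain ⟨h1, h2⟩ := hD.tab i hi hid.2
      rw [e5] at h1
      refine ⟨by omega, (hold₄ _ _ _ (by omega) (hold₃ _ _ _ h1 (h2.congr ?_ ?_))).congr rfl rfl⟩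
      · rw [← es₂]; exact a8
      · rw [← es₂]; exact w1
  · intro i hi hid
    simp only [Set.mem_insert_iff, not_or] at hid
    simp only [State.setReg_arr, State.setArr_arr, if_true, Nat.reduceEqDiff, if_false]
    by_cases hip : i = p
    · subst hip
      rw [Function.update_self, hvm, hu1]
    · rw [Function.update_of_ne hip, b11, verts_merge_of_ne (by rwa [ep]) hid.1, hD.cnt i hi hid.2]
  · have h1 := Nat.mul_le_mul_left (W * 200) hpot
    have h2 : I.n ≤ W * I.n := Nat.le_mul_of_pos_left _ hW1
    have h3 : W * (I.n * 120 + (kp + 1) * (kj + d + 1) * 200) =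
      W * I.n * 120 + W * 200 * ((kp + 1) * (kj + d + 1)) := by ring
    have h4 : W * (I.n * 320) = W * I.n * 320 := by ring
    have h5 : W * (I.n * 600) = W * I.n * 600 := by ring
    rw [mul_add] at h1
    omega

/-- The nodes that have been merged before the node `l` is examined for depth `N - k`. -/
def level (I : Inst) (k l : ℕ) : Set ℕ :=
  {x | x < I.N ∧ (I.N < I.dep x + k ∨ I.dep x + k = I.N ∧ x < l)}

/-- The tables are right, and the clock `t` exceeds `t₀` by no more than the time for the nodes
already merged and the potential. -/
def Paid (I : Inst) (W : ℕ) (nd : ℕ → ℕ) (t₀ : ℕ) (done : Set ℕ) (s : State) (t : ℕ) : Prop :=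
  ∃ comp den, I.DP W nd s done comp den ∧
    t + W * (I.n * 600) * #(I.alive comp) ≤ t₀ + W * 200 * I.pot done comp

/-- Nodes are merged in the order of decreasing depth, so that the children of a node come before
the node. -/
lemma dynamic_spec (hB : I.Fit B) (hI : I.Ctx W s) (hnd : I.IsNode nd)
    (h10 : ∀ i, i < I.N → s.arr 10 i = I.dep i) (hH : I.Heap W I.N s den)
    (h9 : ∀ i, i < I.N → s.arr 9 i = i) (h11 : ∀ i, s.arr 11 i = 0)
    (htab : ∀ i, i < I.N → I.Tab W s den i (Fam (I.bag i) (I.bag i)) (I.val nd id i)) :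
    WP B dynamic s t fun s' t' => (∃ comp den done, I.DP W nd s' done comp den ∧
      ∀ x, x < I.N → x ≠ I.root → x ∈ done) ∧
      t' ≤ t + 10 + I.N * (I.N * 40 + 40) + W * (I.n * 600) * I.N +
        W * 200 * (I.n + I.N) ^ 2 := by
  have hn := hB.n_le
  have hN := hB.N_le
  have hv : ∀ i, i < I.N → I.verts id i = I.bag i := fun i hi => by
    ext v
    rw [mem_verts]
    exact ⟨fun ⟨x, _, hx, h⟩ => hx ▸ h, fun h => ⟨i, hi, rfl, h⟩⟩
  have hal : I.alive id = range I.N := filter_true_of_mem fun _ _ => rfl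
  have hl0 : I.level 0 0 = ∅ := by
    ext x
    simp only [level, Set.mem_ofPred_eq, Set.mem_empty_iff_false, iff_false]
    rintro ⟨hx, h⟩
    have := I.dep_lt x hx
    omega
  simp only [dynamic, wp_seq, wp_setReg, Expr.Fits, Expr.eval, Expr.cost, hI.N]
  refine ⟨by omega, WP.forTo I.N (fun k s' t' => I.Paid W nd (t + 5 + W * (I.n * 600) * I.N +
    k * (I.N * 40 + 30)) (I.level k 0) s' t') (by simpa using hI.N) (by omega) (by decide) rfl rfl
    ?_ ?_ ?_⟩
  · refine ⟨id, den, ?_, ?_⟩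
    · rw [hl0]
      refine ⟨forest_empty, Heap.congr (s := s) (by simpa using hH) rfl rfl rfl, by simp, ?_,
        fun i hi _ => ?_, fun i hi _ => ?_⟩
      · rw [hal]
        simp
        omega
      · simp only [State.setReg_reg, State.setReg_arr, h9 i hi, hv i hi]
        exact ⟨hi, (htab i hi).congr rfl rfl⟩
      · simp [h11, hv i hi]
    · rw [hal, card_range]
      omega
  · intro k s₁ t₁ hk e15 ha₁ hP
    have hI₁ : I.Ctx W s₁ := Ctx.agree (hI.setReg (by omega)) ha₁ rfl
    have f10 : s₁.arr 10 = s.arr 10 := ha₁.arr 10 rfl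
    simp only [wp_seq, wp_setReg, Expr.Fits, Expr.eval, Expr.cost, hI₁.N, e15]
    refine ⟨by omega, WP.forTo I.N (fun l s' t' => I.Paid W nd (t + 5 + W * (I.n * 600) * I.N +
      k * (I.N * 40 + 30) + 15 + l * 30) (I.level k l) s' t') (by simpa using hI₁.N) (by omega)
      (by decide) rfl rfl ?_ ?_ ?_⟩
    · obtain ⟨comp, den', h1, h2⟩ := hP
      exact ⟨comp, den', h1.congr rfl rfl rfl rfl rfl rfl rfl, by omega⟩
    · intro l s₂ t₂ hl e10 ha₂ hP
      have hI₂ : I.Ctx W s₂ := Ctx.agree (hI₁.setReg (by omega)) ha₂ rfl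
      have e34 : s₂.reg 34 = I.N - k := by rw [ha₂.reg 34 rfl]; simp
      have g10 : s₂.arr 10 = s.arr 10 := by rw [ha₂.arr 10 rfl]; simpa using f10
      obtain ⟨comp, den', h1, h2⟩ := hP
      have hdl := I.dep_lt l hl
      simp only [wp_ite, Test.Fits, Test.Holds, Expr.Fits, Expr.eval, Test.cost, Expr.cost, e10,
        e34, g10, h10 l hl, wp_skip]
      refine ⟨by omega, fun h => ?_, fun h => ?_⟩
      · have hlev : I.level k (l + 1) = insert l (I.level k l) := by
          ext x
          simp only [level, Set.mem_ofPred_eq, Set.mem_insert_iff]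
          constructor
          · rintro ⟨hx, h⟩
            by_cases hxl : x = l
            · exact .inl hxl
            · exact .inr ⟨hx, by omega⟩
          · rintro (rfl | ⟨hx, h⟩)
            · exact ⟨hl, by omega⟩
            · exact ⟨hx, by omega⟩
        have hr : l ≠ I.root := by
          rintro rfl
          rw [I.dep_root] at h
          omega
        have hd : l ∉ I.level k l := by
          rintro ⟨-, h⟩
          omega
        have hc : ∀ x, x < I.N → x ≠ I.root → I.par x = l → x ∈ I.level k l := by
          intro x hx hxr hxl
          have := I.dep_par x hx hxr
          rw [hxl] at this
          exact ⟨hx, by omega⟩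
        refine (process_spec hB hI₂ hnd h1 hl hr hd hc e10).mono ?_
        rintro s₃ t₃ - ⟨⟨den'', h3⟩, h4⟩
        have h5 := alive_merge h1.forest hl hr hd
        rw [hlev]
        refine ⟨_, den'', h3.congr rfl rfl rfl rfl rfl rfl rfl, ?_⟩
        rw [← h5] at h2
        rw [mul_add] at h2
        omega
      · have hlev : I.level k (l + 1) = I.level k l := by
          ext x
          simp only [level, Set.mem_ofPred_eq]
          refine and_congr_right fun hx => ?_
          by_cases hxl : x = l
          · subst hxl; omega
          · omega
        rw [hlev]
        exact ⟨comp, den', h1.congr rfl rfl rfl rfl rfl rfl rfl, by omega⟩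
    · rintro s₂ t₂ - hP
      have hlev : I.level (k + 1) 0 = I.level k I.N := by
        ext x
        simp only [level, Set.mem_ofPred_eq]
        refine and_congr_right fun hx => ?_
        omega
      obtain ⟨comp, den', h1, h2⟩ := hP
      rw [hlev]
      refine ⟨comp, den', h1.congr rfl rfl rfl rfl rfl rfl rfl, ?_⟩
      rw [Nat.succ_mul]
      omega
  · rintro s₁ t₁ - ⟨comp, den', h1, h2⟩
    have hall : ∀ x, x < I.N → x ≠ I.root → x ∈ I.level I.N 0 := fun x hx hxr => by
      have := I.dep_par x hx hxr
      exact ⟨hx, by omega⟩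
    refine ⟨⟨comp, den', _, h1, hall⟩, ?_⟩
    have h3 := Nat.mul_le_mul_left (W * 200) (h1.forest.pot_le hall)
    have h4 : I.N * (I.N * 30 + 30) ≤ I.N * (I.N * 40 + 40) := by gcongr <;> omega
    have h5 : I.N * (I.N * 40 + 30) ≤ I.N * (I.N * 40 + 40) := by gcongr; omega
    omega

end Inst

end MaxBisection

/-! ### The initial tables and the optimal entry of the last table -/

namespace MaxBisection

open WordRAM Finset

/-- Offers the entry `13` of the row `12` of the table `25` to the cell `30`, if the represented
set is a bisection. -/
def chooseStep : Prog :=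
  .setReg 31 (cellE 25 12 13) ;; .setReg 32 (.reg 31) ;;
    .ite (.eq (.arr 8 (.reg 31)) (.const 1))
      (.setReg 33 (.mul (.const 2) (.add (.reg 13) (.reg 23))) ;;
        .ite (.le (.reg 33) (.add (.reg 0) (.const 1)))
          (.ite (.le (.reg 0) (.add (.reg 33) (.const 1)))
            (.setWReg 1 (.arr 1 (.reg 31)) ;; offer) .skip) .skip) .skip

/-- Stores the best bisection that the table of the root shows in the cell `30`, the first one of
the first unused table. -/
def choose : Prog :=
  .setReg 17 (.reg 2) ;; .setReg 18 (.reg 2) ;; .setReg 19 (.reg 2) ;;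
  .setReg 25 (.arr 9 (.reg 2)) ;; .setReg 24 (.add (.arr 11 (.reg 2)) (.const 1)) ;;
  .setReg 21 (.arr 6 (.reg 2)) ;; .setReg 35 (.const 0) ;; .setReg 30 (cellE 5 35 35) ;;
    .forTo 12 21 (proj ;; .forTo 13 24 chooseStep)

namespace Inst

variable {I : Inst} {B W : ℕ} {s s' s₀ : State} {t : ℕ} {den : ℕ → Finset ℕ} {nd : ℕ → ℕ}

/-- The initial tables show the subsets of the bags, each as the only set of its class. -/
lemma exists_heap (hI : I.Ctx W s)
    (h8 : Shows 8 {c | ∃ i S, i < I.N ∧ S < 2 ^ #(I.bag i) ∧ c = I.cell W i S 0} s)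
    (hw : ∀ i S, i < I.N → S < 2 ^ #(I.bag i) →
      s.warr 1 (I.cell W i S 0) = I.val nd id i (bits (I.bag i) S)) :
    ∃ den, I.Heap W I.N s den ∧
      ∀ i, i < I.N → I.Tab W s den i (Fam (I.bag i) (I.bag i)) (I.val nd id i) := by
  obtain ⟨den, hden⟩ : ∃ den : ℕ → Finset ℕ, ∀ i S, i < I.N → S < 2 ^ #(I.bag i) →
      den (I.cell W i S 0) = bits (I.bag i) S := by
    refine ⟨fun c => bits (I.bag (c / (I.n + 1) / W)) (c / (I.n + 1) % W), fun i S hi hS => ?_⟩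
    have hS' := hS.trans_le (hI.sz_le i hi)
    have h1 : I.cell W i S 0 / (I.n + 1) = i * W + S := by
      rw [cell, add_zero, Nat.mul_div_cancel _ (by omega)]
    have h2 : (i * W + S) / W = i := by
      rw [mul_comm, Nat.mul_add_div (by omega), Nat.div_eq_of_lt hS', add_zero]
    have h3 : (i * W + S) % W = S := by
      rw [mul_comm, Nat.mul_add_mod, Nat.mod_eq_of_lt hS']
    simp only [h1, h2, h3]
  have h8' : ∀ c, s.arr 8 c = 1 ↔ ∃ i S, i < I.N ∧ S < 2 ^ #(I.bag i) ∧ c = I.cell W i S 0 :=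
    fun c => (h8 c).2
  have hlt : ∀ c, s.arr 8 c = 1 → c < I.cell W I.N 0 0 := by
    intro c hc
    obtain ⟨i, S, hi, hS, rfl⟩ := (h8' c).1 hc
    exact cell_lt (hS.trans_le (hI.sz_le i hi)) (by omega) hi
  refine ⟨den, ⟨fun c => (h8 c).1, fun c hc => ?_, fun c _ hc => ?_, fun c hc h => ?_⟩,
    fun i hi => ⟨fun S k hS hk h => ?_, fun S k U hS hk hU => ?_⟩⟩
  · have := (h8 c).1
    have := hlt c
    omega
  · obtain ⟨i, S, hi, hS, rfl⟩ := (h8' c).1 hc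
    exact ⟨i, S, hi, hS, rfl, hden i S hi hS⟩
  · exact absurd (hlt c h) (not_lt.2 hc)
  · obtain ⟨i', S', hi', hS', h'⟩ := (h8' _).1 h
    obtain ⟨rfl, rfl, rfl⟩ :=
      (cell_inj hS (hS'.trans_le (hI.sz_le _ hi')) hk (Nat.zero_le _)).1 h'
    rw [hden _ _ hi hS']
    exact ⟨⟨bits_subset _ _, mask_bits hS', by rw [sdiff_eq_empty_iff_subset.2 (bits_subset _ _),
      card_empty]⟩, hw _ _ hi hS'⟩
  · obtain ⟨h1, rfl, rfl⟩ := hU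
    rw [sdiff_eq_empty_iff_subset.2 h1, card_empty]
    refine ⟨(h8' _).2 ⟨i, _, hi, mask_lt _ _, rfl⟩, ?_⟩
    rw [hw _ _ hi (mask_lt _ _), bits_mask, inter_eq_left.2 h1]

/-- The offers made by the row `S` of the table `T` of the root. -/
def chooseOffers (I : Inst) (W : ℕ) (s : State) (T d a S : ℕ) : Set (ℕ × ℚ × ℕ × ℕ) :=
  ⋃ k < a, {o | s.arr 8 (I.cell W T S k) = 1 ∧ 2 * (k + #(bits (I.bag I.root) S)) ≤ I.n + 1 ∧
    I.n ≤ 2 * (k + #(bits (I.bag I.root) S)) + 1 ∧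
    o = (d, s.warr 1 (I.cell W T S k), I.cell W T S k, I.cell W T S k)}

lemma chooseRow_spec (hB : I.Fit B) (hI : I.Ctx W s) {S T g a : ℕ} {O}
    (hS : S < 2 ^ #(I.bag I.root)) (e17 : s.reg 17 = I.root) (e18 : s.reg 18 = I.root)
    (e19 : s.reg 19 = I.root)
    (e12 : s.reg 12 = S) (e25 : s.reg 25 = T) (e24 : s.reg 24 = a + 1)
    (e30 : s.reg 30 = I.cell W g 0 0)
    (hg : g < 3 * I.N + 4) (hT : T < g) (ha : a + #(I.bag I.root) ≤ I.n)
    (hO : Offers (I.cell W g 0 0) s₀ s O)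
    (h0 : ∀ c, I.cell W g 0 0 ≤ c → s₀.arr 8 c = 0) (h1 : ∀ c, s₀.arr 8 c ≤ 1) :
    WP B (proj ;; .forTo 13 24 chooseStep) s t fun s' t' =>
      Offers (I.cell W g 0 0) s₀ s' (O ∪ I.chooseOffers W s₀ T (I.cell W g 0 0) (a + 1) S) ∧
        t' ≤ t + I.n * 300 := by
  have hn := hB.n_le
  have hN := hB.N_le
  have hW := hI.W_le
  have hWr := hI.sz_le I.root I.root_lt
  have hone := I.one_le
  rw [wp_seq]
  refine (proj_spec (a := I.root) (b := I.root) (c := I.root) (S := S) hB hI I.root_lt I.root_lt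
    I.root_lt e17 e18 e19 e12 (by omega) inter_subset_left).mono ?_
  rintro s₁ t₁ ha₁ ⟨⟨-, -, h23⟩, ht₁⟩
  replace hI : I.Ctx W s₁ := Ctx.agree hI ha₁ rfl
  replace e12 : s₁.reg 12 = S := by rw [ha₁.reg 12 rfl, e12]
  replace e25 : s₁.reg 25 = T := by rw [ha₁.reg 25 rfl, e25]
  replace e30 : s₁.reg 30 = I.cell W g 0 0 := by rw [ha₁.reg 30 rfl, e30]
  replace e24 : s₁.reg 24 = a + 1 := by rw [ha₁.reg 24 rfl, e24]
  replace hO : Offers (I.cell W g 0 0) s₀ s₁ O := by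
    refine ⟨hO.ge, ?_, ?_⟩ <;>
      rw [ha₁.arr 8 rfl, ha₁.arr 12 rfl, ha₁.arr 13 rfl, ha₁.warr 1 rfl]
    exacts [hO.old, hO.new]
  have hcard : #(bits (I.bag I.root) S) ≤ #(I.bag I.root) := card_le_card (bits_subset _ _)
  refine WP.for_union (a + 1) (fun X s => Offers (I.cell W g 0 0) s₀ s X) _ 100 O e24 (by omega)
    (by decide) rfl rfl (fun _ _ _ h => h.setReg) hO ?_ fun s₂ t₂ _ h ht => ⟨h, by nlinarith⟩
  intro k s₂ t₂ X hk e13 ha₂ hX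
  replace hI := hI.agree ha₂ rfl
  replace e12 : s₂.reg 12 = S := by rw [ha₂.reg 12 rfl, e12]
  replace e25 : s₂.reg 25 = T := by rw [ha₂.reg 25 rfl, e25]
  replace e30 : s₂.reg 30 = I.cell W g 0 0 := by rw [ha₂.reg 30 rfl, e30]
  replace h23 : s₂.reg 23 = #(bits (I.bag I.root) S) := by rw [ha₂.reg 23 rfl, h23]
  have hX' := hX.below (cell_lt (I := I) (W := W) (S := S) (k := k) (by omega) (by omega) hT)
  have hc1 := (hB.cell_le hW (T := T) (S := S) (k := k) (by omega) (by omega) (by omega)).2.2.2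
  have hc2 := (hB.cell_le hW (T := g) (S := 0) (k := 0) (by omega) (by omega)
    (by omega)).2.2.2
  have hge : 4 * 1 ≤ B := (Nat.mul_le_mul_left 4 Nat.one_le_two_pow).trans hB.two_pow_le
  simp only [chooseStep, wp_seq, wp_setReg, eval_cellE hI.n hI.reg4, e12, e25, e13]
  refine ⟨fits_cellE hB hW hI.n hI.reg4 (by omega) (by omega) (by omega), by simpa [Expr.Fits], ?_⟩
  simp only [wp_ite, Test.Fits, Test.Holds, Expr.Fits, Expr.eval, State.setReg_reg, if_true,
    State.setReg_arr, wp_seq, wp_setReg, wp_setWReg, WExpr.Fits, WExpr.eval, wp_skip,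
    Nat.reduceEqDiff, if_false, e13, h23, hX'.1, hI.n]
  have h8 := h1 (I.cell W T S k)
  have hno : ¬(s₀.arr 8 (I.cell W T S k) = 1 ∧ 2 * (k + #(bits (I.bag I.root) S)) ≤ I.n + 1 ∧
      I.n ≤ 2 * (k + #(bits (I.bag I.root) S)) + 1) → ∀ Y : State, Y.arr = s₂.arr →
      Y.warr = s₂.warr → Offers (I.cell W g 0 0) s₀ Y (X ∪ {o | s₀.arr 8 (I.cell W T S k) = 1 ∧
        2 * (k + #(bits (I.bag I.root) S)) ≤ I.n + 1 ∧
        I.n ≤ 2 * (k + #(bits (I.bag I.root) S)) + 1 ∧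
        o = (I.cell W g 0 0, s₀.warr 1 (I.cell W T S k), I.cell W T S k, I.cell W T S k)}) := by
    intro h Y h2 h3
    have he : X ∪ {o | s₀.arr 8 (I.cell W T S k) = 1 ∧
        2 * (k + #(bits (I.bag I.root) S)) ≤ I.n + 1 ∧
        I.n ≤ 2 * (k + #(bits (I.bag I.root) S)) + 1 ∧
        o = (I.cell W g 0 0, s₀.warr 1 (I.cell W T S k), I.cell W T S k, I.cell W T S k)} = X := by
      ext o
      simp only [Set.mem_union, Set.mem_ofPred_eq]
      tauto
    rw [he]
    refine ⟨hX.ge, ?_, ?_⟩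
    · rw [h2, h3]; exact hX.old
    · rw [h2, h3]; exact hX.new
  refine ⟨by omega, fun hv => ⟨by omega, by omega, fun hv1 => ⟨by omega, fun hv2 => ⟨hc1, ?_⟩,
    fun hv2 => ⟨hno (by tauto) _ rfl rfl, ?_⟩⟩, fun hv1 => ⟨hno (by tauto) _ rfl rfl, ?_⟩⟩,
    fun hv => ⟨hno (by tauto) _ rfl rfl, ?_⟩⟩
  · refine (offer_spec (O := X) (l := I.cell W T S k) (r := I.cell W T S k) (by omega : 1 ≤ B) ?_
      (I.cell_ge g _ _) (h0 _ (I.cell_ge g _ _)) h1 (by simpa) (by simp) (by simp) hc2 hc1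
      hc1).mono ?_
    · exact ⟨hX.ge, hX.old, hX.new⟩
    · rintro s₃ t₃ - ⟨h, ht⟩
      refine ⟨?_, ?_⟩
      · convert h using 2
        ext o
        simp [hX'.2.1, hv, hv1, hv2]
      · simp only [Test.cost, Expr.cost, cellE, WExpr.cost] at ht
        omega
  all_goals
    simp only [Test.cost, Expr.cost, cellE]
    omega

lemma choose_spec (hB : I.Fit B) (hI : I.Ctx W s) (hnd : I.IsNode nd) {comp done}
    (hD : I.DP W nd s done comp den) (hdone : ∀ x, x < I.N → x ≠ I.root → x ∈ done) :
    WP B choose s t fun s' t' => (∃ den' g, I.N ≤ g ∧ g ≤ 3 * I.N ∧ I.Heap W (g + 1) s' den' ∧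
        s'.reg 30 = I.cell W g 0 0 ∧ s'.reg 35 = 0 ∧ s'.arr 8 (I.cell W g 0 0) = 1 ∧
        I.Balanced (den' (I.cell W g 0 0)) ∧
        s'.warr 1 (I.cell W g 0 0) = I.cut (den' (I.cell W g 0 0)) ∧
        ∀ U, I.Balanced U → I.cut U ≤ s'.warr 1 (I.cell W g 0 0)) ∧
      t' ≤ t + W * (I.n * 350) := by
  have hn := hB.n_le
  have hN := hB.N_le
  have h2 := hB.two_pow_le
  have hW := hI.W_le
  have hone := I.one_le
  have hr := I.root_lt
  have hrd := hD.forest.root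
  have hWr := hI.sz_le _ hr
  have hW1 : 1 ≤ W := Nat.one_le_two_pow.trans hWr
  have hverts := hD.forest.verts_root hdone
  obtain ⟨hT, hTab⟩ := hD.tab _ hr hrd
  have hcnt := hD.cnt _ hr hrd
  have hcard := card_sdiff_add_card_bag_le hD.forest hr hrd
  rw [hD.forest.val_root hnd hdone, hverts] at hTab
  rw [hverts] at hcnt hcard
  have hH := hD.heap
  have hge := hD.ge
  have hle := hD.le
  generalize ekr : #(range I.n \ I.bag I.root) = a at *
  generalize eT : s.arr 9 I.root = T at *
  generalize eg : s.reg 5 = g at *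
  have hc := (hB.cell_le hW (T := g) (S := 0) (k := 0) (by omega) (by omega) (by omega)).2.2.2
  simp only [choose, wp_seq, wp_setReg, Expr.Fits, Expr.eval, Expr.cost, State.setReg_reg,
    State.setReg_arr, Nat.reduceEqDiff, if_false, hI.root, eT, hcnt, hI.sz _ hr]
  refine ⟨by omega, by omega, by omega, by omega, by omega, by omega, by omega,
    fits_cellE (W := W) hB hW (by simpa using hI.n) (by simpa using hI.reg4) ?_ ?_ ?_, ?_⟩
  · simp [eg]; omega
  · simp; omega
  · simp
  rw [eval_cellE (W := W) (by simpa using hI.n) (by simpa using hI.reg4)]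
  simp only [State.setReg_reg, Nat.reduceEqDiff, if_false, if_true, eg]
  refine WP.for_union (2 ^ #(I.bag I.root)) (fun X s' => Offers (I.cell W g 0 0) s s' X)
    (fun S => I.chooseOffers W s T (I.cell W g 0 0) (a + 1) S) (I.n * 300) ∅ (by simp) (by omega)
    (by decide) rfl rfl (fun _ _ _ h => h.setReg) ?_ ?_ ?_
  · have h := Offers.refl (I.cell W g 0 0) s
    exact ⟨h.ge, h.old, h.new⟩
  · intro S s₁ t₁ X hS e12 ha₁ hX
    refine chooseRow_spec hB (Ctx.agree ?_ ha₁ rfl) hS ?_ ?_ ?_ e12 ?_ ?_ ?_ (by omega) hT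
      (by omega) hX hH.fresh hH.le_one
    · iterate 8 refine Ctx.setReg ?_ (by omega)
      exact hI
    · rw [ha₁.reg 17 rfl]; simp
    · rw [ha₁.reg 18 rfl]; simp
    · rw [ha₁.reg 19 rfl]; simp
    · rw [ha₁.reg 25 rfl]; simp
    · rw [ha₁.reg 24 rfl]; simp
    · rw [ha₁.reg 30 rfl]; simp
  · intro s₁ t₁ ha₁ hO ht
    rw [Set.empty_union] at hO
    have hmem : ∀ o ∈ ⋃ S < 2 ^ #(I.bag I.root),
        I.chooseOffers W s T (I.cell W g 0 0) (a + 1) S, ∃ S k, S < W ∧ k ≤ a ∧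
        s.arr 8 (I.cell W T S k) = 1 ∧ 2 * (k + #(bits (I.bag I.root) S)) ≤ I.n + 1 ∧
        I.n ≤ 2 * (k + #(bits (I.bag I.root) S)) + 1 ∧
        o = (I.cell W g 0 0, s.warr 1 (I.cell W T S k), I.cell W T S k, I.cell W T S k) := by
      intro o ho
      simp only [chooseOffers, Set.mem_iUnion, Set.mem_ofPred_eq] at ho
      obtain ⟨S, hS, k, hk, h1, h2⟩ := ho
      exact ⟨S, k, by omega, by omega, h1, h2⟩
    -- the new table has the single class of all bisections
    obtain ⟨den', h1, -, h3⟩ := hH.extend hge hO (fun o ho => by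
        obtain ⟨S, k, hS, hk, h8, -, -, rfl⟩ := hmem o ho
        exact cell_lt (by omega) (by omega) (by omega)) fun o ho => by
      obtain ⟨S, k, hS, hk, h8, -, -, rfl⟩ := hmem o ho
      exact ⟨h8, h8⟩
    have h4 := h3 (fun S k U => S = 0 ∧ k = 0 ∧ I.Balanced U) I.cut ?_ ?_
    -- there is a bisection, so that its only cell is not empty
    · obtain ⟨h5, h6⟩ := h4.complete 0 0 (range (I.n / 2)) (by omega) (by omega)
        ⟨rfl, rfl, range_subset_range.2 (by omega), by rw [card_range]; omega,
          by rw [card_range]; omega⟩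
      obtain ⟨⟨-, -, h7⟩, h8⟩ := h4.sound 0 0 (by omega) (by omega) h5
      refine ⟨⟨den', g, hge, by omega, h1, ?_, ?_, h5, h7, h8, fun U hU =>
        (h4.complete 0 0 U (by omega) (by omega) ⟨rfl, rfl, hU⟩).2⟩, ?_⟩
      · rw [ha₁.reg 30 rfl]; simp
      · rw [ha₁.reg 35 rfl]; simp
      · have h9 : 1 ≤ W * I.n := Nat.mul_pos hW1 hone
        have h10 := Nat.mul_le_mul_right (I.n * 300 + 7) hWr
        simp only [cellE, Expr.cost] at ht
        nlinarith
    · intro o ho S' k' hS' hk' ho1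
      obtain ⟨S, k, hS, hk, h8, hb1, hb2, rfl⟩ := hmem o ho
      obtain ⟨-, rfl, rfl⟩ := (cell_inj (by omega) hS' (by omega) hk').1 ho1
      obtain ⟨⟨h5, h6, h7⟩, h9⟩ := hTab.sound S k hS (by omega) h8
      simp only [union_self, true_and]
      generalize den (I.cell W T S k) = U at h5 h6 h7 h9 ⊢
      refine ⟨⟨h5, ?_⟩, h9⟩
      rw [← h6, bits_mask, ← h7] at hb1 hb2
      have hsum := card_inter_add_card_sdiff U (I.bag I.root)
      exact ⟨by omega, by omega⟩
    · rintro S' k' U - - ⟨rfl, rfl, hU, hb1, hb2⟩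
      have hS := mask_lt (I.bag I.root) U
      have hk : #(U \ I.bag I.root) ≤ a := ekr ▸ card_le_card (sdiff_subset_sdiff hU subset_rfl)
      obtain ⟨h5, h6⟩ := hTab.complete _ _ U (by omega) (by omega) ⟨hU, rfl, rfl⟩
      have hsum := card_inter_add_card_sdiff U (I.bag I.root)
      rw [← bits_mask] at hsum
      exact ⟨_, Set.mem_iUnion₂.2 ⟨_, hS, Set.mem_iUnion₂.2 ⟨_, Nat.lt_succ_of_le hk, h5, by omega,
        by omega, rfl⟩⟩, rfl, h6⟩

end Inst

end MaxBisection

/-! ### Reading off the solution -/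

namespace MaxBisection

open WordRAM Finset

/-- Marks the cells to which the cell `30 - 37` points, if this cell is marked. -/
def followStep : Prog :=
  .setReg 38 (.sub (.reg 30) (.reg 37)) ;; .ite (.eq (.arr 14 (.reg 38)) (.const 1))
    (.setArr 14 (.arr 12 (.reg 38)) (.const 1) ;; .setArr 14 (.arr 13 (.reg 38)) (.const 1)) .skip

/-- Marks in the array `14` all cells to which pointers lead from the cell `30`, in decreasing
order down to the initial tables. -/
def follow : Prog :=
  .setArr 14 (.reg 30) (.const 1) ;;
    .setReg 36 (.add (.sub (.reg 30) (cellE 1 35 35)) (.const 1)) ;; .forTo 37 36 followStep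

/-- Adds the vertex `11` to the output, if it is in the subset of the bag of `10` with
mask `12`. -/
def collectStep : Prog :=
  .ite (.eq (bagE 10 11) (.const 1)) (.ite (.eq (bitE 10 11 12) (.const 1))
    (.setArr 4 (.reg 11) (.const 1)) .skip) .skip

/-- Outputs the union of the sets for the marked cells of the initial tables, and the value in
the cell `30`. -/
def collect : Prog :=
  .setWReg 0 (.arr 1 (.reg 30)) ;; .forTo 10 1 (.setReg 21 (.arr 6 (.reg 10)) ;;
    .forTo 12 21 (.ite (.eq (.arr 14 (cellE 10 12 35)) (.const 1))
      (.forTo 11 0 collectStep) .skip))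

namespace Inst

variable {I : Inst} {B W : ℕ} {s s' s₀ : State} {t : ℕ} {den : ℕ → Finset ℕ} {T d : ℕ}

lemma Ctx.setWReg {r : ℕ} {x : ℚ} (h : I.Ctx W s) : I.Ctx W (s.setWReg r x) :=
  ⟨⟨h.n, h.N, h.root, h.m, h.par, h.bag, h.tail, h.head, h.wt⟩, h.reg4, h.pw, h.sz, h.sz_le,
    h.W_le⟩

/-- The marked cells are nonempty, and those with an index below `b` make up the solution `U`. -/
structure Marked (s : State) (den : ℕ → Finset ℕ) (b : ℕ) (U : Finset ℕ) : Prop where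
  le_one : ∀ c, s.arr 14 c ≤ 1
  valid : ∀ c, s.arr 14 c = 1 → s.arr 8 c = 1
  mem_iff : ∀ v, v ∈ U ↔ ∃ c, c < b ∧ s.arr 14 c = 1 ∧ v ∈ den c

/-- After `k` passes the solution `den d` is the union of the sets of the marked cells below
`d + 1 - k`: a marked cell that leaves this range is replaced by the two cells of which it is the
union. -/
lemma follow_spec (hB : I.Fit B) (hI : I.Ctx W s) (hH : I.Heap W T s den)
    (e30 : s.reg 30 = d) (e35 : s.reg 35 = 0) (hd : I.cell W I.N 0 0 ≤ d) (hdB : d + 1 ≤ B)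
    (hv : s.arr 8 d = 1) (h14 : ∀ c, s.arr 14 c = 0) :
    WP B follow s t fun s' t' => Marked s' den (I.cell W I.N 0 0) (den d) ∧
      t' ≤ t + 40 + (d + 1 - I.cell W I.N 0 0) * 40 := by
  have hN := hB.N_le
  have hn := hB.n_le
  have hW1 : 1 ≤ W := Nat.one_le_two_pow.trans (hI.sz_le _ I.root_lt)
  generalize eb : I.cell W I.N 0 0 = b at *
  simp only [follow, wp_seq, wp_setReg, wp_setArr, Expr.Fits, Expr.eval, Expr.cost, e30,
    State.setArr_reg]
  refine ⟨by omega, by omega, ⟨⟨by omega, fits_cellE (W := W) hB hI.W_le (by simpa using hI.n)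
    (by simpa using hI.reg4) (by simp [hI.N]; omega) (by simp [e35]; omega) (by simp [e35])⟩,
    by omega, ?_⟩, ?_⟩
  · omega
  rw [eval_cellE (W := W) (by simpa using hI.n) (by simpa using hI.reg4)]
  simp only [State.setArr_reg, hI.N, e35, eb]
  refine WP.for_const (d - b + 1) (fun k s' => Marked s' den (d + 1 - k) (den d)) 30
    (by simp) (by omega) (by decide) rfl rfl (fun _ _ _ h => ⟨h.1, h.2, h.3⟩) ?_ ?_ ?_
  · refine ⟨fun c => ?_, fun c => ?_, fun v => ?_⟩ <;>
      simp only [State.setReg_arr, State.setArr_arr, if_true, Function.update_apply, h14]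
    · split_ifs <;> omega
    · by_cases hc : c = d
      · simp [hc, hv]
      · simp [hc]
    · constructor
      · intro h
        exact ⟨d, by omega, by simp, h⟩
      · rintro ⟨c, -, h1, h2⟩
        by_cases hc : c = d
        · exact hc ▸ h2
        · simp [hc] at h1
  · intro k s₁ t₁ hk e37 ha₁ hM
    have f30 : s₁.reg 30 = d := by rw [ha₁.reg 30 rfl]; simpa using e30
    have f8 : s₁.arr 8 = s.arr 8 := by rw [ha₁.arr 8 rfl]; simp
    have f12 : s₁.arr 12 = s.arr 12 := by rw [ha₁.arr 12 rfl]; simp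
    have f13 : s₁.arr 13 = s.arr 13 := by rw [ha₁.arr 13 rfl]; simp
    have h1 := hM.le_one (d - k)
    have hval := hM.valid
    rw [f8] at hval
    simp only [followStep, wp_seq, wp_setReg, wp_ite, wp_setArr, wp_skip, Test.Fits, Test.Holds,
      Expr.Fits, Expr.eval, Test.cost, Expr.cost, State.setReg_reg, State.setReg_arr,
      State.setArr_arr, State.setArr_reg, if_true, Nat.reduceEqDiff, if_false, e37, f30, f12, f13]
    refine ⟨⟨by omega, by omega⟩, by omega, fun h => ?_, fun h => ⟨⟨hM.le_one, hM.valid,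
      fun v => ?_⟩, by omega⟩⟩
    · obtain ⟨hl, hr, hl8, hr8, hden⟩ := hH.node (d - k) (by omega) (hval _ h)
      refine ⟨by omega, by omega, by omega, by omega, ⟨fun c => ?_, fun c hc => ?_,
        fun v => ?_⟩, by omega⟩
      · simp only [State.setArr_arr, if_true, Function.update_apply]
        have := hM.le_one c
        split_ifs <;> simp [this]
      · simp only [State.setArr_arr, if_true, Function.update_apply, State.setReg_arr,
          Nat.reduceEqDiff, if_false, f8] at hc ⊢
        split_ifs at hc with h2 h3
        · rw [h2]; exact hr8
        · rw [h3]; exact hl8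
        · exact hval c hc
      · simp only [State.setArr_arr, if_true, Function.update_apply, State.setReg_arr]
        rw [hM.mem_iff]
        constructor
        · rintro ⟨c, h2, h3, h4⟩
          by_cases hc : c = d - k
          · rw [hc, hden, mem_union] at h4
            rcases h4 with h4 | h4
            · exact ⟨_, by omega, by simp, h4⟩
            · exact ⟨_, by omega, by simp, h4⟩
          · exact ⟨c, by omega, by simp [h3], h4⟩
        · rintro ⟨c, h2, h3, h4⟩
          split_ifs at h3 with h5 h6
          · exact ⟨d - k, by omega, h, by rw [hden, ← h5]; exact mem_union_right _ h4⟩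
          · exact ⟨d - k, by omega, h, by rw [hden, ← h6]; exact mem_union_left _ h4⟩
          · exact ⟨c, by omega, h3, h4⟩
    · rw [hM.mem_iff]
      refine exists_congr fun c => ⟨fun ⟨h2, h3, h4⟩ => ⟨?_, h3, h4⟩,
        fun ⟨h2, h3, h4⟩ => ⟨by omega, h3, h4⟩⟩
      have : c ≠ d - k := fun hc => h (hc ▸ h3)
      omega
  · intro s₁ t₁ ha₁ hM ht
    rw [show d + 1 - (d - b + 1) = b by omega] at hM
    refine ⟨hM, ?_⟩
    simp only [cellE, Expr.cost] at ht
    omega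

/-- The marked cells of the initial tables stand for subsets of bags, whose union is `U`. -/
lemma collect_spec (hB : I.Fit B) (hI : I.Ctx W s) (hH : I.Heap W T s den)
    (e30 : s.reg 30 = d) (e35 : s.reg 35 = 0) (hdB : d ≤ B) {U : Finset ℕ}
    (hM : Marked s den (I.cell W I.N 0 0) U) (h4 : ∀ v, s.arr 4 v = 0) :
    WP B collect s t fun s' t' =>
      ((∀ v, s'.arr 4 v = if v ∈ U then 1 else 0) ∧ s'.wreg 0 = s.warr 1 d) ∧
      t' ≤ t + 10 + I.N * (W * (I.n * 50 + 50)) := by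
  have hN := hB.N_le
  have hn := hB.n_le
  have hone := I.one_le
  have hW := hI.W_le
  have h2 := hB.two_pow_le
  have hW1 : 1 ≤ W := Nat.one_le_two_pow.trans (hI.sz_le _ I.root_lt)
  have hm1 := hM.le_one
  simp only [collect, wp_seq, wp_setWReg, WExpr.Fits, WExpr.eval, WExpr.cost, Expr.Fits, Expr.eval,
    Expr.cost, e30]
  refine ⟨hdB, WP.for_union I.N (fun X s => Shows 4 X s) (fun i => ⋃ S < 2 ^ #(I.bag i),
    {v | s.arr 14 (I.cell W i S 0) = 1 ∧ v ∈ bits (I.bag i) S}) (15 + W * (I.n * 37 + 27)) ∅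
    (by simpa using hI.N)
    (by omega) (by decide) rfl rfl (fun _ _ _ h => h) (fun v => by simp [h4]) ?_ ?_⟩
  · intro i s₁ t₁ X hi e10 ha₁ hX
    have hI₁ : I.Ctx W s₁ := hI.setWReg.agree ha₁ rfl
    have f14 : s₁.arr 14 = s.arr 14 := by rw [ha₁.arr 14 rfl]; simp
    have f35 : s₁.reg 35 = 0 := by rw [ha₁.reg 35 rfl]; simpa using e35
    have hWi := hI.sz_le i hi
    simp only [wp_seq, wp_setReg, Expr.Fits, Expr.eval, Expr.cost, e10, hI₁.sz i hi]
    refine ⟨⟨by omega, by omega⟩, WP.for_union (2 ^ #(I.bag i)) (fun X s => Shows 4 X s)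
      (fun S => {v | s.arr 14 (I.cell W i S 0) = 1 ∧ v ∈ bits (I.bag i) S}) (I.n * 37 + 20) X
      (by simp) (by omega) (by decide) rfl rfl (fun _ _ _ h => h) hX ?_ ?_⟩
    · intro S s₂ t₂ X hS e12 ha₂ hX
      have hI₂ : I.Ctx W s₂ := (hI₁.setReg (by omega)).agree ha₂ rfl
      have g14 : s₂.arr 14 = s.arr 14 := by rw [ha₂.arr 14 rfl]; simpa using f14
      have g35 : s₂.reg 35 = 0 := by rw [ha₂.reg 35 rfl]; simpa using f35
      have g10 : s₂.reg 10 = i := by rw [ha₂.reg 10 rfl]; simpa using e10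
      have hm := hm1 (I.cell W i S 0)
      simp only [wp_ite, wp_skip, Test.Fits, Test.Holds, Expr.Fits, Expr.eval, Test.cost,
        Expr.cost, eval_cellE hI₂.n hI₂.reg4, g14, g35, g10, e12]
      refine ⟨⟨⟨fits_cellE hB hW hI₂.n hI₂.reg4 (by omega) (by omega) (by omega), by omega⟩,
        by omega⟩, fun h => ?_, fun h => ⟨?_, ?_⟩⟩
      · refine WP.for_union I.n (fun X s => Shows 4 X s)
          (fun v => {u | u = v ∧ v ∈ bits (I.bag i) S}) 30 X
          hI₂.n (by omega) (by decide) rfl rfl (fun _ _ _ h => h) hX ?_ ?_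
        · intro v s₃ t₃ X hv e11 ha₃ hX
          have hI₃ : I.Ctx W s₃ := hI₂.agree ha₃ rfl
          have k10 : s₃.reg 10 = i := by rw [ha₃.reg 10 rfl, g10]
          have k12 : s₃.reg 12 = S := by rw [ha₃.reg 12 rfl, e12]
          have hno : v ∉ bits (I.bag i) S →
              Shows 4 (X ∪ {u | u = v ∧ v ∈ bits (I.bag i) S}) s₃ := by
            intro h
            simpa [h] using hX
          have b1 := fits_bagE hB hI₃.toInput (i := 10) (v := 11) (by omega) (by omega)
          have v1 := eval_bagE_eq_one hI₃.toInput (i := 10) (v := 11) (by omega) (by omega)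
          simp only [collectStep, wp_ite, wp_setArr, wp_skip, Test.Fits, Test.Holds, b1, v1,
            Expr.Fits, Expr.eval, e11, k10, true_and]
          refine ⟨by omega, fun hvi => ?_, fun hvi => ⟨hno fun h => hvi (bits_subset _ _ h), ?_⟩⟩
          · have b2 := fits_bitE hB hI₃ (i := 10) (v := 11) (S := 12) (by omega)
              (by rwa [e11, k10]) (by omega)
            have v2 := eval_bitE hI₃ (i := 10) (v := 11) (S := 12) (by omega) (by rwa [e11, k10])
            rw [e11, k10, k12] at v2
            simp only [b2, v2, ← mem_bits hvi, true_and]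
            refine ⟨by omega, fun hb => ⟨by omega, by omega, ?_, ?_⟩, fun hb => ⟨hno hb, ?_⟩⟩
            · convert hX.update using 2
              ext u
              simp [hb]
            all_goals
              simp only [Test.cost, bagE, bitE, idxE, Expr.cost]
              omega
          · simp only [Test.cost, bagE, idxE, Expr.cost]
            omega
        · intro s₃ t₃ ha₃ hX ht
          refine ⟨?_, ?_⟩
          · convert hX using 2
            ext v
            simp only [Set.mem_ofPred_eq, Set.mem_iUnion]
            constructor
            · rintro ⟨-, hv⟩
              exact ⟨v, I.bag_lt _ _ (bits_subset _ _ hv), rfl, hv⟩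
            · rintro ⟨v', -, rfl, hv⟩
              exact ⟨h, hv⟩
          · simp only [cellE, Expr.cost] at ht
            omega
      · simpa [h] using hX
      · simp only [cellE, Expr.cost]
        omega
    · intro s₂ t₂ ha₂ hX ht
      refine ⟨hX, ?_⟩
      have h3 : 2 ^ #(I.bag i) * (I.n * 37 + 20 + 7) ≤ W * (I.n * 37 + 27) :=
        Nat.mul_le_mul_right _ hWi
      omega
  · intro s₁ t₁ ha₁ hX ht
    refine ⟨⟨fun v => ?_, ?_⟩, ?_⟩
    · obtain ⟨h5, h6⟩ := hX v
      have h7 : v ∈ (∅ ∪ ⋃ i < I.N, ⋃ S < 2 ^ #(I.bag i),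
          {v | s.arr 14 (I.cell W i S 0) = 1 ∧ v ∈ bits (I.bag i) S}) ↔ v ∈ U := by
        rw [hM.mem_iff]
        simp only [Set.empty_union, Set.mem_iUnion, Set.mem_ofPred_eq]
        constructor
        · rintro ⟨i, hi, S, hS, h8, h9⟩
          have hlt := cell_lt (I := I) (k := 0) (hS.trans_le (hI.sz_le i hi)) (by omega) hi
          refine ⟨_, hlt, h8, ?_⟩
          obtain ⟨i', S', hi', hS', h10, h11⟩ := hH.leaf _ hlt (hM.valid _ h8)
          obtain ⟨rfl, rfl, -⟩ := (cell_inj (hS.trans_le (hI.sz_le _ hi))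
            (hS'.trans_le (hI.sz_le _ hi')) (by omega) (by omega)).1 h10
          rw [h11]
          exact h9
        · rintro ⟨c, hc, h8, h9⟩
          obtain ⟨i, S, hi, hS, rfl, h11⟩ := hH.leaf _ hc (hM.valid _ h8)
          exact ⟨i, hi, S, hS, h8, h11 ▸ h9⟩
      rw [h7] at h6
      split_ifs with hU
      · exact h6.2 hU
      · have : s₁.arr 4 v ≠ 1 := fun h => hU (h6.1 h)
        omega
    · rw [ha₁.wreg 0 rfl]
      simp
    · have h3 : 15 + W * (I.n * 37 + 27) + 7 ≤ W * (I.n * 50 + 50) := by nlinarith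
      have h4 := Nat.mul_le_mul_left I.N h3
      omega

end Inst

end MaxBisection

/-! ### The algorithm -/

namespace MaxBisection

open WordRAM Finset

/-- The algorithm: preprocessing, dynamic programming along the tree, choice of the best bisection
in the table of the root, and the way back along the pointers. -/
def solve : Prog :=
  positions ;; pairs ;; leaves ;; tables ;; arcs ;; depths ;; dynamic ;; choose ;; follow ;; collect

namespace Inst

variable {I : Inst} {B W : ℕ} {s : State}

/-- Words of `O(t + log (n + 1))` bits suffice. -/
lemma fit_pow (I : Inst) : I.Fit ((2 ^ I.t * (I.n + 1)) ^ 10) := by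
  have hn := I.one_le
  have hN := I.N_le
  have hE : 1 ≤ 2 ^ I.t := Nat.one_le_two_pow
  generalize eE : 2 ^ I.t = E at *
  constructor
  · rw [pow_succ 2, eE]
    have h1 : 3 * I.N + 4 ≤ 12 * (I.n + 1) + 4 := by omega
    have h2 : 2 ≤ E * (I.n + 1) := by nlinarith
    have h3 : 32 ≤ (E * (I.n + 1)) ^ 5 := by
      calc 32 = 2 ^ 5 := by norm_num
        _ ≤ _ := Nat.pow_le_pow_left h2 5
    calc (3 * I.N + 4) * (E * 2) * (I.n + 1) ≤ (16 * (I.n + 1)) * (E * 2) * (I.n + 1) := by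
          gcongr
          omega
      _ = 32 * ((E * (I.n + 1)) * (I.n + 1)) := by ring
      _ ≤ (E * (I.n + 1)) ^ 5 * ((E * (I.n + 1)) * (E * (I.n + 1))) := by
          gcongr
          nlinarith
      _ = (E * (I.n + 1)) ^ 7 := by ring
      _ ≤ (E * (I.n + 1)) ^ 10 := Nat.pow_le_pow_right (by omega) (by norm_num)
  · calc I.n ^ 2 ≤ (E * (I.n + 1)) ^ 2 := Nat.pow_le_pow_left (by nlinarith) 2
      _ ≤ (E * (I.n + 1)) ^ 10 := Nat.pow_le_pow_right (by positivity) (by norm_num)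

/-- The sum of the time bounds of the ten parts of the algorithm. -/
lemma time_le {n N m t W E M τ d : ℕ} (hn : 1 ≤ n) (hN : N ≤ 4 * (n + 1)) (hm : m ≤ n ^ 2)
    (hE : 2 ^ t = E) (hW : W ≤ 2 * E) (hM : M = E * n ^ 2) (hd : d ≤ 2 * N * (W * (n + 1)) + 1)
    (hτ : τ ≤ 97 + N * (20 + n * 40 + 7) + N * (n * 30 + 5 + (t + 1) * (n * 30 + 5) + 7) +
      N * (W * 30 + 10 + 7) + N * 10 + m * (50 + W * 70 + 7) + N * (N * 20 + 20) +
      (N * (N * 40 + 40) + W * (n * 600) * N + W * 200 * (n + N) ^ 2) + W * (n * 350) +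
      d * 40 + N * (W * (n * 50 + 50))) : τ ≤ 100000 * M := by
  have hN8 : N ≤ 8 * n := by omega
  have ht : t + 1 ≤ E := hE ▸ Nat.lt_two_pow_self
  have hE1 : 1 ≤ E := by omega
  have h1 : 1 ≤ n * n := Nat.mul_pos hn hn
  have a1 : n * n ≤ M := by rw [hM]; nlinarith
  have a2 : n ≤ M := by nlinarith
  have b1 : N * n ≤ 8 * M := by nlinarith
  have b2 : N ≤ 8 * M := by omega
  have b3 : N * N ≤ 64 * M := by nlinarith
  have c0 : E * (n * n) = M := by rw [hM]; ring
  have c1 : W * (n * n) ≤ 2 * M := by nlinarith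
  have c2 : W * (n * N) ≤ 16 * M := by
    calc W * (n * N) ≤ W * (n * (8 * n)) := by gcongr
      _ = 8 * (W * (n * n)) := by ring
      _ ≤ _ := by omega
  have c3 : W * (N * N) ≤ 128 * M := by
    calc W * (N * N) ≤ W * (8 * n * (8 * n)) := by gcongr
      _ = 64 * (W * (n * n)) := by ring
      _ ≤ _ := by omega
  have c4 : W * N ≤ 16 * M := by
    refine le_trans ?_ c2
    gcongr
    exact Nat.le_mul_of_pos_left _ hn
  have c5 : W * n ≤ 2 * M := by
    refine le_trans ?_ c1
    gcongr
    exact Nat.le_mul_of_pos_left _ hn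
  have d1 : m ≤ M := by nlinarith
  have d2 : m * W ≤ 2 * M := by
    refine le_trans ?_ c1
    rw [mul_comm]
    gcongr
    rwa [← sq]
  have e1 : (t + 1) * (n * N) ≤ 8 * M := by
    calc (t + 1) * (n * N) ≤ E * (n * (8 * n)) := by gcongr
      _ = 8 * (E * (n * n)) := by ring
      _ = _ := by rw [c0]
  have e2 : (t + 1) * N ≤ 8 * M := by
    refine le_trans ?_ e1
    gcongr
    exact Nat.le_mul_of_pos_left _ hn
  linarith

/-- Started with an input in an otherwise empty memory, the algorithm outputs an optimal
bisection. -/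
lemma solve_spec (hB : I.Fit B) (hI : I.Input s) (h4 : s.reg 4 = 0)
    (h0 : ∀ a c, 4 ≤ a → s.arr a c = 0) (hw : ∀ c, s.warr 1 c = 0) :
    WP B solve s 0 fun s' t' => I.Output s' ∧ t' ≤ 100000 * (2 ^ I.t * I.n ^ 2) := by
  simp only [solve, wp_seq]
  refine (positions_spec hB hI h4).mono ?_
  rintro s₁ t₁ ha₁ ⟨⟨W, hI₁⟩, ht₁⟩
  refine (pairs_spec hB hI₁.toInput).mono ?_
  rintro s₂ t₂ ha₂ ⟨h7, ht₂⟩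
  have hI₂ := hI₁.agree ha₂ rfl
  -- each arc is charged to the common node that the preprocessing has found for its ends
  have hnd : I.IsNode fun a => s₂.arr 7 (I.tail a * I.n + I.head a) := by
    intro a ha
    obtain ⟨i, hi, h1, h2⟩ := I.arc a ha
    exact h7 i _ _ hi h1 h2
  refine (leaves_spec hB hI₂ fun c => ?_).mono ?_
  · rw [ha₂.arr 8 rfl, ha₁.arr 8 rfl, h0 8 c (by omega)]
  rintro s₃ t₃ ha₃ ⟨h8, ht₃⟩
  have hI₃ := hI₂.agree ha₃ rfl
  refine (tables_spec hB hI₃.toInput).mono ?_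
  rintro s₄ t₄ ha₄ ⟨h9, ht₄⟩
  have hI₄ := hI₃.agree ha₄ rfl
  refine (arcs_spec hB hI₄ hnd (fun a ha => ?_) fun c => ?_).mono ?_
  · rw [ha₄.arr 7 rfl, ha₃.arr 7 rfl]
  · rw [ha₄.warr 1 rfl, ha₃.warr 1 rfl, ha₂.warr 1 rfl, ha₁.warr 1 rfl, hw]
  rintro s₅ t₅ ha₅ ⟨hval, ht₅⟩
  have hI₅ := hI₄.agree ha₅ rfl
  refine (depths_spec hB hI₅.toInput).mono ?_
  rintro s₆ t₆ ha₆ ⟨h10, ht₆⟩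
  have hI₆ := hI₅.agree ha₆ rfl
  obtain ⟨den, hH, htab⟩ := exists_heap (s := s₆) (nd := fun a => _) hI₆ (by
      unfold Shows
      rw [ha₆.arr 8 rfl, ha₅.arr 8 rfl, ha₄.arr 8 rfl]
      exact h8) (by
    rw [ha₆.warr 1 rfl]
    exact hval)
  refine (dynamic_spec hB hI₆ hnd h10 hH (fun i hi => ?_) (fun i => ?_) htab).mono ?_
  · rw [ha₆.arr 9 rfl, ha₅.arr 9 rfl, h9 i hi]
  · rw [ha₆.arr 11 rfl, ha₅.arr 11 rfl, ha₄.arr 11 rfl, ha₃.arr 11 rfl, ha₂.arr 11 rfl,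
      ha₁.arr 11 rfl, h0 11 i (by omega)]
  rintro s₇ t₇ ha₇ ⟨⟨comp, den₇, done, hD, hdone⟩, ht₇⟩
  have hI₇ := hI₆.agree ha₇ rfl
  refine (choose_spec hB hI₇ hnd hD hdone).mono ?_
  rintro s₈ t₈ ha₈ ⟨⟨den₈, g, hg, hg', hH₈, e30, e35, hd8, hbal, hcut, hopt⟩, ht₈⟩
  have hI₈ := hI₇.agree ha₈ rfl
  have hzero : ∀ a c, 4 ≤ a → positions.setsArr a = false → pairs.setsArr a = false →
      leaves.setsArr a = false → tables.setsArr a = false → arcs.setsArr a = false →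
      depths.setsArr a = false → dynamic.setsArr a = false → choose.setsArr a = false →
      s₈.arr a c = 0 := by
    intro a c ha b1 b2 b3 b4 b5 b6 b7 b8
    rw [ha₈.arr a b8, ha₇.arr a b7, ha₆.arr a b6, ha₅.arr a b5, ha₄.arr a b4, ha₃.arr a b3,
      ha₂.arr a b2, ha₁.arr a b1, h0 a c ha]
  have hW1 : 1 ≤ W := Nat.one_le_two_pow.trans (hI₈.sz_le _ I.root_lt)
  have hone := I.one_le
  have hdB : I.cell W g 0 0 + 1 ≤ B :=
    (hB.cell_le hI₈.W_le (T := g) (S := 0) (k := 1) (by omega) (by omega) (by omega)).2.2.2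
  refine (follow_spec hB hI₈ hH₈ e30 e35 (by unfold cell; gcongr) hdB hd8 fun c =>
    hzero 14 c (by omega) rfl rfl rfl rfl rfl rfl rfl rfl).mono ?_
  rintro s₉ t₉ ha₉ ⟨hM, ht₉⟩
  have hI₉ := hI₈.agree ha₉ rfl
  refine (collect_spec hB hI₉ (hH₈.congr (ha₉.arr 8 rfl) (ha₉.arr 12 rfl) (ha₉.arr 13 rfl))
    ((ha₉.reg 30 rfl).trans e30) ((ha₉.reg 35 rfl).trans e35) (by omega) hM fun v => ?_).mono ?_
  · rw [ha₉.arr 4 rfl]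
    exact hzero 4 v (by omega) rfl rfl rfl rfl rfl rfl rfl rfl
  rintro s' t' - ⟨⟨hout, hval'⟩, ht'⟩
  rw [ha₉.warr 1 rfl] at hval'
  refine ⟨⟨_, hbal, fun U hU => hcut ▸ hopt U hU, fun v _ => hout v, hval'.trans hcut⟩, ?_⟩
  have hd : I.cell W g 0 0 + 1 - I.cell W I.N 0 0 ≤ 2 * I.N * (W * (I.n + 1)) + 1 := by
    have h1 : g * (W * (I.n + 1)) ≤ (2 * I.N + I.N) * (W * (I.n + 1)) :=
      Nat.mul_le_mul_right _ (by omega)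
    rw [add_mul] at h1
    simp only [cell, add_zero, mul_assoc] at h1 ⊢
    omega
  refine time_le hone I.N_le I.m_le rfl (W := W) ((hI₈.W_le).trans_eq (pow_succ' 2 _)) rfl hd ?_
  omega

end Inst

end MaxBisection

theorem mainTheorem2 :
    ∃ (P : WordRAM.Prog) (C c : ℕ),
      ∀ (n N : ℕ) (E : Finset (Fin n × Fin n)) (w : Fin n × Fin n → ℚ)
        (arcs : List (Fin n × Fin n)) (D : TreeDecomposition E (Fin N)),
        1 ≤ n → arcs.Nodup → arcs.toFinset = E → D.IsSmall →
        ∃ (T : ℕ) (s : WordRAM.State),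
          WordRAM.Exec ((2 ^ D.width * (n + 1)) ^ c) P (inputState arcs w D) T s ∧
          T ≤ C * (2 ^ D.width * n ^ 2) ∧
          IsCorrectOutput E w s := by
  refine ⟨MaxBisection.solve, 100000, 10, fun n N E w arcs D hn hnd hE hD => ?_⟩
  obtain ⟨T, s, hexec, hout, hT⟩ := MaxBisection.Inst.solve_spec
    (MaxBisection.instOf arcs w D hn hnd hE hD).fit_pow
    (MaxBisection.input_instOf hn hnd hE hD) rfl (by
      intro a c ha
      obtain ⟨a, rfl⟩ := Nat.exists_eq_add_of_le' ha
      rfl) fun c => rfl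
  rw [zero_add] at hT
  exact ⟨T, s, hexec, hT, MaxBisection.isCorrectOutput_of_output hn hnd hE hD hout⟩
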